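/- Throughout, manifolds are smooth, finite-dimensional, Hausdorff, second countable and without boundary, and $\mathbb R^\times$ is the multiplicative group of non-zero reals. **Conventions.** A *contact manifold* $(M,C)$ is a manifold with a smooth distribution $C\subset TM$ of hyperplanes such that $C\times_M C\to TM/C$, $(X,Y)\mapsto[X,Y]\bmod C$, is non-degenerate. A *symplectic cover* of $(M,C)$ is a principal $\mathbb R^\times$-bundle $\tau:P\to M$, with action $h_s$, and a symplectic form $\omega$ on $P$ with $h_s^*\omega=s\,\omega$ for all $s\in\mathbb R^\times$, such that $C=T\tau(\ker\theta)$, where $\nabla$ is the generator of the action $s\mapsto h_s$ (the Liouville vector field) and $\theta=i_\nabla\omega$. Given a Riemannian metric $g_M$ on $M$, the *induced calibration* is the function $\mathfrak s:P\to\mathbb R_{+}$, $$\mathfrak s(p)=\frac{|\theta_p(w)|}{\|T\tau(w)\|_{g_M}}\quad\text{for any } w\in T_pP\text{ with } 0\ne T\tau(w)\perp C_{\tau(p)},$$ and the *induced metric* on $P$ is $\widetilde{g_M}=\mathfrak s\big((d\mathfrak s/\mathfrak s)^2+\tau^*g_M\big)$. The triple $(M,C,g_M)$ is an *almost Sasakian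 manifold* if $(\omega,\widetilde{g_M})$ is almost Kähler, that is, the $(1,1)$-tensor $J$ given by $\widetilde{g_M}(X,Y)=\omega(X,JY)$ satisfies $J^2=-\mathrm{id}$; it is *Sasakian* if moreover the Nijenhuis torsion of $J$ vanishes. Then $(P,\omega,\widetilde{g_M})$ is called the *Kählerianization* of $(M,C,g_M)$. **Theorem (Sasakian products).** For $i=1,2$ let $(P_i,\omega_i,g_i)$, with projection $\tau_i:P_i\to M_i$, be the Kählerianization of an almost Sasakian manifold $(M_i,C_i,g_{M_i})$, with induced calibration $\mathfrak s_i$. 1. The orbit space $M=M_1\times^!M_2=(P_1\times P_2)/\mathbb R^\times$ of the diagonal action is Hausdorff and second countable, and it carries a smooth structure of dimension $\dim M_1+\dim M_2+1$ for which the projection $\tau:P_1\times P_2\to M$ is a principal $\mathbb R^\times$-bundle. Items 2 to 4 hold for every such smooth structure. 2. There is exactly one pair $(C,g_M)$ of a contact distribution $C$ and a Riemannian metric $g_M$ on $M$ such that $(M,C,g_M)$ is almost Sasakian with symplectic cover $(P_1\times P_2,\omega_1\oplus\omega_2)$ and $(P_1\times P_2,\ \omega_1\oplus\omega_2,\ g_1\oplus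 g_2)$ is its Kählerianization. 3. If $(M_1,C_1,g_{M_1})$ and $(M_2,C_2,g_{M_2})$ are Sasakian, then so is $(M,C,g_M)$. 4. The functions $\mathfrak s_1,\mathfrak s_2$ are positive, and the induced calibration of $(C,g_M)$ is $\mathfrak s(p_1,p_2)=\mathfrak s_1(p_1)+\mathfrak s_2(p_2)$. The $1$-form $$\beta=\frac1{\mathfrak s_1+\mathfrak s_2}\Big(\sqrt{\tfrac{\mathfrak s_2}{\mathfrak s_1}}\;d\mathfrak s_1-\sqrt{\tfrac{\mathfrak s_1}{\mathfrak s_2}}\;d\mathfrak s_2\Big)$$ on $P_1\times P_2$ is $\mathbb R^\times$-invariant and equals $\tau^*\beta_0$ for a smooth $1$-form $\beta_0$ on $M$, and $$g_M=\beta_0^2+\frac{\mathfrak s_1}{\mathfrak s}\,g_{M_1}+\frac{\mathfrak s_2}{\mathfrak s}\,g_{M_2},$$ where this identity is read after pullback to $P_1\times P_2$ (the pullback of $g_{M_i}$ being taken along $(p_1,p_2)\mapsto\tau_i(p_i)$). -/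

import Mathlib

open Set Manifold Bundle Topology VectorField
open scoped ContDiff

noncomputable section

namespace SasakianProduct

/-! ### Tensor fields on a manifold -/

section Tensors

variable {E : Type*} [NormedAddCommGroup E] [NormedSpace ℝ E]
  {H : Type*} [TopologicalSpace H] (I : ModelWithCorners ℝ E H)
  (M : Type*) [TopologicalSpace M] [ChartedSpace H M]

/-- (Not necessarily continuous) 1-forms on `M`. -/
abbrev OneForm := (x : M) → TangentSpace I x →L[ℝ] ℝ

/-- (Not necessarily continuous) covariant 2-tensor fields on `M`. -/
abbrev TwoTensor := (x : M) → TangentSpace I x →L[ℝ] TangentSpace I x →L[ℝ] ℝ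

/-- (Not necessarily continuous) distributions on `M`, as families of subspaces of the tangent
spaces. -/
abbrev Distribution := (x : M) → Submodule ℝ (TangentSpace I x)

/-- (Not necessarily continuous) (1,1)-tensor fields on `M`. -/
abbrev EndField := (x : M) → TangentSpace I x →L[ℝ] TangentSpace I x

/-- (Not necessarily continuous) vector fields on `M`. -/
abbrev VField := (x : M) → TangentSpace I x

variable {M} [IsManifold I ∞ M]

/-- The vector field `X` is smooth at `x`. -/
def VField.SmoothAt (X : VField I M) (x : M) : Prop :=
  ContMDiffAt I I.tangent ∞ (fun y ↦ (⟨y, X y⟩ : TangentBundle I M)) x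

/-- The 1-form `η` is smooth on the set `U`. -/
def OneForm.SmoothOn (η : OneForm I M) (U : Set M) : Prop :=
  ContMDiffOn I (I.prod 𝓘(ℝ, E →L[ℝ] ℝ)) ∞
    (fun y ↦ TotalSpace.mk' (E →L[ℝ] ℝ) (E := fun y : M ↦ TangentSpace I y →L[ℝ] ℝ) y (η y)) U

/-- The covariant 2-tensor field `K` is smooth. -/
def TwoTensor.Smooth (K : TwoTensor I M) : Prop :=
  ContMDiff I (I.prod 𝓘(ℝ, E →L[ℝ] E →L[ℝ] ℝ)) ∞
    (fun y ↦ TotalSpace.mk' (E →L[ℝ] E →L[ℝ] ℝ)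
      (E := fun y : M ↦ TangentSpace I y →L[ℝ] TangentSpace I y →L[ℝ] ℝ) y (K y))

/-- `g` is a smooth Riemannian metric on `M`. -/
def IsRiemannianMetric (g : TwoTensor I M) : Prop :=
  ∃ G : ContMDiffRiemannianMetric I ∞ E (fun x : M ↦ TangentSpace I x), ∀ x, G.inner x = g x

/-- The 2-form `Ω` is closed: `dΩ = 0`, where `dΩ` is given by the invariant formula
`dΩ(X, Y, Z) = X Ω(Y,Z) - Y Ω(X,Z) + Z Ω(X,Y) - Ω([X,Y],Z) + Ω([X,Z],Y) - Ω([Y,Z],X)`. -/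
def IsClosedForm (Ω : TwoTensor I M) : Prop :=
  ∀ (x : M) (X Y Z : VField I M),
    VField.SmoothAt I X x → VField.SmoothAt I Y x → VField.SmoothAt I Z x →
    mvfderiv I (fun y ↦ Ω y (Y y) (Z y)) x (X x)
      - mvfderiv I (fun y ↦ Ω y (X y) (Z y)) x (Y x)
      + mvfderiv I (fun y ↦ Ω y (X y) (Y y)) x (Z x)
      - Ω x (mlieBracket I X Y x) (Z x)
      + Ω x (mlieBracket I X Z x) (Y x)
      - Ω x (mlieBracket I Y Z x) (X x) = 0

/-- Symplectic forms: smooth, skew-symmetric, non-degenerate and closed. -/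
structure IsSymplecticForm (Ω : TwoTensor I M) : Prop where
  smooth : TwoTensor.Smooth I Ω
  alternating : ∀ x (v : TangentSpace I x), Ω x v v = 0
  nondegenerate : ∀ x (v : TangentSpace I x), (∀ w, Ω x v w = 0) → v = 0
  closed : IsClosedForm I Ω

/-- `C` is a smooth distribution of hyperplanes: locally the kernel of a smooth nowhere-vanishing
1-form. -/
def IsHyperplaneDistribution (C : Distribution I M) : Prop :=
  ∀ x : M, ∃ U : Set M, IsOpen U ∧ x ∈ U ∧ ∃ η : OneForm I M, OneForm.SmoothOn I η U ∧
    ∀ y ∈ U, η y ≠ 0 ∧ C y = LinearMap.ker (η y).toLinearMap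

/-- Contact distributions: smooth hyperplane distributions `C` for which the form
`W_C : C × C → TM / C`, `W_C(X, Y) = [X, Y] mod C`, is non-degenerate. (The form is tensorial, so
its value at `x` is computed by any sections `X`, `Y` of `C` near `x`.) -/
structure IsContactDistribution (C : Distribution I M) : Prop where
  hyperplane : IsHyperplaneDistribution I C
  nondegenerate : ∀ (x : M) (v : TangentSpace I x), v ∈ C x →
    (∀ X Y : VField I M, VField.SmoothAt I X x → VField.SmoothAt I Y x →
      (∀ᶠ y in 𝓝 x, X y ∈ C y) → (∀ᶠ y in 𝓝 x, Y y ∈ C y) → X x = v →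
      mlieBracket I X Y x ∈ C x) → v = 0

/-- `J` is the almost complex structure relating `Ω` and `g`:
`g(X, Y) = Ω(X, J Y)` and `J² = -id`. -/
def IsCompatibleStructure (Ω g : TwoTensor I M) (J : EndField I M) : Prop :=
  (∀ x (v w : TangentSpace I x), g x v w = Ω x v (J x w)) ∧
    ∀ x (v : TangentSpace I x), J x (J x v) = -v

/-- Almost Kähler structures: a symplectic form and a compatible Riemannian metric. -/
structure IsAlmostKahler (Ω g : TwoTensor I M) : Prop where
  symplectic : IsSymplecticForm I Ω
  riemannian : IsRiemannianMetric I g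
  compatible : ∃ J : EndField I M, IsCompatibleStructure I Ω g J

/-- The almost complex structure `J` is integrable: its Nijenhuis torsion
`([JX,JY] - [X,Y]) - J([JX,Y] + [X,JY])` vanishes. -/
def IsIntegrable (J : EndField I M) : Prop :=
  ∀ (x : M) (X Y : VField I M), VField.SmoothAt I X x → VField.SmoothAt I Y x →
    (mlieBracket I (fun y ↦ J y (X y)) (fun y ↦ J y (Y y)) x - mlieBracket I X Y x)
      - J x (mlieBracket I (fun y ↦ J y (X y)) Y x + mlieBracket I X (fun y ↦ J y (Y y)) x) = 0

/-- Kähler structures: almost Kähler structures whose (unique) almost complex structure is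
integrable. -/
structure IsKahler (Ω g : TwoTensor I M) : Prop extends IsAlmostKahler I Ω g where
  integrable : ∃ J : EndField I M, IsCompatibleStructure I Ω g J ∧ IsIntegrable I J

end Tensors

/-! ### Pullbacks and products of tensor fields -/

section Pullback

variable {E : Type*} [NormedAddCommGroup E] [NormedSpace ℝ E]
  {H : Type*} [TopologicalSpace H] (I : ModelWithCorners ℝ E H)
  {M : Type*} [TopologicalSpace M] [ChartedSpace H M]
  {E' : Type*} [NormedAddCommGroup E'] [NormedSpace ℝ E']
  {H' : Type*} [TopologicalSpace H'] (I' : ModelWithCorners ℝ E' H')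
  {M' : Type*} [TopologicalSpace M'] [ChartedSpace H' M']

/-- The pullback `f^* α` of a 1-form. -/
def OneForm.pullback (f : M → M') (α : OneForm I' M') : OneForm I M :=
  fun x ↦ (α (f x)).comp (mfderiv I I' f x)

/-- The pullback `f^* K` of a covariant 2-tensor field. -/
def TwoTensor.pullback (f : M → M') (K : TwoTensor I' M') : TwoTensor I M :=
  fun x ↦ (ContinuousLinearMap.precomp ℝ (mfderiv I I' f x)).comp
    ((K (f x)).comp (mfderiv I I' f x))

theorem TwoTensor.pullback_apply (f : M → M') (K : TwoTensor I' M') (x : M)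
    (v w : TangentSpace I x) :
    TwoTensor.pullback I I' f K x v w = K (f x) (mfderiv I I' f x v) (mfderiv I I' f x w) := rfl

/-- The tensor square `α ⊗ α` of a 1-form. -/
def OneForm.sq (α : OneForm I M) : TwoTensor I M := fun x ↦ (α x).smulRight (α x)

theorem OneForm.sq_apply (α : OneForm I M) (x : M) (v w : TangentSpace I x) :
    OneForm.sq I α x v w = α x v * α x w := rfl

/-- The direct sum `K ⊕ K' = pr₁^* K + pr₂^* K'` on the product of two manifolds. -/
def TwoTensor.prod (K : TwoTensor I M) (K' : TwoTensor I' M') :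
    TwoTensor (I.prod I') (M × M') :=
  fun x ↦ TwoTensor.pullback (I.prod I') I Prod.fst K x
    + TwoTensor.pullback (I.prod I') I' Prod.snd K' x

end Pullback

/-! ### Principal bundles, symplectic covers, Sasakian structures

Here `P` is a manifold with an action of the group `ℝˣ` and `τ : P → M` is the projection. -/

section Bundles

variable {EP : Type*} [NormedAddCommGroup EP] [NormedSpace ℝ EP]
  {HP : Type*} [TopologicalSpace HP] (IP : ModelWithCorners ℝ EP HP)
  {P : Type*} [TopologicalSpace P] [ChartedSpace HP P] [MulAction ℝˣ P]
  {E : Type*} [NormedAddCommGroup E] [NormedSpace ℝ E]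
  {H : Type*} [TopologicalSpace H] (I : ModelWithCorners ℝ E H)
  {M : Type*} [TopologicalSpace M] [ChartedSpace H M]

/-- `τ : P → M` is a smooth principal `ℝˣ`-bundle: near every point of `M` there is a smooth
equivariant local trivialization `τ⁻¹(U) ≃ U × ℝˣ`. -/
def IsPrincipalBundle (τ : P → M) : Prop :=
  ∀ x : M, ∃ e : Trivialization ℝˣ τ, x ∈ e.baseSet ∧
    ContMDiffOn IP (I.prod 𝓘(ℝ, ℝ)) ∞ e e.source ∧
    ContMDiffOn (I.prod 𝓘(ℝ, ℝ)) IP ∞ e.toOpenPartialHomeomorph.symm e.target ∧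
    ∀ p ∈ e.source, ∀ s : ℝˣ, s • p ∈ e.source ∧ e (s • p) = ((e p).1, s * (e p).2)

/-- The Liouville vector field `∇`, the infinitesimal generator of the action: `∇(p)` is the
derivative of `s ↦ s • p` at `s = 1` in the direction `1`. -/
def liouville : VField IP P :=
  fun p ↦ mfderiv 𝓘(ℝ, ℝ) IP (fun s : ℝˣ ↦ s • p) 1 (1 : ℝ)

/-- The Liouville 1-form `θ = i_∇ Ω`. -/
def liouvilleForm (Ω : TwoTensor IP P) : OneForm IP P := fun p ↦ Ω p (liouville IP p)

/-- `K` is homogeneous (of degree 1): `h_s^* K = s K` for all `s ∈ ℝˣ`. -/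
def TwoTensor.IsHomogeneous (K : TwoTensor IP P) : Prop :=
  ∀ (s : ℝˣ) (p : P), TwoTensor.pullback IP IP (fun q ↦ s • q) K p = (s : ℝ) • K p

/-- The calibration on `P` induced by a metric `g` on `M`: `p ∈ P` is viewed, by means of the
Liouville form, as the functional on the line `T_xM / C_x ≃ C_x^⊥`, `x = τ(p)`, that maps `Tτ(w)`
to `θ(w)`, and `𝔰(p)` is its norm, i.e. the value of `|θ(w)| / ‖Tτ(w)‖` for any `w` such that
`Tτ(w)` is non-zero and orthogonal to `C_x`. -/
def inducedCalibration (τ : P → M) (Ω : TwoTensor IP P) (C : Distribution I M)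
    (g : TwoTensor I M) (p : P) : ℝ :=
  sSup {r : ℝ | ∃ w : TangentSpace IP p, mfderiv IP I τ p w ≠ 0 ∧
    (∀ c ∈ C (τ p), g (τ p) (mfderiv IP I τ p w) c = 0) ∧
    r = |liouvilleForm IP Ω p w| /
      Real.sqrt (g (τ p) (mfderiv IP I τ p w) (mfderiv IP I τ p w))}

/-- The metric on `P` induced by a metric `g` on `M`: `(d𝔰)² / 𝔰 + 𝔰 τ^* g`, where `𝔰` is the
induced calibration. -/
def inducedMetric (τ : P → M) (Ω : TwoTensor IP P) (C : Distribution I M)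
    (g : TwoTensor I M) : TwoTensor IP P :=
  fun p ↦
    (inducedCalibration IP I τ Ω C g p)⁻¹ •
      OneForm.sq IP (fun q ↦ mvfderiv IP (inducedCalibration IP I τ Ω C g) q) p
    + inducedCalibration IP I τ Ω C g p • TwoTensor.pullback IP I τ g p

variable [IsManifold IP ∞ P] [IsManifold I ∞ M]

/-- `τ : (P, Ω) → (M, C)` is a symplectic cover of a contact manifold: a principal `ℝˣ`-bundle with
a homogeneous symplectic form such that the contact distribution `C` is the projection of the
kernel of the Liouville 1-form. -/
structure IsSymplecticCover (τ : P → M) (Ω : TwoTensor IP P) (C : Distribution I M) : Prop where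
  principal : IsPrincipalBundle IP I τ
  symplectic : IsSymplecticForm IP Ω
  homogeneous : TwoTensor.IsHomogeneous IP Ω
  contact : IsContactDistribution I C
  projection : ∀ p : P, C (τ p) =
    (LinearMap.ker (liouvilleForm IP Ω p).toLinearMap).map (mfderiv IP I τ p).toLinearMap

/-- `(M, C, g)`, with symplectic cover `τ : (P, Ω) → (M, C)`, is an almost Sasakian manifold: `g` is
a Riemannian metric on `M` and the induced metric on `P` is compatible with `Ω`. -/
structure IsAlmostSasakian (τ : P → M) (Ω : TwoTensor IP P) (C : Distribution I M)
    (g : TwoTensor I M) : Prop where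
  cover : IsSymplecticCover IP I τ Ω C
  riemannian : IsRiemannianMetric I g
  almostKahler : IsAlmostKahler IP Ω (inducedMetric IP I τ Ω C g)

/-- `(M, C, g)`, with symplectic cover `τ : (P, Ω) → (M, C)`, is a Sasakian manifold: it is almost
Sasakian and the induced metric together with `Ω` is a Kähler structure. -/
structure IsSasakian (τ : P → M) (Ω : TwoTensor IP P) (C : Distribution I M)
    (g : TwoTensor I M) : Prop extends IsAlmostSasakian IP I τ Ω C g where
  kahler : IsKahler IP Ω (inducedMetric IP I τ Ω C g)

/-- `(P, Ω, gP)` is the Kählerianization of the almost Sasakian manifold `(M, C, g)`. -/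
structure IsKahlerianization (τ : P → M) (Ω gP : TwoTensor IP P) (C : Distribution I M)
    (g : TwoTensor I M) : Prop where
  almostSasakian : IsAlmostSasakian IP I τ Ω C g
  metric_eq : gP = inducedMetric IP I τ Ω C g

end Bundles

/-! ### The product of two `ℝˣ`-bundles -/

section Product

variable (P₁ P₂ : Type*) [MulAction ℝˣ P₁] [MulAction ℝˣ P₂]

/-- The base `M₁ ×^! M₂` of the product `P₁ ×^! P₂`: the orbit space of `P₁ × P₂` for the diagonal
action of `ℝˣ` (with the quotient topology). -/
abbrev ProductBase : Type _ := MulAction.orbitRel.Quotient ℝˣ (P₁ × P₂)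

/-- The projection `P₁ ×^! P₂ → M₁ ×^! M₂`. -/
def productProj (p : P₁ × P₂) : ProductBase P₁ P₂ :=
  Quotient.mk (MulAction.orbitRel ℝˣ (P₁ × P₂)) p

variable {P₁ P₂}
  {E₁ : Type*} [NormedAddCommGroup E₁] [NormedSpace ℝ E₁]
  {H₁ : Type*} [TopologicalSpace H₁] (I₁ : ModelWithCorners ℝ E₁ H₁)
  [TopologicalSpace P₁] [ChartedSpace H₁ P₁]
  {E₂ : Type*} [NormedAddCommGroup E₂] [NormedSpace ℝ E₂]
  {H₂ : Type*} [TopologicalSpace H₂] (I₂ : ModelWithCorners ℝ E₂ H₂)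
  [TopologicalSpace P₂] [ChartedSpace H₂ P₂]

/-- For functions `s₁` on `P₁` and `s₂` on `P₂`, the 1-form
`β = (s₁ + s₂)⁻¹ (√(s₂ / s₁) ds₁ - √(s₁ / s₂) ds₂)` on `P₁ × P₂`. -/
def productBeta (s₁ : P₁ → ℝ) (s₂ : P₂ → ℝ) : OneForm (I₁.prod I₂) (P₁ × P₂) :=
  fun p ↦ (s₁ p.1 + s₂ p.2)⁻¹ •
    (Real.sqrt (s₂ p.2 / s₁ p.1) •
        OneForm.pullback (I₁.prod I₂) I₁ Prod.fst (fun q ↦ mvfderiv I₁ s₁ q) p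
      - Real.sqrt (s₁ p.1 / s₂ p.2) •
        OneForm.pullback (I₁.prod I₂) I₂ Prod.snd (fun q ↦ mvfderiv I₂ s₂ q) p)

end Product

end SasakianProduct

end

open SasakianProduct

noncomputable section

namespace SasakianProduct

section FlatTensors

variable {E : Type*} [NormedAddCommGroup E] [NormedSpace ℝ E]
  {H : Type*} [TopologicalSpace H] {I : ModelWithCorners ℝ E H}
  {M : Type*} [TopologicalSpace M] [ChartedSpace H M]
  {E' : Type*} [NormedAddCommGroup E'] [NormedSpace ℝ E']
  {H' : Type*} [TopologicalSpace H'] {I' : ModelWithCorners ℝ E' H'}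
  {M' : Type*} [TopologicalSpace M'] [ChartedSpace H' M']
  {V : Type*} [NormedAddCommGroup V] [NormedSpace ℝ V]
  {V' : Type*} [NormedAddCommGroup V'] [NormedSpace ℝ V']

/-- The pullback of a covariant 2-tensor field to a vector space, as a function with values in
the space of bilinear forms. -/
def TwoTensor.flat (K : TwoTensor I M) (f : V → M) (v : V) : V →L[ℝ] V →L[ℝ] ℝ :=
  TwoTensor.pullback 𝓘(ℝ, V) I f K v

/-- The pullback of a 1-form to a vector space, as a function with values in the dual space. -/
def OneForm.flat (η : OneForm I M) (f : V → M) (v : V) : V →L[ℝ] ℝ :=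
  OneForm.pullback 𝓘(ℝ, V) I f η v

theorem TwoTensor.flat_apply (K : TwoTensor I M) (f : V → M) (v a b : V) :
    K.flat f v a b = K (f v) (mfderiv 𝓘(ℝ, V) I f v a) (mfderiv 𝓘(ℝ, V) I f v b) := rfl

theorem OneForm.flat_apply (η : OneForm I M) (f : V → M) (v a : V) :
    η.flat f v a = η (f v) (mfderiv 𝓘(ℝ, V) I f v a) := rfl

theorem TwoTensor.congr_point (K : TwoTensor I M) {x y : M} (h : x = y) (v w : E) :
    K x v w = K y v w := by
  subst h; rfl

theorem OneForm.congr_point (η : OneForm I M) {x y : M} (h : x = y) (v : E) :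
    η x v = η y v := by
  subst h; rfl

theorem TwoTensor.flat_congr (K : TwoTensor I M) {f g : V → M} {v : V} (h : f =ᶠ[𝓝 v] g) :
    K.flat f v = K.flat g v := by
  ext a b
  have := h.mfderiv_eq (I := 𝓘(ℝ, V)) (I' := I)
  have h0 := h.eq_of_nhds
  simp only [TwoTensor.flat_apply]
  rw [this]
  exact K.congr_point h0 _ _

theorem OneForm.flat_congr (K : OneForm I M) {f g : V → M} {v : V} (h : f =ᶠ[𝓝 v] g) :
    K.flat f v = K.flat g v := by
  ext a
  have := h.mfderiv_eq (I := 𝓘(ℝ, V)) (I' := I)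
  have h0 := h.eq_of_nhds
  simp only [OneForm.flat_apply]
  rw [this]
  exact K.congr_point h0 _

theorem TwoTensor.flat_pullback (K : TwoTensor I' M') {F : M → M'} {f : V → M} {v : V}
    (hF : MDifferentiableAt I I' F (f v)) (hf : MDifferentiableAt 𝓘(ℝ, V) I f v) :
    (TwoTensor.pullback I I' F K).flat f v = K.flat (F ∘ f) v := by
  ext a b
  simp only [TwoTensor.flat_apply, TwoTensor.pullback_apply]
  rw [mfderiv_comp v hF hf]
  rfl

theorem OneForm.flat_pullback (K : OneForm I' M') {F : M → M'} {f : V → M} {v : V}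
    (hF : MDifferentiableAt I I' F (f v)) (hf : MDifferentiableAt 𝓘(ℝ, V) I f v) :
    (OneForm.pullback I I' F K).flat f v = K.flat (F ∘ f) v := by
  ext a
  simp only [OneForm.flat_apply, OneForm.pullback]
  rw [mfderiv_comp v hF hf]
  rfl

theorem TwoTensor.flat_comp (K : TwoTensor I M) {f : V → M} {g : V' → V} {v : V'}
    (hf : MDifferentiableAt 𝓘(ℝ, V) I f (g v)) (hg : DifferentiableAt ℝ g v) (a b : V') :
    K.flat (f ∘ g) v a b = K.flat f (g v) (fderiv ℝ g v a) (fderiv ℝ g v b) := by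
  simp only [TwoTensor.flat_apply]
  rw [mfderiv_comp v hf hg.mdifferentiableAt, mfderiv_eq_fderiv]
  rfl

variable [IsManifold I ∞ M] [IsManifold I' ∞ M']

theorem contMDiffAt_mfderiv_apply {f : V → M} {a : V → V} {v₀ : V}
    (hf : ContMDiffAt 𝓘(ℝ, V) I ∞ f v₀) (ha : ContDiffAt ℝ ∞ a v₀) :
    ContMDiffAt 𝓘(ℝ, V) I.tangent ∞
      (fun v ↦ (⟨f v, mfderiv 𝓘(ℝ, V) I f v (a v)⟩ : TangentBundle I M)) v₀ := by
  have h1 := hf.mfderiv_const (m := ∞) (by simp)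
  refine ContMDiffAt.clm_apply_of_inCoordinates (b₁ := id) (b₂ := f)
    (E₁ := TangentSpace 𝓘(ℝ, V)) (E₂ := TangentSpace I) (F₁ := V) (F₂ := E)
    (IB₁ := 𝓘(ℝ, V)) (IB₂ := I) (v := a) (ϕ := fun v ↦ mfderiv 𝓘(ℝ, V) I f v) h1 ?_ hf
  exact contMDiffAt_vectorSpace_iff_contDiffAt.2 ha

theorem contDiffAt_clm_of_apply [FiniteDimensional ℝ V] {W D : Type*} [NormedAddCommGroup W]
    [NormedSpace ℝ W] [NormedAddCommGroup D] [NormedSpace ℝ D] {F : D → V →L[ℝ] W} {d : D}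
    (h : ∀ a, ContDiffAt ℝ ∞ (fun v ↦ F v a) d) : ContDiffAt ℝ ∞ F d := by
  let n := Module.finrank ℝ V
  have hn : n = Module.finrank ℝ (Fin n → ℝ) := (Module.finrank_fin_fun ℝ).symm
  let e₁ := ContinuousLinearEquiv.ofFinrankEq hn
  let e₂ := (e₁.arrowCongr (1 : W ≃L[ℝ] W)).trans (ContinuousLinearEquiv.piRing (Fin n))
  rw [← Function.id_comp F, ← e₂.symm_comp_self]
  exact e₂.symm.contDiff.contDiffAt.comp d (contDiffAt_pi.mpr fun i ↦ h _)

theorem TwoTensor.Smooth.contDiffAt_flat [FiniteDimensional ℝ V] {K : TwoTensor I M}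
    (hK : TwoTensor.Smooth I K) {f : V → M} {v₀ : V} (hf : ContMDiffAt 𝓘(ℝ, V) I ∞ f v₀) :
    ContDiffAt ℝ ∞ (K.flat f) v₀ := by
  refine contDiffAt_clm_of_apply fun a ↦ contDiffAt_clm_of_apply fun b ↦ ?_
  have h1 := ContMDiffAt.clm_bundle_apply₂ (E₁ := fun x : M ↦ TangentSpace I x)
    (E₂ := fun x : M ↦ TangentSpace I x) (E₃ := Bundle.Trivial M ℝ) (F₃ := ℝ)
    (b := f) (x := v₀) (ψ := fun v ↦ K (f v)) (IM := 𝓘(ℝ, V))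
    ((hK (f v₀)).comp v₀ hf) (contMDiffAt_mfderiv_apply hf (contDiffAt_const (c := a)))
    (contMDiffAt_mfderiv_apply hf (contDiffAt_const (c := b)))
  simp only [contMDiffAt_totalSpace] at h1
  exact h1.2.contDiffAt

theorem inCoordinates_dual_apply (x : M) {y : M} (α : TangentSpace I y →L[ℝ] ℝ) (w : E) :
    ContinuousLinearMap.inCoordinates E (fun y : M ↦ TangentSpace I y) ℝ (Bundle.Trivial M ℝ)
      x y x y α w = α ((trivializationAt E (TangentSpace I) x).symmL ℝ y w) := by
  simp [ContinuousLinearMap.inCoordinates]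

/-- A 1-form whose pullback by the inverse of the chart at `x` is smooth is smooth at `x`. -/
theorem OneForm.contMDiffAt_of_flat [I.Boundaryless] {η : OneForm I M} {x : M}
    (h : ContDiffAt ℝ ∞ (η.flat (extChartAt I x).symm) (extChartAt I x x)) :
    ContMDiffAt I (I.prod 𝓘(ℝ, E →L[ℝ] ℝ)) ∞
      (fun y ↦ TotalSpace.mk' (E →L[ℝ] ℝ) (E := fun y : M ↦ TangentSpace I y →L[ℝ] ℝ) y (η y))
      x := by
  have key := contMDiffAt_hom_bundle (n := ∞) (IM := I) (IB := I) (F₁ := E)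
    (E₁ := fun y : M ↦ TangentSpace I y)
    (F₂ := ℝ) (E₂ := Bundle.Trivial M ℝ) (x₀ := x)
    (fun y ↦ TotalSpace.mk' (E →L[ℝ] ℝ) (E := fun y : M ↦ TangentSpace I y →L[ℝ] ℝ) y (η y))
  refine key.2 ⟨contMDiffAt_id, ?_⟩
  have h2 : ContMDiffAt I 𝓘(ℝ, E →L[ℝ] ℝ) ∞
      (fun y ↦ η.flat (extChartAt I x).symm (extChartAt I x y)) x :=
    h.contMDiffAt.comp x contMDiffAt_extChartAt
  refine h2.congr_of_eventuallyEq ?_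
  filter_upwards [chart_source_mem_nhds H x] with y hy
  have h3 := TangentBundle.symmL_trivializationAt (I := I) hy
  rw [I.range_eq_univ, mfderivWithin_univ] at h3
  have h4 : (extChartAt I x).symm (extChartAt I x y) = y := (extChartAt I x).left_inv (by simpa)
  ext v
  exact (inCoordinates_dual_apply x (η y) v).trans
    ((congrArg (η y) (DFunLike.congr_fun h3 v)).trans (η.congr_point h4 _).symm)

/-- A covariant 2-tensor field whose pullbacks by the inverses of all charts are smooth is
smooth. -/
theorem TwoTensor.smooth_of_flat [I.Boundaryless] {K : TwoTensor I M}
    (h : ∀ x, ContDiffAt ℝ ∞ (K.flat (extChartAt I x).symm) (extChartAt I x x)) :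
    TwoTensor.Smooth I K := by
  intro x
  have key := contMDiffAt_hom_bundle (n := ∞) (IM := I) (IB := I) (F₁ := E)
    (E₁ := fun y : M ↦ TangentSpace I y)
    (F₂ := E →L[ℝ] ℝ) (E₂ := fun y : M ↦ TangentSpace I y →L[ℝ] ℝ) (x₀ := x)
    (fun y ↦ TotalSpace.mk' (E →L[ℝ] E →L[ℝ] ℝ)
      (E := fun y : M ↦ TangentSpace I y →L[ℝ] TangentSpace I y →L[ℝ] ℝ) y (K y))
  refine key.2 ⟨contMDiffAt_id, ?_⟩
  have h2 : ContMDiffAt I 𝓘(ℝ, E →L[ℝ] E →L[ℝ] ℝ) ∞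
      (fun y ↦ K.flat (extChartAt I x).symm (extChartAt I x y)) x :=
    (h x).contMDiffAt.comp x contMDiffAt_extChartAt
  refine h2.congr_of_eventuallyEq ?_
  filter_upwards [chart_source_mem_nhds H x] with y hy
  have h3 := TangentBundle.symmL_trivializationAt (I := I) hy
  rw [I.range_eq_univ, mfderivWithin_univ] at h3
  have h4 : (extChartAt I x).symm (extChartAt I x y) = y := (extChartAt I x).left_inv (by simpa)
  have hy' : y ∈ (trivializationAt (E →L[ℝ] ℝ) (fun y : M ↦ TangentSpace I y →L[ℝ] ℝ)
    x).baseSet := by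
    simpa [hom_trivializationAt_baseSet] using hy
  ext v w
  have h5 : ∀ α : TangentSpace I y →L[ℝ] ℝ,
      (trivializationAt (E →L[ℝ] ℝ) (fun y : M ↦ TangentSpace I y →L[ℝ] ℝ) x).continuousLinearMapAt
        ℝ y α w = α (mfderiv 𝓘(ℝ, E) I (extChartAt I x).symm (extChartAt I x y) w) := by
    intro α
    rw [Trivialization.continuousLinearMapAt_apply, Trivialization.linearMapAt_apply, if_pos hy',
      hom_trivializationAt_apply]
    exact (inCoordinates_dual_apply x α w).trans (congrArg α (DFunLike.congr_fun h3 w))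
  refine (h5 _).trans (Eq.trans ?_ (K.congr_point h4 _ _).symm)
  exact DFunLike.congr_fun (congrArg (K y) (DFunLike.congr_fun h3 v)) _

end FlatTensors

section ChartFields

variable {E : Type*} [NormedAddCommGroup E] [NormedSpace ℝ E]
  {H : Type*} [TopologicalSpace H] {I : ModelWithCorners ℝ E H}
  {M : Type*} [TopologicalSpace M] [ChartedSpace H M]

/-- The vector field on `M` which is read as `V` in the chart at `x`. -/
def VField.ofChart (I : ModelWithCorners ℝ E H) (x : M) (V : E → E) : VField I M := fun y ↦
  (mfderiv 𝓘(ℝ, E) I (extChartAt I x).symm (extChartAt I x y) (V (extChartAt I x y)) : E)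

theorem eventually_extChartAt_symm (x : M) :
    ∀ᶠ y in 𝓝 x, (extChartAt I x).symm (extChartAt I x y) = y := by
  filter_upwards [extChartAt_source_mem_nhds (I := I) x] with y hy
  exact (extChartAt I x).left_inv hy

theorem TwoTensor.eventually_apply_ofChart (K : TwoTensor I M) (x : M) (V W : E → E) :
    ∀ᶠ y in 𝓝 x, K y (VField.ofChart I x V y) (VField.ofChart I x W y) =
      K.flat (extChartAt I x).symm (extChartAt I x y) (V (extChartAt I x y))
        (W (extChartAt I x y)) := by
  filter_upwards [eventually_extChartAt_symm (I := I) x] with y hy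
  exact (K.congr_point hy _ _).symm

variable [IsManifold I ∞ M] [I.Boundaryless]

theorem contMDiffAt_extChartAt_symm (x : M) :
    ContMDiffAt 𝓘(ℝ, E) I ∞ (extChartAt I x).symm (extChartAt I x x) :=
  (contMDiffOn_extChartAt_symm x).contMDiffAt (extChartAt_target_mem_nhds x)

theorem contMDiffAt_extChartAt_symm_of_mem (x : M) {e : E} (he : e ∈ (extChartAt I x).target) :
    ContMDiffAt 𝓘(ℝ, E) I ∞ (extChartAt I x).symm e :=
  (contMDiffOn_extChartAt_symm x).contMDiffAt ((isOpen_extChartAt_target x).mem_nhds he)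

theorem mfderiv_extChartAt_symm_self (x : M) (v : E) :
    mfderiv 𝓘(ℝ, E) I (extChartAt I x).symm (extChartAt I x x) v = v := by
  have h := mfderivWithin_range_extChartAt_symm (I := I) (x := x)
  rw [I.range_eq_univ, mfderivWithin_univ] at h
  exact DFunLike.congr_fun h v

theorem VField.ofChart_self (x : M) (V : E → E) :
    VField.ofChart I x V x = V (extChartAt I x x) :=
  mfderiv_extChartAt_symm_self x _

theorem VField.ofChart_smoothAt {x : M} {V : E → E} (hV : ContDiffAt ℝ ∞ V (extChartAt I x x)) :
    VField.SmoothAt I (VField.ofChart I x V) x := by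
  have h1 := contMDiffAt_mfderiv_apply (contMDiffAt_extChartAt_symm (I := I) x) hV
  have h2 := h1.comp x (contMDiffAt_extChartAt (n := ∞))
  refine h2.congr_of_eventuallyEq ?_
  filter_upwards [eventually_extChartAt_symm (I := I) x] with y hy
  have : ∀ z : M, y = z → ∀ v : E, (⟨y, v⟩ : TangentBundle I M) = ⟨z, v⟩ := by
    rintro z rfl v; rfl
  exact this _ hy.symm _

theorem mpullbackWithin_extChartAt_ofChart (x : M) (V : E → E) {e : E}
    (he : e ∈ (extChartAt I x).target) :
    mpullbackWithin 𝓘(ℝ, E) I (extChartAt I x).symm (VField.ofChart I x V) (range I) e = V e := by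
  have hinv := isInvertible_mfderivWithin_extChartAt_symm (I := I) he
  have h1 : extChartAt I x ((extChartAt I x).symm e) = e := (extChartAt I x).right_inv he
  rw [mpullbackWithin_apply]
  have h2 : VField.ofChart I x V ((extChartAt I x).symm e)
      = mfderivWithin 𝓘(ℝ, E) I (extChartAt I x).symm (range I) e (V e) := by
    rw [I.range_eq_univ, mfderivWithin_univ]
    have : ∀ e' : E, e' = e → (mfderiv 𝓘(ℝ, E) I (extChartAt I x).symm e' (V e') : E)
        = mfderiv 𝓘(ℝ, E) I (extChartAt I x).symm e (V e) := by
      rintro e' rfl; rfl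
    exact this _ h1
  rw [h2]
  obtain ⟨A, hA⟩ := hinv
  rw [← hA, ContinuousLinearMap.inverse_equiv]
  exact A.symm_apply_apply _

theorem VField.exists_eventuallyEq_ofChart [CompleteSpace E] {X : VField I M} {x : M}
    (hX : VField.SmoothAt I X x) :
    ∃ V : E → E, ContDiffAt ℝ ∞ V (extChartAt I x x) ∧
      ∀ᶠ y in 𝓝 x, X y = VField.ofChart I x V y := by
  refine ⟨mpullbackWithin 𝓘(ℝ, E) I (extChartAt I x).symm X (range I), ?_, ?_⟩
  · have h := contMDiffWithinAt_mpullbackWithin_extChartAt_symm (V := X) (x := x) (s := univ)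
      (m := ∞) (n := ∞) (contMDiffWithinAt_univ.2 hX) uniqueMDiffOn_univ (mem_univ _) (by simp)
    have h2 := h.contMDiffAt (by simpa using extChartAt_target_mem_nhds x)
    exact contMDiffAt_vectorSpace_iff_contDiffAt.1 h2
  · filter_upwards [extChartAt_source_mem_nhds (I := I) x] with y hy
    have he := (extChartAt I x).map_source hy
    have hinv := isInvertible_mfderivWithin_extChartAt_symm (I := I) he
    rw [I.range_eq_univ, mfderivWithin_univ] at hinv
    have h1 : (extChartAt I x).symm (extChartAt I x y) = y := (extChartAt I x).left_inv hy
    have h2 : ∀ (B : E →L[ℝ] E), B.IsInvertible → ∀ v, B (B.inverse v) = v := by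
      rintro _ ⟨A, rfl⟩ v
      rw [ContinuousLinearMap.inverse_equiv]
      exact A.apply_symm_apply v
    have h3 : ∀ z : M, z = y → (X z : E) = X y := by rintro z rfl; rfl
    refine (h3 _ h1).symm.trans (Eq.trans (h2 _ hinv _).symm ?_)
    rw [I.range_eq_univ]
    simp only [VField.ofChart, mpullbackWithin_apply, mfderivWithin_univ]
    rfl

theorem mlieBracket_ofChart {x : M} (V W : E → E) :
    mlieBracket I (VField.ofChart I x V) (VField.ofChart I x W) x =
      fderiv ℝ W (extChartAt I x x) (V (extChartAt I x x))
        - fderiv ℝ V (extChartAt I x x) (W (extChartAt I x x)) := by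
  have h0 : ∀ B : E →L[ℝ] E, B = ContinuousLinearMap.id ℝ E → ∀ v, B.inverse v = v := by
    rintro _ rfl v
    rw [ContinuousLinearMap.inverse_id]
    rfl
  rw [← mlieBracketWithin_univ, mlieBracketWithin_apply]
  refine (h0 _ mfderiv_extChartAt_self _).trans ?_
  simp only [preimage_univ, univ_inter, I.range_eq_univ]
  have h : ∀ V : E → E, mpullbackWithin 𝓘(ℝ, E) I (extChartAt I x).symm (VField.ofChart I x V)
      univ =ᶠ[𝓝 (extChartAt I x x)] V := by
    intro V
    filter_upwards [extChartAt_target_mem_nhds (I := I) x] with e he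
    rw [← I.range_eq_univ]
    exact mpullbackWithin_extChartAt_ofChart x V he
  have h2 := Filter.EventuallyEq.lieBracket_vectorField_eq (𝕜 := ℝ) (h V) (h W)
  exact (congrFun lieBracketWithin_univ _).trans h2

omit [I.Boundaryless] in
theorem mvfderiv_comp_extChartAt {F : Type*} [NormedAddCommGroup F] [NormedSpace ℝ F] {x : M}
    {f : M → F} {h : E → F}
    (hh : DifferentiableAt ℝ h (extChartAt I x x))
    (hf : ∀ᶠ y in 𝓝 x, f y = h (extChartAt I x y)) (v : E) :
    mvfderiv I f x v = fderiv ℝ h (extChartAt I x x) v := by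
  have h1 : f =ᶠ[𝓝 x] h ∘ extChartAt I x := hf
  have h2 : mfderiv I 𝓘(ℝ, F) f x = mfderiv I 𝓘(ℝ, F) (h ∘ extChartAt I x) x := h1.mfderiv_eq
  have h3 : mfderiv I 𝓘(ℝ, F) (h ∘ extChartAt I x) x v = fderiv ℝ h (extChartAt I x x) v := by
    rw [mfderiv_comp x hh.mdifferentiableAt (mdifferentiableAt_extChartAt (mem_chart_source H x)),
      mfderiv_extChartAt_self, mfderiv_eq_fderiv]
    rfl
  refine Eq.trans ?_ h3
  exact DFunLike.congr_fun h2 v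

end ChartFields

section Closed

variable {V : Type*} [NormedAddCommGroup V] [NormedSpace ℝ V]
  {W : Type*} [NormedAddCommGroup W] [NormedSpace ℝ W]

theorem fderiv_bilin_apply {B : V → W →L[ℝ] W →L[ℝ] ℝ} {X Y : V → W} {v : V}
    (hB : DifferentiableAt ℝ B v) (hX : DifferentiableAt ℝ X v) (hY : DifferentiableAt ℝ Y v)
    (u : V) :
    fderiv ℝ (fun v ↦ B v (X v) (Y v)) v u = fderiv ℝ B v u (X v) (Y v)
      + B v (fderiv ℝ X v u) (Y v) + B v (X v) (fderiv ℝ Y v u) := by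
  have h := (hB.hasFDerivAt.clm_apply hX.hasFDerivAt).clm_apply hY.hasFDerivAt
  rw [h.fderiv]
  simp
  ring

theorem fderiv_bilin_const_apply {B : V → W →L[ℝ] W →L[ℝ] ℝ} {v : V}
    (hB : DifferentiableAt ℝ B v) (u : V) (a b : W) :
    fderiv ℝ (fun v ↦ B v a b) v u = fderiv ℝ B v u a b := by
  rw [fderiv_bilin_apply hB (differentiableAt_const a) (differentiableAt_const b)]
  simp

/-- The exterior derivative of a 2-form on a vector space. -/
def extDerivTwo (B : V → V →L[ℝ] V →L[ℝ] ℝ) (v a b c : V) : ℝ :=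
  fderiv ℝ B v a b c - fderiv ℝ B v b a c + fderiv ℝ B v c a b

theorem differentiableAt_bilin_comp {B : W → W →L[ℝ] W →L[ℝ] ℝ} {F : V → W} {v₀ : V}
    (hB : DifferentiableAt ℝ B (F v₀)) (hF : DifferentiableAt ℝ F v₀) :
    DifferentiableAt ℝ (fun v ↦ B (F v)) v₀ :=
  DifferentiableAt.comp (G := W →L[ℝ] W →L[ℝ] ℝ) v₀ hB hF

set_option synthInstance.maxHeartbeats 100000 in
theorem fderiv_bilin_comp {B : W → W →L[ℝ] W →L[ℝ] ℝ} {F : V → W} {v₀ : V}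
    (hB : DifferentiableAt ℝ B (F v₀)) (hF : DifferentiableAt ℝ F v₀) (u : V) :
    fderiv ℝ (fun v ↦ B (F v)) v₀ u = fderiv ℝ B (F v₀) (fderiv ℝ F v₀ u) :=
  DFunLike.congr_fun (fderiv_comp (G := W →L[ℝ] W →L[ℝ] ℝ) v₀ hB hF) u

/-- Pullback commutes with the exterior derivative. -/
theorem extDerivTwo_pullback {B : W → W →L[ℝ] W →L[ℝ] ℝ} {F : V → W} {v₀ : V}
    (hB : DifferentiableAt ℝ B (F v₀)) (hsk : ∀ a b, B (F v₀) a b = -B (F v₀) b a)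
    (hF : ContDiffAt ℝ 2 F v₀) (u v w : V) :
    extDerivTwo (fun v ↦ (B (F v)).bilinearComp (fderiv ℝ F v) (fderiv ℝ F v)) v₀ u v w =
      extDerivTwo B (F v₀) (fderiv ℝ F v₀ u) (fderiv ℝ F v₀ v) (fderiv ℝ F v₀ w) := by
  have hsym : IsSymmSndFDerivAt ℝ F v₀ := hF.isSymmSndFDerivAt (by simp)
  have hdF : DifferentiableAt ℝ F v₀ := hF.differentiableAt (by simp)
  have hdF' : DifferentiableAt ℝ (fderiv ℝ F) v₀ :=
    (hF.fderiv_right (m := 1) (by norm_num)).differentiableAt (by simp)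
  have hBF : DifferentiableAt ℝ (fun v ↦ B (F v)) v₀ :=
    differentiableAt_bilin_comp hB hdF
  have hD : DifferentiableAt ℝ (fun v ↦ (B (F v)).bilinearComp (fderiv ℝ F v) (fderiv ℝ F v))
      v₀ := by
    have h1 : DifferentiableAt ℝ (fun v ↦ ((ContinuousLinearMap.compL ℝ V W ℝ).flip
        (fderiv ℝ F v)).comp ((B (F v)).comp (fderiv ℝ F v))) v₀ :=
      ((ContinuousLinearMap.differentiableAt _).comp v₀ hdF').clm_comp (hBF.clm_comp hdF')
    exact h1
  have hX : ∀ c, DifferentiableAt ℝ (fun v ↦ fderiv ℝ F v c) v₀ := fun c ↦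
    hdF'.clm_apply (differentiableAt_const c)
  have hX' : ∀ c u, fderiv ℝ (fun v ↦ fderiv ℝ F v c) v₀ u = fderiv ℝ (fderiv ℝ F) v₀ u c := by
    intro c u
    rw [fderiv_clm_apply hdF' (differentiableAt_const c)]
    simp
  have hBF' : ∀ u, fderiv ℝ (fun v ↦ B (F v)) v₀ u = fderiv ℝ B (F v₀) (fderiv ℝ F v₀ u) := by
    exact fderiv_bilin_comp hB hdF
  have hder : ∀ u a b : V, fderiv ℝ (fun v ↦ (B (F v)).bilinearComp (fderiv ℝ F v)
      (fderiv ℝ F v)) v₀ u a b =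
      fderiv ℝ B (F v₀) (fderiv ℝ F v₀ u) (fderiv ℝ F v₀ a) (fderiv ℝ F v₀ b)
      + B (F v₀) (fderiv ℝ (fderiv ℝ F) v₀ u a) (fderiv ℝ F v₀ b)
      + B (F v₀) (fderiv ℝ F v₀ a) (fderiv ℝ (fderiv ℝ F) v₀ u b) := by
    intro u a b
    rw [← fderiv_bilin_const_apply hD]
    simp only [ContinuousLinearMap.bilinearComp_apply]
    rw [fderiv_bilin_apply hBF (hX a) (hX b), hX', hX', hBF']
  rw [extDerivTwo, hder, hder, hder, hsym.eq v u, hsym.eq w u, hsym.eq w v, extDerivTwo]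
  linear_combination hsk (fderiv ℝ F v₀ v) (fderiv ℝ (fderiv ℝ F) v₀ u w)
    
variable {E : Type*} [NormedAddCommGroup E] [NormedSpace ℝ E] [FiniteDimensional ℝ E]
  {H : Type*} [TopologicalSpace H] {I : ModelWithCorners ℝ E H}
  {M : Type*} [TopologicalSpace M] [ChartedSpace H M] [IsManifold I ∞ M] [I.Boundaryless]

omit [FiniteDimensional ℝ E] [IsManifold I ∞ M] [I.Boundaryless] in
theorem TwoTensor.skew_of_alternating {Ω : TwoTensor I M}
    (h : ∀ x (v : TangentSpace I x), Ω x v v = 0) (x : M) (v w : TangentSpace I x) :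
    Ω x v w = -Ω x w v := by
  have h1 := h x (v + w)
  simp only [map_add, add_apply, h] at h1
  linarith

theorem closed_formula_ofChart {Ω : TwoTensor I M} (hs : TwoTensor.Smooth I Ω)
    (ha : ∀ x (v : TangentSpace I x), Ω x v v = 0) (x : M) {X Y Z : E → E}
    (hX : DifferentiableAt ℝ X (extChartAt I x x)) (hY : DifferentiableAt ℝ Y (extChartAt I x x))
    (hZ : DifferentiableAt ℝ Z (extChartAt I x x)) :
    mvfderiv I (fun y ↦ Ω y (VField.ofChart I x Y y) (VField.ofChart I x Z y)) x
        (VField.ofChart I x X x)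
      - mvfderiv I (fun y ↦ Ω y (VField.ofChart I x X y) (VField.ofChart I x Z y)) x
        (VField.ofChart I x Y x)
      + mvfderiv I (fun y ↦ Ω y (VField.ofChart I x X y) (VField.ofChart I x Y y)) x
        (VField.ofChart I x Z x)
      - Ω x (mlieBracket I (VField.ofChart I x X) (VField.ofChart I x Y) x) (VField.ofChart I x Z x)
      + Ω x (mlieBracket I (VField.ofChart I x X) (VField.ofChart I x Z) x) (VField.ofChart I x Y x)
      - Ω x (mlieBracket I (VField.ofChart I x Y) (VField.ofChart I x Z) x) (VField.ofChart I x X x)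
      = extDerivTwo (Ω.flat (extChartAt I x).symm) (extChartAt I x x) (X (extChartAt I x x))
        (Y (extChartAt I x x)) (Z (extChartAt I x x)) := by
  have hd : DifferentiableAt ℝ (Ω.flat (extChartAt I x).symm) (extChartAt I x x) :=
    (hs.contDiffAt_flat (contMDiffAt_extChartAt_symm x)).differentiableAt (by simp)
  have hder : ∀ {A B : E → E}, DifferentiableAt ℝ A (extChartAt I x x) →
      DifferentiableAt ℝ B (extChartAt I x x) → ∀ u : E,
      mvfderiv I (fun y ↦ Ω y (VField.ofChart I x A y) (VField.ofChart I x B y)) x u =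
      fderiv ℝ (Ω.flat (extChartAt I x).symm) (extChartAt I x x) u (A (extChartAt I x x))
        (B (extChartAt I x x))
      + Ω.flat (extChartAt I x).symm (extChartAt I x x) (fderiv ℝ A (extChartAt I x x) u)
        (B (extChartAt I x x))
      + Ω.flat (extChartAt I x).symm (extChartAt I x x) (A (extChartAt I x x))
        (fderiv ℝ B (extChartAt I x x) u) := by
    intro A B hA hB u
    rw [← fderiv_bilin_apply hd hA hB]
    exact mvfderiv_comp_extChartAt (by fun_prop)
      (Ω.eventually_apply_ofChart x A B) u
  have hΩ : ∀ u w : E, Ω x u w = Ω.flat (extChartAt I x).symm (extChartAt I x x) u w := by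
    intro u w
    rw [TwoTensor.flat_apply, mfderiv_extChartAt_symm_self, mfderiv_extChartAt_symm_self]
    exact (Ω.congr_point (by simp) u w).symm
  have hsk : ∀ u w : E, Ω.flat (extChartAt I x).symm (extChartAt I x x) u w =
      - Ω.flat (extChartAt I x).symm (extChartAt I x x) w u := by
    intro u w
    rw [← hΩ, ← hΩ]
    exact TwoTensor.skew_of_alternating ha x u w
  simp only [VField.ofChart_self]
  rw [hder hY hZ, hder hX hZ, hder hX hY]
  rw [mlieBracket_ofChart, mlieBracket_ofChart, mlieBracket_ofChart]
  have hΩ' := fun u v w ↦ (hΩ (u - v) w).trans (by rw [map_sub, sub_apply])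
  erw [hΩ', hΩ', hΩ']
  rw [extDerivTwo]
  linear_combination
    hsk (Y (extChartAt I x x)) (fderiv ℝ Z (extChartAt I x x) (X (extChartAt I x x)))
    - hsk (X (extChartAt I x x)) (fderiv ℝ Z (extChartAt I x x) (Y (extChartAt I x x)))
    + hsk (X (extChartAt I x x)) (fderiv ℝ Y (extChartAt I x x) (Z (extChartAt I x x)))

theorem isClosedForm_of_flat {Ω : TwoTensor I M} (hs : TwoTensor.Smooth I Ω)
    (ha : ∀ x (v : TangentSpace I x), Ω x v v = 0)
    (h : ∀ (x : M) (u v w : E),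
      extDerivTwo (Ω.flat (extChartAt I x).symm) (extChartAt I x x) u v w = 0) :
    IsClosedForm I Ω := by
  intro x X Y Z hX hY hZ
  obtain ⟨A, hA, hXA⟩ := VField.exists_eventuallyEq_ofChart hX
  obtain ⟨B, hB, hYB⟩ := VField.exists_eventuallyEq_ofChart hY
  obtain ⟨C, hC, hZC⟩ := VField.exists_eventuallyEq_ofChart hZ
  have key := closed_formula_ofChart hs ha x (hA.differentiableAt (by simp))
    (hB.differentiableAt (by simp)) (hC.differentiableAt (by simp))
  rw [h] at key
  have hmv : ∀ {f g : M → ℝ}, f =ᶠ[𝓝 x] g → mvfderiv I f x = mvfderiv I g x := by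
    intro f g hfg
    ext v
    exact DFunLike.congr_fun (hfg.mfderiv_eq (I := I) (I' := 𝓘(ℝ, ℝ))) v
  have e1 : (fun y ↦ Ω y (Y y) (Z y)) =ᶠ[𝓝 x]
      fun y ↦ Ω y (VField.ofChart I x B y) (VField.ofChart I x C y) := by
    filter_upwards [hYB, hZC] with y h1 h2; rw [h1, h2]
  have e2 : (fun y ↦ Ω y (X y) (Z y)) =ᶠ[𝓝 x]
      fun y ↦ Ω y (VField.ofChart I x A y) (VField.ofChart I x C y) := by
    filter_upwards [hXA, hZC] with y h1 h2; rw [h1, h2]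
  have e3 : (fun y ↦ Ω y (X y) (Y y)) =ᶠ[𝓝 x]
      fun y ↦ Ω y (VField.ofChart I x A y) (VField.ofChart I x B y) := by
    filter_upwards [hXA, hYB] with y h1 h2; rw [h1, h2]
  rw [hmv e1, hmv e2, hmv e3, Filter.EventuallyEq.mlieBracket_vectorField_eq hXA hYB,
    Filter.EventuallyEq.mlieBracket_vectorField_eq hXA hZC,
    Filter.EventuallyEq.mlieBracket_vectorField_eq hYB hZC, hXA.self_of_nhds, hYB.self_of_nhds,
    hZC.self_of_nhds]
  exact key

theorem IsClosedForm.extDerivTwo_flat_chart {Ω : TwoTensor I M} (hs : TwoTensor.Smooth I Ω)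
    (ha : ∀ x (v : TangentSpace I x), Ω x v v = 0) (hc : IsClosedForm I Ω) (x : M) (u v w : E) :
    extDerivTwo (Ω.flat (extChartAt I x).symm) (extChartAt I x x) u v w = 0 := by
  have key := closed_formula_ofChart hs ha x (differentiableAt_const u) (differentiableAt_const v)
    (differentiableAt_const w)
  rw [← key]
  exact hc x _ _ _ (VField.ofChart_smoothAt contDiffAt_const)
    (VField.ofChart_smoothAt contDiffAt_const) (VField.ofChart_smoothAt contDiffAt_const)

/-- The pullback of a closed 2-form to a vector space is closed. -/
theorem IsClosedForm.extDerivTwo_flat {Ω : TwoTensor I M} (hs : TwoTensor.Smooth I Ω)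
    (ha : ∀ x (v : TangentSpace I x), Ω x v v = 0) (hc : IsClosedForm I Ω)
    {f : V → M} {v₀ : V} (hf : ContMDiffAt 𝓘(ℝ, V) I ∞ f v₀) (u v w : V) :
    extDerivTwo (Ω.flat f) v₀ u v w = 0 := by
  set x := f v₀ with hx
  set F : V → E := extChartAt I x ∘ f with hF
  have hFs : ContDiffAt ℝ ∞ F v₀ :=
    (contMDiffAt_extChartAt (I := I) (n := ∞) (x := x)).comp v₀ hf |>.contDiffAt
  have hF1 : ContDiffAt ℝ 2 F v₀ := hFs.of_le (by norm_cast)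
  have hd : DifferentiableAt ℝ (Ω.flat (extChartAt I x).symm) (F v₀) :=
    (hs.contDiffAt_flat (contMDiffAt_extChartAt_symm x)).differentiableAt (by simp)
  have heq : Ω.flat f =ᶠ[𝓝 v₀] fun v ↦
      ((Ω.flat (extChartAt I x).symm (F v)).bilinearComp (fderiv ℝ F v) (fderiv ℝ F v)) := by
    have h1 : ∀ᶠ v in 𝓝 v₀, ContMDiffAt 𝓘(ℝ, V) I 1 f v :=
      (contMDiffAt_iff_contMDiffAt_nhds (by simp)).1 (hf.of_le (m := 1) (by norm_cast))
    have h2 : ∀ᶠ v in 𝓝 v₀, f v ∈ (extChartAt I x).source :=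
      hf.continuousAt.preimage_mem_nhds (extChartAt_source_mem_nhds x)
    filter_upwards [h1, h2.eventually_nhds] with v hv1 hv2
    have hv2' := hv2.self_of_nhds
    have hFv : DifferentiableAt ℝ F v :=
      ((contMDiffAt_extChartAt' (I := I) (n := 1) (by simpa using hv2')).comp v hv1
        ).contDiffAt.differentiableAt (by simp)
    have h3 : f =ᶠ[𝓝 v] (extChartAt I x).symm ∘ F := by
      filter_upwards [hv2] with v' hv'
      exact ((extChartAt I x).left_inv hv').symm
    ext a b
    rw [Ω.flat_congr h3, Ω.flat_comp ?_ hFv]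
    · simp
    · exact (contMDiffAt_extChartAt_symm_of_mem x ((extChartAt I x).map_source hv2')
        ).mdifferentiableAt (by simp)
  have hE : extDerivTwo (Ω.flat f) v₀ u v w = extDerivTwo (fun v ↦
      ((Ω.flat (extChartAt I x).symm (F v)).bilinearComp (fderiv ℝ F v) (fderiv ℝ F v)))
      v₀ u v w := by
    rw [extDerivTwo, heq.fderiv_eq]
    rfl
  rw [hE, extDerivTwo_pullback hd (fun a b ↦ TwoTensor.skew_of_alternating ha _ _ _) hF1]
  exact hc.extDerivTwo_flat_chart hs ha x _ _ _

end Closed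

section Metrics

variable {E : Type*} [NormedAddCommGroup E] [NormedSpace ℝ E] [FiniteDimensional ℝ E]
  {H : Type*} [TopologicalSpace H] {I : ModelWithCorners ℝ E H}
  {M : Type*} [TopologicalSpace M] [ChartedSpace H M] [IsManifold I ∞ M]

theorem isVonNBounded_of_posDef (B : E →L[ℝ] E →L[ℝ] ℝ) (hB : ∀ v, v ≠ 0 → 0 < B v v) :
    Bornology.IsVonNBounded ℝ {v : E | B v v < 1} := by
  rw [NormedSpace.isVonNBounded_iff, isBounded_iff_forall_norm_le]
  rcases subsingleton_or_nontrivial E with hE | hE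
  · exact ⟨0, fun v _ ↦ by simp [Subsingleton.elim v 0]⟩
  obtain ⟨u, hu, hmin⟩ := (isCompact_sphere (0 : E) 1).exists_isMinOn
    (NormedSpace.sphere_nonempty.2 zero_le_one)
    (f := fun v ↦ B v v)
    (((B.continuous.comp continuous_id).clm_apply continuous_id).continuousOn)
  have hu0 : u ≠ 0 := ne_zero_of_mem_unit_sphere ⟨u, hu⟩
  have hc := hB u hu0
  refine ⟨Real.sqrt (B u u)⁻¹, fun v (hv : B v v < 1) ↦ ?_⟩
  rcases eq_or_ne v 0 with rfl | hv0
  · simp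
  apply Real.le_sqrt_of_sq_le
  have hn : 0 < ‖v‖ := norm_pos_iff.2 hv0
  have h1 : B u u ≤ B (‖v‖⁻¹ • v) (‖v‖⁻¹ • v) := hmin (by simp [norm_smul, hn.ne'])
  simp only [map_smul, smul_apply, smul_eq_mul] at h1
  rw [le_inv_comm₀ (by positivity) hc]
  calc B u u ≤ ‖v‖⁻¹ * (‖v‖⁻¹ * B v v) := h1
    _ ≤ ‖v‖⁻¹ * (‖v‖⁻¹ * 1) := by gcongr
    _ = (‖v‖ ^ 2)⁻¹ := by rw [mul_one, sq, mul_inv]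

theorem isRiemannianMetric_of_posDef {g : TwoTensor I M} (hs : TwoTensor.Smooth I g)
    (hsymm : ∀ x (v w : TangentSpace I x), g x v w = g x w v)
    (hpos : ∀ x (v : TangentSpace I x), v ≠ 0 → 0 < g x v v) : IsRiemannianMetric I g :=
  ⟨⟨g, hsymm, hpos, fun x ↦ isVonNBounded_of_posDef (E := E) (g x) (hpos x), hs⟩, fun _ ↦ rfl⟩

omit [FiniteDimensional ℝ E]

theorem IsRiemannianMetric.smooth {g : TwoTensor I M} (hg : IsRiemannianMetric I g) :
    TwoTensor.Smooth I g := by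
  obtain ⟨G, hG⟩ := hg
  have := G.contMDiff
  simp only [hG] at this
  exact this

theorem IsRiemannianMetric.symm {g : TwoTensor I M} (hg : IsRiemannianMetric I g) (x : M)
    (v w : TangentSpace I x) : g x v w = g x w v := by
  obtain ⟨G, hG⟩ := hg
  rw [← hG]; exact G.symm x v w

theorem IsRiemannianMetric.pos {g : TwoTensor I M} (hg : IsRiemannianMetric I g) (x : M)
    (v : TangentSpace I x) (hv : v ≠ 0) : 0 < g x v v := by
  obtain ⟨G, hG⟩ := hg
  rw [← hG]; exact G.pos x v hv

end Metrics

section ComplexStructures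

variable {E : Type*} [NormedAddCommGroup E] [NormedSpace ℝ E] [FiniteDimensional ℝ E]
  {H : Type*} [TopologicalSpace H] {I : ModelWithCorners ℝ E H} [I.Boundaryless]
  {M : Type*} [TopologicalSpace M] [ChartedSpace H M] [IsManifold I ∞ M]

/-- The Nijenhuis torsion of a field of endomorphisms of a vector space. -/
def flatNijenhuis (J : E → E →L[ℝ] E) (e v w : E) : E :=
  fderiv ℝ J e (J e v) w - fderiv ℝ J e (J e w) v + J e (fderiv ℝ J e w v)
    - J e (fderiv ℝ J e v w)

/-- `J` is the field of endomorphisms with `g(v, w) = Ω(v, J w)` in the chart at `x`. -/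
def IsChartStructure (Ω g : TwoTensor I M) (x : M) (J : E → E →L[ℝ] E) : Prop :=
  ∀ᶠ e in 𝓝 (extChartAt I x x), ∀ a b,
    g.flat (extChartAt I x).symm e a b = Ω.flat (extChartAt I x).symm e a (J e b)

theorem isInvertible_of_nondegenerate {B : E →L[ℝ] E →L[ℝ] ℝ} (hB : ∀ v, B v = 0 → v = 0) :
    B.IsInvertible := by
  have hinj : Function.Injective (B : E →ₗ[ℝ] E →L[ℝ] ℝ) := by
    rw [← LinearMap.ker_eq_bot, LinearMap.ker_eq_bot']
    exact hB
  have hfr : Module.finrank ℝ E = Module.finrank ℝ (E →L[ℝ] ℝ) := by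
    rw [← (LinearMap.toContinuousLinearMap (𝕜 := ℝ) (E := E) (F' := ℝ)).finrank_eq]
    exact (Subspace.dual_finrank_eq (K := ℝ) (V := E)).symm
  refine ⟨(LinearEquiv.ofInjectiveOfFinrankEq _ hinj hfr).toContinuousLinearEquiv, ?_⟩
  ext v w
  rfl

omit [FiniteDimensional ℝ E] in
theorem exists_equiv_mfderiv_extChartAt_symm (x : M) {e : E} (he : e ∈ (extChartAt I x).target) :
    ∃ A : E ≃L[ℝ] E, ∀ v : E, mfderiv 𝓘(ℝ, E) I (extChartAt I x).symm e v = A v := by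
  have hinv := isInvertible_mfderivWithin_extChartAt_symm (I := I) he
  rw [I.range_eq_univ, mfderivWithin_univ] at hinv
  obtain ⟨A, hA⟩ := hinv
  exact ⟨A, fun v ↦ DFunLike.congr_fun hA.symm v⟩

omit [FiniteDimensional ℝ E] in
theorem TwoTensor.flat_chart_nondegenerate {Ω : TwoTensor I M}
    (hn : ∀ x (v : TangentSpace I x), (∀ w, Ω x v w = 0) → v = 0) (x : M) {e : E}
    (he : e ∈ (extChartAt I x).target) (v : E)
    (hv : ∀ w, Ω.flat (extChartAt I x).symm e v w = 0) : v = 0 := by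
  obtain ⟨A, hA⟩ := exists_equiv_mfderiv_extChartAt_symm (I := I) x he
  have h1 : A v = 0 := by
    refine hn ((extChartAt I x).symm e) _ fun w ↦ ?_
    have h2 := hv (A.symm w)
    rw [TwoTensor.flat_apply, hA, hA] at h2
    exact (congrArg (Ω _ (A v)) (A.apply_symm_apply w)).symm.trans h2
  exact (map_eq_zero_iff A A.injective).1 h1

theorem exists_isChartStructure {Ω g : TwoTensor I M} (hΩ : TwoTensor.Smooth I Ω)
    (ha : ∀ x (v : TangentSpace I x), Ω x v v = 0)
    (hn : ∀ x (v : TangentSpace I x), (∀ w, Ω x v w = 0) → v = 0)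
    (hg : TwoTensor.Smooth I g) (x : M) :
    ∃ J : E → E →L[ℝ] E, ContDiffAt ℝ ∞ J (extChartAt I x x) ∧ IsChartStructure Ω g x J := by
  have hinv : ∀ e ∈ (extChartAt I x).target,
      (Ω.flat (extChartAt I x).symm e).flip.IsInvertible := by
    intro e he
    apply isInvertible_of_nondegenerate
    intro v hv
    apply TwoTensor.flat_chart_nondegenerate hn x he
    intro w
    have h1 := DFunLike.congr_fun hv w
    simp only [ContinuousLinearMap.flip_apply, zero_apply] at h1
    have h2 := TwoTensor.skew_of_alternating ha _
      (mfderiv 𝓘(ℝ, E) I (extChartAt I x).symm e v) (mfderiv 𝓘(ℝ, E) I (extChartAt I x).symm e w)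
    rw [TwoTensor.flat_apply] at h1 ⊢
    rw [h2, h1, neg_zero]
  have hflip : ∀ {B : E → E →L[ℝ] E →L[ℝ] ℝ} {e : E}, ContDiffAt ℝ ∞ B e →
      ContDiffAt ℝ ∞ (fun e ↦ (B e).flip) e := by
    intro B e hB
    refine contDiffAt_clm_of_apply fun a ↦ contDiffAt_clm_of_apply fun b ↦ ?_
    simp only [ContinuousLinearMap.flip_apply]
    exact (hB.clm_apply contDiffAt_const).clm_apply contDiffAt_const
  refine ⟨fun e ↦ (Ω.flat (extChartAt I x).symm e).flip.inverse.comp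
    (g.flat (extChartAt I x).symm e).flip, ?_, ?_⟩
  · have h1 := hflip (hΩ.contDiffAt_flat (contMDiffAt_extChartAt_symm x))
    have h2 := hflip (hg.contDiffAt_flat (contMDiffAt_extChartAt_symm x))
    obtain ⟨A, hA⟩ := hinv _ (mem_extChartAt_target x)
    have h3 : ContDiffAt ℝ ∞ (ContinuousLinearMap.inverse : (E →L[ℝ] E →L[ℝ] ℝ) → _)
        (Ω.flat (extChartAt I x).symm (extChartAt I x x)).flip := by
      rw [← hA]; exact contDiffAt_map_inverse A
    exact ContDiffAt.clm_comp (ContDiffAt.comp (extChartAt I x x)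
      (f := fun e ↦ (Ω.flat (extChartAt I x).symm e).flip) h3 h1) h2
  · filter_upwards [extChartAt_target_mem_nhds x] with e he a b
    obtain ⟨A, hA⟩ := hinv e he
    have h1 : (Ω.flat (extChartAt I x).symm e).flip
        ((Ω.flat (extChartAt I x).symm e).flip.inverse ((g.flat (extChartAt I x).symm e).flip b))
        = (g.flat (extChartAt I x).symm e).flip b := by
      rw [← hA, ContinuousLinearMap.inverse_equiv]
      exact A.apply_symm_apply _
    exact (DFunLike.congr_fun h1 a).symm

omit [FiniteDimensional ℝ E] in
theorem IsChartStructure.eventually_apply_ofChart {Ω g : TwoTensor I M}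
    (ha : ∀ x (v : TangentSpace I x), Ω x v v = 0)
    (hn : ∀ x (v : TangentSpace I x), (∀ w, Ω x v w = 0) → v = 0) {J : EndField I M}
    (hJ : IsCompatibleStructure I Ω g J) {x : M} {j : E → E →L[ℝ] E}
    (hj : IsChartStructure Ω g x j) (A : E → E) :
    ∀ᶠ y in 𝓝 x, J y (VField.ofChart I x A y) = VField.ofChart I x (fun e ↦ j e (A e)) y := by
  filter_upwards [extChartAt_source_mem_nhds (I := I) x,
    (continuousAt_extChartAt x).eventually hj] with y hy hjy
  have he := (extChartAt I x).map_source hy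
  have hyy : (extChartAt I x).symm (extChartAt I x y) = y := (extChartAt I x).left_inv hy
  obtain ⟨B, hB⟩ := exists_equiv_mfderiv_extChartAt_symm (I := I) x he
  rw [← sub_eq_zero]
  refine hn _ _ fun w ↦ ?_
  rw [TwoTensor.skew_of_alternating ha, map_sub, ← hJ.1]
  obtain ⟨w', rfl⟩ := B.surjective w
  have h1 := hjy w' (A (extChartAt I x y))
  rw [TwoTensor.flat_apply, TwoTensor.flat_apply, hB] at h1
  have h2 := g.congr_point hyy (B w') (VField.ofChart I x A y)
  have h3 := Ω.congr_point hyy (B w') (VField.ofChart I x (fun e ↦ j e (A e)) y)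
  rw [neg_eq_zero, sub_eq_zero]
  exact h2.symm.trans (h1.trans h3)

omit [FiniteDimensional ℝ E] in
theorem nijenhuis_aux (j : E →L[ℝ] E) (hj : ∀ v, j (j v) = -v) (p q r s t t' q₂ q₃ : E) :
    ((j p + q) - (j r + s) - (t - t')) - j ((p - (j t' + q₂)) + ((j t + q₃) - r)) =
      q - s + j q₂ - j q₃ := by
  simp only [map_add, map_sub, hj]
  abel

omit [FiniteDimensional ℝ E] in
/-- The Nijenhuis torsion in a chart. -/
theorem nijenhuis_ofChart {Ω g : TwoTensor I M}
    (ha : ∀ x (v : TangentSpace I x), Ω x v v = 0)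
    (hn : ∀ x (v : TangentSpace I x), (∀ w, Ω x v w = 0) → v = 0) {J : EndField I M}
    (hJ : IsCompatibleStructure I Ω g J) {x : M} {j : E → E →L[ℝ] E}
    (hj : IsChartStructure Ω g x j) (hjs : DifferentiableAt ℝ j (extChartAt I x x)) {A B : E → E}
    (hA : DifferentiableAt ℝ A (extChartAt I x x)) (hB : DifferentiableAt ℝ B (extChartAt I x x)) :
    (mlieBracket I (fun y ↦ J y (VField.ofChart I x A y)) (fun y ↦ J y (VField.ofChart I x B y)) x
      - mlieBracket I (VField.ofChart I x A) (VField.ofChart I x B) x)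
      - J x (mlieBracket I (fun y ↦ J y (VField.ofChart I x A y)) (VField.ofChart I x B) x
        + mlieBracket I (VField.ofChart I x A) (fun y ↦ J y (VField.ofChart I x B y)) x) =
      flatNijenhuis j (extChartAt I x x) (A (extChartAt I x x)) (B (extChartAt I x x)) := by
  have eA := hj.eventually_apply_ofChart ha hn hJ A
  have eB := hj.eventually_apply_ofChart ha hn hJ B
  have hJx : ∀ v : E, J x v = j (extChartAt I x x) v := by
    intro v
    have h1 := (hj.eventually_apply_ofChart ha hn hJ fun _ ↦ v).self_of_nhds
    rwa [VField.ofChart_self, VField.ofChart_self] at h1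
  have hjj : ∀ v : E, j (extChartAt I x x) (j (extChartAt I x x) v) = -v := by
    intro v
    rw [← hJx, ← hJx]
    exact hJ.2 x v
  have hd : ∀ {C : E → E}, DifferentiableAt ℝ C (extChartAt I x x) → ∀ u,
      fderiv ℝ (fun e ↦ j e (C e)) (extChartAt I x x) u =
      j (extChartAt I x x) (fderiv ℝ C (extChartAt I x x) u)
        + fderiv ℝ j (extChartAt I x x) u (C (extChartAt I x x)) := by
    intro C hC u
    rw [fderiv_clm_apply hjs hC]
    simp
  have b1 := (Filter.EventuallyEq.mlieBracket_vectorField_eq eA eB).trans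
    (mlieBracket_ofChart _ _)
  have b2 := (Filter.EventuallyEq.mlieBracket_vectorField_eq eA
    (Filter.EventuallyEq.refl _ (VField.ofChart I x B))).trans (mlieBracket_ofChart _ _)
  have b3 := (Filter.EventuallyEq.mlieBracket_vectorField_eq
    (Filter.EventuallyEq.refl _ (VField.ofChart I x A)) eB).trans (mlieBracket_ofChart _ _)
  rw [b1, b2, b3, mlieBracket_ofChart, hd hA, hd hB, hd hA, hd hB]
  have h4 : ∀ a b b' d : E, b = b' → a - b' = d → a - b = d := by
    rintro a b _ d rfl h; exact h
  exact h4 _ _ _ _ (hJx _) (nijenhuis_aux _ hjj _ _ _ _ _ _ _ _)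

theorem isIntegrable_of_flat {Ω g : TwoTensor I M}
    (ha : ∀ x (v : TangentSpace I x), Ω x v v = 0)
    (hn : ∀ x (v : TangentSpace I x), (∀ w, Ω x v w = 0) → v = 0) {J : EndField I M}
    (hJ : IsCompatibleStructure I Ω g J)
    (h : ∀ x : M, ∃ j : E → E →L[ℝ] E, DifferentiableAt ℝ j (extChartAt I x x) ∧
      IsChartStructure Ω g x j ∧ ∀ v w, flatNijenhuis j (extChartAt I x x) v w = 0) :
    IsIntegrable I J := by
  intro x X Y hX hY
  obtain ⟨A, hA, hXA⟩ := VField.exists_eventuallyEq_ofChart hX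
  obtain ⟨B, hB, hYB⟩ := VField.exists_eventuallyEq_ofChart hY
  obtain ⟨j, hjs, hj, hN⟩ := h x
  have key := nijenhuis_ofChart ha hn hJ hj hjs (hA.differentiableAt (by simp))
    (hB.differentiableAt (by simp))
  rw [hN] at key
  have hJX : (fun y ↦ J y (X y)) =ᶠ[𝓝 x] fun y ↦ J y (VField.ofChart I x A y) := by
    filter_upwards [hXA] with y hy; rw [hy]
  have hJY : (fun y ↦ J y (Y y)) =ᶠ[𝓝 x] fun y ↦ J y (VField.ofChart I x B y) := by
    filter_upwards [hYB] with y hy; rw [hy]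
  rw [Filter.EventuallyEq.mlieBracket_vectorField_eq hJX hJY,
    Filter.EventuallyEq.mlieBracket_vectorField_eq hXA hYB,
    Filter.EventuallyEq.mlieBracket_vectorField_eq hJX hYB,
    Filter.EventuallyEq.mlieBracket_vectorField_eq hXA hJY]
  exact key

omit [FiniteDimensional ℝ E] in
theorem IsIntegrable.flatNijenhuis_eq_zero {Ω g : TwoTensor I M}
    (ha : ∀ x (v : TangentSpace I x), Ω x v v = 0)
    (hn : ∀ x (v : TangentSpace I x), (∀ w, Ω x v w = 0) → v = 0) {J : EndField I M}
    (hJ : IsCompatibleStructure I Ω g J) (hi : IsIntegrable I J) {x : M} {j : E → E →L[ℝ] E}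
    (hj : IsChartStructure Ω g x j) (hjs : DifferentiableAt ℝ j (extChartAt I x x)) (v w : E) :
    flatNijenhuis j (extChartAt I x x) v w = 0 :=
  (nijenhuis_ofChart ha hn hJ hj hjs (differentiableAt_const v)
    (differentiableAt_const w)).symm.trans
    (hi x _ _ (VField.ofChart_smoothAt contDiffAt_const) (VField.ofChart_smoothAt contDiffAt_const))

end ComplexStructures

section Products

variable {E : Type*} [NormedAddCommGroup E] [NormedSpace ℝ E]
  {H : Type*} [TopologicalSpace H] {I : ModelWithCorners ℝ E H}
  {M : Type*} [TopologicalSpace M] [ChartedSpace H M]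
  {E' : Type*} [NormedAddCommGroup E'] [NormedSpace ℝ E']
  {H' : Type*} [TopologicalSpace H'] {I' : ModelWithCorners ℝ E' H'}
  {M' : Type*} [TopologicalSpace M'] [ChartedSpace H' M']
  {V : Type*} [NormedAddCommGroup V] [NormedSpace ℝ V]

theorem TwoTensor.prod_apply (K : TwoTensor I M) (K' : TwoTensor I' M') (p : M × M')
    (v w : E × E') :
    TwoTensor.prod I I' K K' p v w = K p.1 v.1 w.1 + K' p.2 v.2 w.2 := by
  have h1 := mfderiv_fst (I := I) (I' := I') (x := p)
  have h2 := mfderiv_snd (I := I) (I' := I') (x := p)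
  change K p.1 (mfderiv (I.prod I') I Prod.fst p v) (mfderiv (I.prod I') I Prod.fst p w) +
    K' p.2 (mfderiv (I.prod I') I' Prod.snd p v) (mfderiv (I.prod I') I' Prod.snd p w) = _
  rw [h1, h2]
  rfl

theorem TwoTensor.flat_prod (K : TwoTensor I M) (K' : TwoTensor I' M') {f : V → M × M'} {v : V}
    (hf : MDifferentiableAt 𝓘(ℝ, V) (I.prod I') f v) :
    (TwoTensor.prod I I' K K').flat f v =
      K.flat (fun u ↦ (f u).1) v + K'.flat (fun u ↦ (f u).2) v := by
  have h1 := K.flat_pullback (F := Prod.fst) (f := f) (I := I.prod I')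
    (mdifferentiable_fst (f v)) hf
  have h2 := K'.flat_pullback (F := Prod.snd) (f := f) (I := I.prod I')
    (mdifferentiable_snd (f v)) hf
  ext a b
  exact congrArg₂ (· + ·) (DFunLike.congr_fun (DFunLike.congr_fun h1 a) b)
    (DFunLike.congr_fun (DFunLike.congr_fun h2 a) b)

variable [IsManifold I ∞ M] [I.Boundaryless] [IsManifold I' ∞ M'] [I'.Boundaryless]

theorem TwoTensor.flat_prod_chart (K : TwoTensor I M) (K' : TwoTensor I' M') (p : M × M')
    {e : E × E'} (he : e ∈ (extChartAt (I.prod I') p).target) (a b : E × E') :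
    (TwoTensor.prod I I' K K').flat (extChartAt (I.prod I') p).symm e a b =
      K.flat (extChartAt I p.1).symm e.1 a.1 b.1 + K'.flat (extChartAt I' p.2).symm e.2 a.2 b.2 := by
  rw [TwoTensor.flat_prod K K' ((contMDiffAt_extChartAt_symm_of_mem p he).mdifferentiableAt
    (by simp))]
  rw [extChartAt_prod] at he ⊢
  have h1 := K.flat_comp (f := (extChartAt I p.1).symm) (g := Prod.fst) (v := e)
    ((contMDiffAt_extChartAt_symm_of_mem p.1 he.1).mdifferentiableAt (by simp))
    differentiableAt_fst a b
  have h2 := K'.flat_comp (f := (extChartAt I' p.2).symm) (g := Prod.snd) (v := e)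
    ((contMDiffAt_extChartAt_symm_of_mem p.2 he.2).mdifferentiableAt (by simp))
    differentiableAt_snd a b
  rw [fderiv_fst] at h1
  rw [fderiv_snd] at h2
  exact congrArg₂ (· + ·) h1 h2

omit [I.Boundaryless] in
theorem eventually_mdifferentiableAt {f : V → M} {v : V} (hf : ContMDiffAt 𝓘(ℝ, V) I ∞ f v) :
    ∀ᶠ u in 𝓝 v, MDifferentiableAt 𝓘(ℝ, V) I f u := by
  have h1 := (contMDiffAt_iff_contMDiffAt_nhds (by simp)).1 (hf.of_le (m := 1) (by norm_cast))
  filter_upwards [h1] with u hu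
  exact hu.mdifferentiableAt (by simp)

variable [FiniteDimensional ℝ E] [FiniteDimensional ℝ E']

omit [FiniteDimensional ℝ E] [FiniteDimensional ℝ E'] in
theorem TwoTensor.eventuallyEq_flat_prod_chart (K : TwoTensor I M) (K' : TwoTensor I' M')
    (p : M × M') :
    (TwoTensor.prod I I' K K').flat (extChartAt (I.prod I') p).symm
      =ᶠ[𝓝 (extChartAt (I.prod I') p p)] fun e ↦
      K.flat (fun u ↦ ((extChartAt (I.prod I') p).symm u).1) e +
        K'.flat (fun u ↦ ((extChartAt (I.prod I') p).symm u).2) e := by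
  filter_upwards [eventually_mdifferentiableAt (contMDiffAt_extChartAt_symm (I := I.prod I') p)]
    with e he
  exact TwoTensor.flat_prod K K' he

theorem TwoTensor.Smooth.prod {K : TwoTensor I M} {K' : TwoTensor I' M'}
    (hK : TwoTensor.Smooth I K) (hK' : TwoTensor.Smooth I' K') :
    TwoTensor.Smooth (I.prod I') (TwoTensor.prod I I' K K') := by
  apply TwoTensor.smooth_of_flat
  intro p
  have hp := contMDiffAt_extChartAt_symm (I := I.prod I') p
  have h1 := hK.contDiffAt_flat hp.fst
  have h2 := hK'.contDiffAt_flat hp.snd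
  exact (h1.add h2).congr_of_eventuallyEq (TwoTensor.eventuallyEq_flat_prod_chart K K' p)

theorem IsRiemannianMetric.prod {g : TwoTensor I M} {g' : TwoTensor I' M'}
    (hg : IsRiemannianMetric I g) (hg' : IsRiemannianMetric I' g') :
    IsRiemannianMetric (I.prod I') (TwoTensor.prod I I' g g') := by
  refine isRiemannianMetric_of_posDef (hg.smooth.prod hg'.smooth) ?_ ?_
  · intro p (v : E × E') (w : E × E')
    refine (TwoTensor.prod_apply g g' p v w).trans (Eq.trans ?_ (TwoTensor.prod_apply g g' p w v).symm)
    exact congrArg₂ (· + ·) (hg.symm p.1 v.1 w.1) (hg'.symm p.2 v.2 w.2)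
  · intro p (v : E × E') hv
    refine lt_of_lt_of_eq ?_ (TwoTensor.prod_apply g g' p v v).symm
    have h1 : 0 ≤ g p.1 v.1 v.1 := by
      rcases eq_or_ne v.1 0 with h | h
      · exact le_of_eq (by rw [h]; exact ((g p.1 (0 : E)).map_zero).symm)
      · exact (hg.pos p.1 v.1 h).le
    have h2 : 0 ≤ g' p.2 v.2 v.2 := by
      rcases eq_or_ne v.2 0 with h | h
      · exact le_of_eq (by rw [h]; exact ((g' p.2 (0 : E')).map_zero).symm)
      · exact (hg'.pos p.2 v.2 h).le
    by_cases h : v.1 = 0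
    · have h' : v.2 ≠ 0 := fun h' ↦ hv (Prod.ext h h')
      exact add_pos_of_nonneg_of_pos h1 (hg'.pos p.2 v.2 h')
    · exact add_pos_of_pos_of_nonneg (hg.pos p.1 v.1 h) h2

theorem extDerivTwo_congr {B B' : V → V →L[ℝ] V →L[ℝ] ℝ} {v₀ : V}
    (h : B =ᶠ[𝓝 v₀] B') (u v w : V) : extDerivTwo B v₀ u v w = extDerivTwo B' v₀ u v w := by
  rw [extDerivTwo, extDerivTwo, h.fderiv_eq]

theorem fderiv_apply_of_eq_add {F : Type*} [NormedAddCommGroup F] [NormedSpace ℝ F] {B B' B'' : V → F}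
    {v₀ : V} (h : DifferentiableAt ℝ B v₀) (h' : DifferentiableAt ℝ B' v₀)
    (h'' : ∀ v, B'' v = B v + B' v) (u : V) :
    fderiv ℝ B'' v₀ u = fderiv ℝ B v₀ u + fderiv ℝ B' v₀ u := by
  rw [show B'' = fun v ↦ B v + B' v from funext h'', fderiv_fun_add h h']
  rfl

set_option synthInstance.maxHeartbeats 200000 in
theorem extDerivTwo_add {B B' : V → V →L[ℝ] V →L[ℝ] ℝ} {v₀ : V}
    (h : DifferentiableAt ℝ B v₀) (h' : DifferentiableAt ℝ B' v₀) (u v w : V) :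
    extDerivTwo (fun v ↦ B v + B' v) v₀ u v w =
      extDerivTwo B v₀ u v w + extDerivTwo B' v₀ u v w := by
  have h1 : ∀ u, fderiv ℝ (fun v ↦ B v + B' v) v₀ u = fderiv ℝ B v₀ u + fderiv ℝ B' v₀ u :=
    fderiv_apply_of_eq_add (F := V →L[ℝ] V →L[ℝ] ℝ) h h' fun _ ↦ rfl
  rw [extDerivTwo, h1, h1, h1, extDerivTwo, extDerivTwo]
  simp only [add_apply]
  ring

theorem IsSymplecticForm.prod {Ω : TwoTensor I M} {Ω' : TwoTensor I' M'}
    (hΩ : IsSymplecticForm I Ω) (hΩ' : IsSymplecticForm I' Ω') :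
    IsSymplecticForm (I.prod I') (TwoTensor.prod I I' Ω Ω') := by
  have hs := hΩ.smooth.prod hΩ'.smooth
  have ha : ∀ p (v : TangentSpace (I.prod I') p), TwoTensor.prod I I' Ω Ω' p v v = 0 := by
    intro p (v : E × E')
    refine (TwoTensor.prod_apply Ω Ω' p v v).trans ?_
    have h1 := hΩ.alternating p.1 v.1
    have h2 := hΩ'.alternating p.2 v.2
    exact (congrArg₂ (· + ·) h1 h2).trans (add_zero 0)
  refine ⟨hs, ha, ?_, ?_⟩
  · intro p (v : E × E') hv
    refine Prod.ext (hΩ.nondegenerate p.1 v.1 fun (w : E) ↦ ?_)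
      (hΩ'.nondegenerate p.2 v.2 fun (w : E') ↦ ?_)
    · have h1 := (TwoTensor.prod_apply Ω Ω' p v (w, 0)).symm.trans (hv _)
      have h2 : Ω' p.2 v.2 (0 : E') = 0 := (Ω' p.2 v.2).map_zero
      exact (add_zero _).symm.trans ((congrArg _ h2.symm).trans h1)
    · have h1 := (TwoTensor.prod_apply Ω Ω' p v (0, w)).symm.trans (hv _)
      have h2 : Ω p.1 v.1 (0 : E) = 0 := (Ω p.1 v.1).map_zero
      exact (zero_add _).symm.trans ((congrArg (· + _) h2.symm).trans h1)
  · refine isClosedForm_of_flat hs ha fun p u v w ↦ ?_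
    have hp := contMDiffAt_extChartAt_symm (I := I.prod I') p
    have e1 := hΩ.closed.extDerivTwo_flat hΩ.smooth hΩ.alternating hp.fst u v w
    have e2 := hΩ'.closed.extDerivTwo_flat hΩ'.smooth hΩ'.alternating hp.snd u v w
    have d1 := (hΩ.smooth.contDiffAt_flat hp.fst).differentiableAt (by simp)
    have d2 := (hΩ'.smooth.contDiffAt_flat hp.snd).differentiableAt (by simp)
    rw [extDerivTwo_congr (TwoTensor.eventuallyEq_flat_prod_chart Ω Ω' p),
      extDerivTwo_add d1 d2, e1, e2, add_zero]

/-- The direct sum of two fields of endomorphisms. -/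
def EndField.prod (J : EndField I M) (J' : EndField I' M') : EndField (I.prod I') (M × M') :=
  fun p ↦ (J p.1).prodMap (J' p.2)

omit [IsManifold I ∞ M] [I.Boundaryless] [IsManifold I' ∞ M'] [I'.Boundaryless]
  [FiniteDimensional ℝ E] [FiniteDimensional ℝ E'] in
theorem IsCompatibleStructure.prod {Ω g : TwoTensor I M} {Ω' g' : TwoTensor I' M'}
    {J : EndField I M} {J' : EndField I' M'} (h : IsCompatibleStructure I Ω g J)
    (h' : IsCompatibleStructure I' Ω' g' J') :
    IsCompatibleStructure (I.prod I') (TwoTensor.prod I I' Ω Ω') (TwoTensor.prod I I' g g')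
      (EndField.prod J J') := by
  refine ⟨fun p (v : E × E') (w : E × E') ↦ ?_, fun p (v : E × E') ↦ ?_⟩
  · refine (TwoTensor.prod_apply g g' p v w).trans (Eq.trans ?_
      (TwoTensor.prod_apply Ω Ω' p v (J p.1 w.1, J' p.2 w.2)).symm)
    exact congrArg₂ (· + ·) (h.1 p.1 v.1 w.1) (h'.1 p.2 v.2 w.2)
  · exact Prod.ext (h.2 p.1 v.1) (h'.2 p.2 v.2)

theorem IsAlmostKahler.prod {Ω g : TwoTensor I M} {Ω' g' : TwoTensor I' M'}
    (h : IsAlmostKahler I Ω g) (h' : IsAlmostKahler I' Ω' g') :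
    IsAlmostKahler (I.prod I') (TwoTensor.prod I I' Ω Ω') (TwoTensor.prod I I' g g') := by
  obtain ⟨J, hJ⟩ := h.compatible
  obtain ⟨J', hJ'⟩ := h'.compatible
  exact ⟨h.symplectic.prod h'.symplectic, h.riemannian.prod h'.riemannian, _, hJ.prod hJ'⟩

omit [FiniteDimensional ℝ E] [FiniteDimensional ℝ E'] in
theorem IsChartStructure.prod {Ω g : TwoTensor I M} {Ω' g' : TwoTensor I' M'} {p : M × M'}
    {j : E → E →L[ℝ] E} {j' : E' → E' →L[ℝ] E'} (h : IsChartStructure Ω g p.1 j)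
    (h' : IsChartStructure Ω' g' p.2 j') :
    IsChartStructure (TwoTensor.prod I I' Ω Ω') (TwoTensor.prod I I' g g') p
      (fun e ↦ (j e.1).prodMap (j' e.2)) := by
  have hp : extChartAt (I.prod I') p p = (extChartAt I p.1 p.1, extChartAt I' p.2 p.2) := by
    rw [extChartAt_prod]; rfl
  have h1 : ∀ᶠ e in 𝓝 (extChartAt (I.prod I') p p), ∀ a b,
      g.flat (extChartAt I p.1).symm e.1 a b = Ω.flat (extChartAt I p.1).symm e.1 a (j e.1 b) := by
    rw [hp]; exact (continuousAt_fst (X := E) (Y := E') (p := (_, _))).eventually (by unfold IsChartStructure at h; exact h)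
  have h2 : ∀ᶠ e in 𝓝 (extChartAt (I.prod I') p p), ∀ a b,
      g'.flat (extChartAt I' p.2).symm e.2 a b =
        Ω'.flat (extChartAt I' p.2).symm e.2 a (j' e.2 b) := by
    rw [hp]; exact (continuousAt_snd (X := E) (Y := E') (p := (_, _))).eventually (by unfold IsChartStructure at h'; exact h')
  filter_upwards [h1, h2, extChartAt_target_mem_nhds p] with e he1 he2 he a b
  rw [TwoTensor.flat_prod_chart _ _ p he, TwoTensor.flat_prod_chart _ _ p he, he1, he2]
  rfl

theorem differentiableAt_prodMap {j : E → E →L[ℝ] E} {j' : E' → E' →L[ℝ] E'} {e : E × E'}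
    (h : ContDiffAt ℝ ∞ j e.1) (h' : ContDiffAt ℝ ∞ j' e.2) :
    DifferentiableAt ℝ (fun e : E × E' ↦ (j e.1).prodMap (j' e.2)) e := by
  refine ContDiffAt.differentiableAt (n := ∞) (contDiffAt_clm_of_apply fun a ↦ ?_) (by simp)
  exact ((h.comp e contDiffAt_fst).clm_apply contDiffAt_const).prodMk
    ((h'.comp e contDiffAt_snd).clm_apply contDiffAt_const)

theorem flatNijenhuis_prodMap {j : E → E →L[ℝ] E} {j' : E' → E' →L[ℝ] E'} {e : E × E'}
    (h : ContDiffAt ℝ ∞ j e.1) (h' : ContDiffAt ℝ ∞ j' e.2) (v w : E × E') :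
    flatNijenhuis (fun e : E × E' ↦ (j e.1).prodMap (j' e.2)) e v w =
      (flatNijenhuis j e.1 v.1 w.1, flatNijenhuis j' e.2 v.2 w.2) := by
  have hd := differentiableAt_prodMap h h'
  have d1 : DifferentiableAt ℝ j e.1 := h.differentiableAt (by simp)
  have d2 : DifferentiableAt ℝ j' e.2 := h'.differentiableAt (by simp)
  have hder : ∀ u b, fderiv ℝ (fun e : E × E' ↦ (j e.1).prodMap (j' e.2)) e u b =
      (fderiv ℝ j e.1 u.1 b.1, fderiv ℝ j' e.2 u.2 b.2) := by
    intro u b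
    have h1 : HasFDerivAt (fun e : E × E' ↦ j e.1) _ e :=
      HasFDerivAt.comp e d1.hasFDerivAt hasFDerivAt_fst
    have h2 : HasFDerivAt (fun e : E × E' ↦ j' e.2) _ e :=
      HasFDerivAt.comp e d2.hasFDerivAt hasFDerivAt_snd
    have h3 := (h1.clm_apply (hasFDerivAt_const b.1 e)).prodMk
      (h2.clm_apply (hasFDerivAt_const b.2 e))
    have h4 := hd.hasFDerivAt.clm_apply (hasFDerivAt_const b e)
    have h5 := DFunLike.congr_fun (h4.unique h3) u
    simpa using! h5
  simp only [flatNijenhuis, hder]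
  simp

theorem IsKahler.prod {Ω g : TwoTensor I M} {Ω' g' : TwoTensor I' M'}
    (h : IsKahler I Ω g) (h' : IsKahler I' Ω' g') :
    IsKahler (I.prod I') (TwoTensor.prod I I' Ω Ω') (TwoTensor.prod I I' g g') := by
  obtain ⟨J, hJ, hi⟩ := h.integrable
  obtain ⟨J', hJ', hi'⟩ := h'.integrable
  have hs := h.symplectic
  have hs' := h'.symplectic
  have hp := hs.prod hs'
  refine ⟨h.toIsAlmostKahler.prod h'.toIsAlmostKahler, _, hJ.prod hJ', ?_⟩
  refine isIntegrable_of_flat hp.alternating hp.nondegenerate (hJ.prod hJ') fun p ↦ ?_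
  obtain ⟨j, hjs, hj⟩ := exists_isChartStructure hs.smooth hs.alternating hs.nondegenerate
    h.riemannian.smooth p.1
  obtain ⟨j', hjs', hj'⟩ := exists_isChartStructure hs'.smooth hs'.alternating hs'.nondegenerate
    h'.riemannian.smooth p.2
  have hpp : extChartAt (I.prod I') p p = (extChartAt I p.1 p.1, extChartAt I' p.2 p.2) := by
    rw [extChartAt_prod]; rfl
  refine ⟨_, ?_, hj.prod hj', fun v w ↦ ?_⟩
  · rw [hpp]; exact differentiableAt_prodMap hjs hjs'
  · rw [hpp, flatNijenhuis_prodMap hjs hjs',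
      hi.flatNijenhuis_eq_zero hs.alternating hs.nondegenerate hJ hj
        (hjs.differentiableAt (by simp)),
      hi'.flatNijenhuis_eq_zero hs'.alternating hs'.nondegenerate hJ' hj'
        (hjs'.differentiableAt (by simp))]
    rfl

end Products

section ExpUnit

/-- The exponential of a real number as a unit. -/
def expUnit (t : ℝ) : ℝˣ := Units.mk0 (Real.exp t) (Real.exp_ne_zero t)

theorem expUnit_val (t : ℝ) : (expUnit t : ℝ) = Real.exp t := rfl

theorem expUnit_zero : expUnit 0 = 1 := Units.ext Real.exp_zero

theorem contMDiff_expUnit : ContMDiff 𝓘(ℝ, ℝ) 𝓘(ℝ, ℝ) ∞ expUnit := by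
  apply ContMDiff.of_comp_isOpenEmbedding Units.isOpenEmbedding_val
  exact Real.contDiff_exp.contMDiff

theorem mfderiv_expUnit : mfderiv 𝓘(ℝ, ℝ) 𝓘(ℝ, ℝ) expUnit 0 (1 : ℝ) = (1 : ℝ) := by
  have h : HasMFDerivAt 𝓘(ℝ, ℝ) 𝓘(ℝ, ℝ) expUnit 0 (ContinuousLinearMap.id ℝ ℝ) := by
    refine ⟨contMDiff_expUnit.continuous.continuousAt, ?_⟩
    have h1 : HasFDerivAt Real.exp (ContinuousLinearMap.id ℝ ℝ) 0 := by
      have := (Real.hasDerivAt_exp 0).hasFDerivAt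
      rw [Real.exp_zero] at this
      rwa [show ContinuousLinearMap.toSpanSingleton ℝ (1 : ℝ) = ContinuousLinearMap.id ℝ ℝ by
        ext; simp] at this
    exact h1.hasFDerivWithinAt
  exact DFunLike.congr_fun h.mfderiv (1 : ℝ)

end ExpUnit

section Bundles

variable {EP : Type*} [NormedAddCommGroup EP] [NormedSpace ℝ EP]
  {HP : Type*} [TopologicalSpace HP] {IP : ModelWithCorners ℝ EP HP}
  {P : Type*} [TopologicalSpace P] [ChartedSpace HP P] [MulAction ℝˣ P]
  {E : Type*} [NormedAddCommGroup E] [NormedSpace ℝ E]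
  {H : Type*} [TopologicalSpace H] {I : ModelWithCorners ℝ E H}
  {M : Type*} [TopologicalSpace M] [ChartedSpace H M] {τ : P → M}

/-- A local trivialization of a principal bundle, as a section `σ` together with the fibre
coordinate `a`. -/
theorem IsPrincipalBundle.exists_section (h : IsPrincipalBundle IP I τ) (p : P) :
    ∃ (B : Set M) (σ : M → P) (a : P → ℝˣ), IsOpen B ∧ τ p ∈ B ∧ IsOpen (τ ⁻¹' B) ∧
      ContMDiffOn I IP ∞ σ B ∧ (∀ y ∈ B, τ (σ y) = y) ∧ σ (τ p) = p ∧
      ContMDiffOn IP I ∞ τ (τ ⁻¹' B) ∧ ContMDiffOn IP 𝓘(ℝ, ℝ) ∞ a (τ ⁻¹' B) ∧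
      (∀ q, τ q ∈ B → q = a q • σ (τ q)) ∧
      ContMDiffOn (𝓘(ℝ, ℝ).prod IP) IP ∞ (fun q : ℝˣ × P ↦ q.1 • q.2) (univ ×ˢ (τ ⁻¹' B)) ∧
      ∀ q, τ q ∈ B → ∀ s : ℝˣ, τ (s • q) = τ q ∧ a (s • q) = s * a q := by
  obtain ⟨e, hx, hs, hs', he⟩ := h (τ p)
  have hp : p ∈ e.source := e.mem_source.2 hx
  have hsrc : e.source = τ ⁻¹' e.baseSet := e.source_eq
  have hinv : ∀ y ∈ e.baseSet, ∀ t : ℝˣ, (y, t) ∈ e.target := fun y hy t ↦ e.mem_target.2 hy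
  have hsy : ∀ y ∈ e.baseSet, ∀ t : ℝˣ, e.toOpenPartialHomeomorph.symm (y, t) ∈ e.source :=
    fun y hy t ↦ e.toOpenPartialHomeomorph.map_target (hinv y hy t)
  have hr : ∀ y ∈ e.baseSet, ∀ t : ℝˣ, e (e.toOpenPartialHomeomorph.symm (y, t)) = (y, t) :=
    fun y hy t ↦ e.toOpenPartialHomeomorph.right_inv (hinv y hy t)
  have hl : ∀ q ∈ e.source, e.toOpenPartialHomeomorph.symm (e q) = q :=
    fun q hq ↦ e.toOpenPartialHomeomorph.left_inv hq
  have hτs : ∀ y ∈ e.baseSet, ∀ t : ℝˣ, τ (e.toOpenPartialHomeomorph.symm (y, t)) = y :=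
    fun y hy t ↦ by rw [← e.coe_fst (hsy y hy t), hr y hy t]
  have hact : ∀ q ∈ e.source, ∀ s : ℝˣ,
      s • q = e.toOpenPartialHomeomorph.symm (τ q, s * (e q).2) := by
    intro q hq s
    rw [← hl _ (he q hq s).1, (he q hq s).2, e.coe_fst hq]
  have hτ : ContMDiffOn IP I ∞ τ (τ ⁻¹' e.baseSet) := by
    rw [← hsrc]
    refine (contMDiff_fst.comp_contMDiffOn hs).congr fun q hq ↦ (e.coe_fst hq).symm
  have hsnd : ContMDiffOn IP 𝓘(ℝ, ℝ) ∞ (fun q ↦ (e q).2) (τ ⁻¹' e.baseSet) := by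
    rw [← hsrc]
    exact contMDiff_snd.comp_contMDiffOn hs
  refine ⟨e.baseSet, fun y ↦ e.toOpenPartialHomeomorph.symm (y, (e p).2),
    fun q ↦ (e q).2 * (e p).2⁻¹, e.open_baseSet, hx, by rw [← hsrc]; exact e.open_source,
    ?_, fun y hy ↦ hτs y hy _, ?_, hτ, ?_, ?_, ?_, ?_⟩
  · exact hs'.comp (contMDiffOn_id.prodMk contMDiffOn_const) fun y hy ↦ hinv y hy _
  · rw [← e.coe_fst hp]; exact hl p hp
  · exact hsnd.mul contMDiffOn_const
  · intro q hq
    have h1 := hact _ (hsy (τ q) hq (e p).2) ((e q).2 * (e p).2⁻¹)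
    rw [h1, hτs _ hq, hr _ hq]
    rw [inv_mul_cancel_right, ← e.coe_fst (e.mem_source.2 hq)]
    exact (hl q (e.mem_source.2 hq)).symm
  · have h1 : ContMDiffOn (𝓘(ℝ, ℝ).prod IP) (I.prod 𝓘(ℝ, ℝ)) ∞
        (fun q : ℝˣ × P ↦ (τ q.2, q.1 * (e q.2).2)) (univ ×ˢ (τ ⁻¹' e.baseSet)) :=
      (hτ.comp contMDiffOn_snd fun q hq ↦ hq.2).prodMk
        (contMDiffOn_fst.mul (hsnd.comp contMDiffOn_snd fun q hq ↦ hq.2))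
    exact (hs'.comp h1 fun q hq ↦ hinv _ hq.2 _).congr
      fun q hq ↦ hact _ (e.mem_source.2 hq.2) _
  · intro q hq s
    have h1 := he q (e.mem_source.2 hq) s
    refine ⟨?_, ?_⟩
    · rw [← e.coe_fst h1.1, h1.2, e.coe_fst (e.mem_source.2 hq)]
    · simp only [h1.2, mul_assoc]

theorem IsPrincipalBundle.proj_smul (h : IsPrincipalBundle IP I τ) (s : ℝˣ) (p : P) :
    τ (s • p) = τ p := by
  obtain ⟨B, σ, a, -, hx, -, -, -, -, -, -, -, -, hs⟩ := h.exists_section p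
  exact (hs p hx s).1

theorem IsPrincipalBundle.exists_smul_eq (h : IsPrincipalBundle IP I τ) {p q : P}
    (hpq : τ p = τ q) : ∃ s : ℝˣ, q = s • p := by
  obtain ⟨B, σ, a, -, hx, -, -, -, hσ, -, -, ha, -, -⟩ := h.exists_section p
  refine ⟨a q, ?_⟩
  have h1 := ha q (hpq ▸ hx)
  rw [← hpq, hσ] at h1
  exact h1

theorem IsPrincipalBundle.surjective (h : IsPrincipalBundle IP I τ) : Function.Surjective τ := by
  intro x
  obtain ⟨e, hx, -⟩ := h x
  exact ⟨_, e.proj_symm_apply (e.mem_target.2 hx : (x, (1 : ℝˣ)) ∈ e.target)⟩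

theorem IsPrincipalBundle.contMDiff (h : IsPrincipalBundle IP I τ) : ContMDiff IP I ∞ τ := by
  intro p
  obtain ⟨B, σ, a, -, hx, ho, -, -, -, hτ, -⟩ := h.exists_section p
  exact hτ.contMDiffAt (ho.mem_nhds hx)

theorem IsPrincipalBundle.contMDiff_smul (h : IsPrincipalBundle IP I τ) :
    ContMDiff (𝓘(ℝ, ℝ).prod IP) IP ∞ (fun q : ℝˣ × P ↦ q.1 • q.2) := by
  intro p
  obtain ⟨B, σ, a, -, hx, ho, -, -, -, -, -, -, hs, -⟩ := h.exists_section p.2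
  exact hs.contMDiffAt ((isOpen_univ.prod ho).mem_nhds ⟨mem_univ _, hx⟩)

theorem IsPrincipalBundle.contMDiff_const_smul (h : IsPrincipalBundle IP I τ) (s : ℝˣ) :
    ContMDiff IP IP ∞ (fun q : P ↦ s • q) :=
  h.contMDiff_smul.comp (contMDiff_const.prodMk contMDiff_id)

theorem IsPrincipalBundle.contMDiff_smul_const (h : IsPrincipalBundle IP I τ) (p : P) :
    ContMDiff 𝓘(ℝ, ℝ) IP ∞ (fun s : ℝˣ ↦ s • p) :=
  h.contMDiff_smul.comp (contMDiff_id.prodMk contMDiff_const)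

theorem IsPrincipalBundle.mdifferentiable (h : IsPrincipalBundle IP I τ) :
    MDifferentiable IP I τ := h.contMDiff.mdifferentiable (by simp)

theorem IsPrincipalBundle.mdifferentiable_const_smul (h : IsPrincipalBundle IP I τ) (s : ℝˣ) :
    MDifferentiable IP IP (fun q : P ↦ s • q) :=
  (h.contMDiff_const_smul s).mdifferentiable (by simp)

/-- The Liouville vector field is the velocity of the flow `t ↦ exp t • p`. -/
theorem IsPrincipalBundle.mfderiv_expUnit_smul (h : IsPrincipalBundle IP I τ) (p : P) :
    (mfderiv 𝓘(ℝ, ℝ) IP (fun t : ℝ ↦ expUnit t • p) 0 (1 : ℝ) : EP) = liouville IP p := by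
  have h0 : MDifferentiableAt 𝓘(ℝ, ℝ) IP (fun s : ℝˣ ↦ s • p) (expUnit 0) :=
    (h.contMDiff_smul_const p).mdifferentiableAt (by simp)
  have h1 := mfderiv_comp_apply (0 : ℝ) h0
    (contMDiff_expUnit.mdifferentiableAt (by simp)) (1 : ℝ)
  refine h1.trans ?_
  have h2 : ∀ s : ℝˣ, s = 1 → ∀ v : ℝ, v = 1 →
      (mfderiv 𝓘(ℝ, ℝ) IP (fun s : ℝˣ ↦ s • p) s v : EP) = liouville IP p := by
    rintro _ rfl _ rfl; rfl
  exact h2 _ expUnit_zero _ mfderiv_expUnit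

theorem IsPrincipalBundle.mfderiv_smul_liouville (h : IsPrincipalBundle IP I τ) (s : ℝˣ) (p : P) :
    (mfderiv IP IP (fun q : P ↦ s • q) p (liouville IP p) : EP) = liouville IP (s • p) := by
  have h1 := mfderiv_comp_apply (1 : ℝˣ)
    (h.mdifferentiable_const_smul s ((1 : ℝˣ) • p))
    ((h.contMDiff_smul_const p).mdifferentiableAt (by simp)) (1 : ℝ)
  have h2 : (fun q : P ↦ s • q) ∘ (fun t : ℝˣ ↦ t • p) = fun t : ℝˣ ↦ t • s • p := by
    ext t; exact smul_comm s t p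
  rw [h2] at h1
  have h3 : ∀ q, q = p → (mfderiv IP IP (fun q : P ↦ s • q) q (liouville IP p : EP) : EP) =
      mfderiv IP IP (fun q : P ↦ s • q) p (liouville IP p : EP) := by
    rintro _ rfl; rfl
  exact (h3 _ (one_smul _ p)).symm.trans h1.symm

theorem IsPrincipalBundle.mfderiv_proj_liouville (h : IsPrincipalBundle IP I τ) (p : P) :
    mfderiv IP I τ p (liouville IP p) = 0 := by
  have h1 := mfderiv_comp_apply (1 : ℝˣ) (h.mdifferentiable ((1 : ℝˣ) • p))
    ((h.contMDiff_smul_const p).mdifferentiableAt (by simp)) (1 : ℝ)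
  have h2 : τ ∘ (fun t : ℝˣ ↦ t • p) = fun _ ↦ τ p := by
    ext t; exact h.proj_smul t p
  rw [h2, mfderiv_const] at h1
  have h3 : ∀ q, q = p → (mfderiv IP I τ q (liouville IP p : EP) : E) =
      mfderiv IP I τ p (liouville IP p : EP) := by
    rintro _ rfl; rfl
  exact (h3 _ (one_smul _ p)).symm.trans h1.symm

theorem IsPrincipalBundle.mfderiv_proj_smul (h : IsPrincipalBundle IP I τ) (s : ℝˣ) (p : P)
    (w : EP) : (mfderiv IP I τ (s • p) (mfderiv IP IP (fun q : P ↦ s • q) p w) : E) =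
      mfderiv IP I τ p w := by
  have h1 := mfderiv_comp_apply p (h.mdifferentiable (s • p))
    (h.mdifferentiable_const_smul s p) w
  have h2 : τ ∘ (fun q : P ↦ s • q) = τ := by
    ext t; exact h.proj_smul s t
  rw [h2] at h1
  exact h1.symm

/-- Near `p` a principal bundle has a smooth section through `p`. -/
theorem IsPrincipalBundle.exists_smooth_section (h : IsPrincipalBundle IP I τ) (p : P) :
    ∃ σ : M → P, ContMDiffAt I IP ∞ σ (τ p) ∧ σ (τ p) = p ∧ ∀ᶠ y in 𝓝 (τ p), τ (σ y) = y := by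
  obtain ⟨B, σ, a, hB, hx, -, hσ, hτσ, hp, -⟩ := h.exists_section p
  exact ⟨σ, hσ.contMDiffAt (hB.mem_nhds hx), hp, Filter.eventually_of_mem (hB.mem_nhds hx) hτσ⟩

theorem IsPrincipalBundle.mfderiv_proj_section {p : P} (h : IsPrincipalBundle IP I τ)
    {σ : M → P} {x : M} (hσ : ContMDiffAt I IP ∞ σ x) (hp : σ x = p)
    (hτ : ∀ᶠ y in 𝓝 x, τ (σ y) = y) (v : E) :
    (mfderiv IP I τ p (mfderiv I IP σ x v) : E) = v := by
  subst hp
  have h1 := mfderiv_comp_apply x (h.mdifferentiable (σ x)) (hσ.mdifferentiableAt (by simp)) v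
  have h2 : τ ∘ σ =ᶠ[𝓝 x] id := hτ
  have h3 := h2.mfderiv_eq (I := I) (I' := I)
  rw [mfderiv_id] at h3
  exact h1.symm.trans (DFunLike.congr_fun h3 v)

theorem IsPrincipalBundle.mfderiv_surjective (h : IsPrincipalBundle IP I τ) (p : P) (v : E) :
    ∃ w : EP, (mfderiv IP I τ p w : E) = v := by
  obtain ⟨σ, hσ, hp, hτ⟩ := h.exists_smooth_section p
  exact ⟨_, h.mfderiv_proj_section hσ hp hτ v⟩

/-- The Liouville vector field spans the kernel of the differential of the projection. -/
theorem IsPrincipalBundle.exists_smul_liouville (h : IsPrincipalBundle IP I τ) {p : P} {w : EP}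
    (hw : (mfderiv IP I τ p w : E) = 0) : ∃ c : ℝ, w = c • (liouville IP p : EP) := by
  obtain ⟨B, σ, a, hB, hx, ho, hσ, hτσ, hp, -, ha, haσ, -, hsm⟩ := h.exists_section p
  have hσ' := hσ.contMDiffAt (hB.mem_nhds hx)
  have ha' := ha.contMDiffAt (ho.mem_nhds hx)
  have hdσ : MDifferentiableAt IP IP (σ ∘ τ) p :=
    (hσ'.mdifferentiableAt (by simp)).comp p (h.mdifferentiable p)
  have hda := ha'.mdifferentiableAt (by simp)
  have ha1 : a p = 1 := by
    have h1 := (hsm p hx (a p)).2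
    have h2 := haσ p hx
    rw [hp] at h2
    rw [← h2] at h1
    exact (mul_eq_right.1 h1.symm)
  have h1 : (fun q : ℝˣ × P ↦ q.1 • q.2) ∘ (fun q ↦ (a q, (σ ∘ τ) q)) =ᶠ[𝓝 p] id := by
    filter_upwards [ho.mem_nhds hx] with q hq
    exact (haσ q hq).symm
  have hS : MDifferentiableAt (𝓘(ℝ, ℝ).prod IP) IP (fun q : ℝˣ × P ↦ q.1 • q.2)
      (a p, (σ ∘ τ) p) := h.contMDiff_smul.mdifferentiableAt (by simp)
  have h2 := mfderiv_comp_apply p hS (hda.prodMk hdσ) w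
  rw [h1.mfderiv_eq (I := IP) (I' := IP), mfderiv_id, mfderiv_prodMk hda hdσ] at h2
  let da : ℝ := mfderiv IP 𝓘(ℝ, ℝ) a p w
  let u : EP := mfderiv IP IP (σ ∘ τ) p w
  have h3 := mfderiv_prod_eq_add_apply (I := 𝓘(ℝ, ℝ)) (I' := IP) (I'' := IP) hS (v := (da, u))
  have h4 : (mfderiv IP IP (σ ∘ τ) p w : EP) = 0 := by
    refine (mfderiv_comp_apply p (hσ'.mdifferentiableAt (by simp)) (h.mdifferentiable p) w).trans ?_
    exact (congrArg (mfderiv I IP σ (τ p)) hw).trans (map_zero _)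
  refine ⟨da, h2.trans (h3.trans ?_)⟩
  have h5 : ∀ (c : ℝ) (s : ℝˣ) (q : P), s = 1 → q = p →
      (mfderiv 𝓘(ℝ, ℝ) IP (fun z : ℝˣ ↦ z • q) s c : EP) = c • (liouville IP p : EP) := by
    rintro c s q rfl rfl
    exact (congrArg (mfderiv 𝓘(ℝ, ℝ) IP (fun z : ℝˣ ↦ z • q) 1) (mul_one c).symm).trans
      ((mfderiv 𝓘(ℝ, ℝ) IP (fun z : ℝˣ ↦ z • q) 1).map_smul c (1 : ℝ))
  refine Eq.trans (congrArg₂ (· + ·) (h5 _ _ _ ha1 hp) ?_) (add_zero _)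
  exact (congrArg (mfderiv IP IP (fun z : P ↦ a p • z) (σ (τ p))) h4).trans (map_zero _)

theorem IsPrincipalBundle.liouville_ne_zero (h : IsPrincipalBundle IP I τ) (p : P) :
    liouville IP p ≠ 0 := by
  obtain ⟨B, σ, a, hB, hx, ho, hσ, hτσ, hp, -, ha, haσ, -, hsm⟩ := h.exists_section p
  have ha' : ContMDiffAt IP 𝓘(ℝ, ℝ) ∞ (fun q ↦ (a q : ℝ)) p :=
    (Units.contMDiff_val.contMDiffAt).comp p (ha.contMDiffAt (ho.mem_nhds hx))
  have h0 : ContMDiff 𝓘(ℝ, ℝ) IP ∞ (fun t : ℝ ↦ expUnit t • p) :=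
    (h.contMDiff_smul_const p).comp contMDiff_expUnit
  have ha'' : MDifferentiableAt IP 𝓘(ℝ, ℝ) (fun q ↦ (a q : ℝ)) (expUnit 0 • p) := by
    rw [expUnit_zero, one_smul]; exact ha'.mdifferentiableAt (by simp)
  have h1 := mfderiv_comp_apply (0 : ℝ) ha'' (h0.mdifferentiableAt (by simp)) (1 : ℝ)
  have h2 : (fun q ↦ (a q : ℝ)) ∘ (fun t : ℝ ↦ expUnit t • p) = fun t ↦ Real.exp t * a p := by
    ext t
    simp only [Function.comp, (hsm p hx _).2, Units.val_mul, expUnit_val]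
  intro hz
  have h4 := (h.mfderiv_expUnit_smul p).trans hz
  rw [h2, mfderiv_eq_fderiv] at h1
  have h5 : HasDerivAt (fun t ↦ Real.exp t * (a p : ℝ)) (a p : ℝ) 0 := by
    simpa using (Real.hasDerivAt_exp 0).mul_const (a p : ℝ)
  have h6 : (fderiv ℝ (fun t ↦ Real.exp t * (a p : ℝ)) 0 1 : ℝ) = a p := by
    rw [h5.hasFDerivAt.fderiv]; simp
  have h7 := h6.symm.trans (h1.trans ((congrArg _ h4).trans (map_zero _)))
  exact (a p).ne_zero h7

end Bundles

section Basic

variable {EP : Type*} [NormedAddCommGroup EP] [NormedSpace ℝ EP]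
  {HP : Type*} [TopologicalSpace HP] {IP : ModelWithCorners ℝ EP HP}
  {P : Type*} [TopologicalSpace P] [ChartedSpace HP P] [MulAction ℝˣ P]
  {E : Type*} [NormedAddCommGroup E] [NormedSpace ℝ E]
  {H : Type*} [TopologicalSpace H] {I : ModelWithCorners ℝ E H}
  {M : Type*} [TopologicalSpace M] [ChartedSpace H M] {τ : P → M}

/-- Invariant 2-tensors. -/
def TwoTensor.IsInvariant (K : TwoTensor IP P) : Prop :=
  ∀ (s : ℝˣ) (p : P) (v w : EP), K (s • p) (mfderiv IP IP (fun q : P ↦ s • q) p v)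
    (mfderiv IP IP (fun q : P ↦ s • q) p w) = K p v w

/-- Invariant 1-forms. -/
def OneForm.IsInvariant (K : OneForm IP P) : Prop :=
  ∀ (s : ℝˣ) (p : P) (v : EP), K (s • p) (mfderiv IP IP (fun q : P ↦ s • q) p v) = K p v

theorem IsPrincipalBundle.exists_eq_add_liouville (h : IsPrincipalBundle IP I τ) {p : P} {s : ℝˣ}
    {v v' : EP} (hv : (mfderiv IP I τ (s • p) v' : E) = mfderiv IP I τ p v) :
    ∃ c : ℝ, v' = (mfderiv IP IP (fun q : P ↦ s • q) p v : EP) +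
      c • (liouville IP (s • p) : EP) := by
  let u : EP := mfderiv IP IP (fun q : P ↦ s • q) p v
  have h1 : (mfderiv IP I τ (s • p) (v' - u : EP) : E) = 0 :=
    ((mfderiv IP I τ (s • p)).map_sub (v' : EP) _).trans
      (sub_eq_zero.2 (hv.trans (h.mfderiv_proj_smul s p v).symm))
  obtain ⟨c, hc⟩ := h.exists_smul_liouville h1
  exact ⟨c, (sub_eq_iff_eq_add'.1 hc)⟩

/-- An invariant 2-tensor that vanishes on the Liouville vector field only depends on the
projections of its arguments. -/
theorem TwoTensor.IsInvariant.eq_of_proj_eq (h : IsPrincipalBundle IP I τ) {K : TwoTensor IP P}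
    (hK : K.IsInvariant) (h1 : ∀ p (w : EP), K p (liouville IP p) w = 0)
    (h2 : ∀ p (w : EP), K p w (liouville IP p) = 0) {p q : P} (hpq : τ p = τ q) {v v' w w' : EP}
    (hv : (mfderiv IP I τ q v' : E) = mfderiv IP I τ p v)
    (hw : (mfderiv IP I τ q w' : E) = mfderiv IP I τ p w) : K q v' w' = K p v w := by
  obtain ⟨s, rfl⟩ := h.exists_smul_eq hpq
  obtain ⟨c, rfl⟩ := h.exists_eq_add_liouville hv
  obtain ⟨d, rfl⟩ := h.exists_eq_add_liouville hw
  have key : ∀ (B : EP →L[ℝ] EP →L[ℝ] ℝ) (X : EP), (∀ w, B X w = 0) → (∀ w, B w X = 0) →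
      ∀ a b : EP, B (a + c • X) (b + d • X) = B a b := by
    intro B X hB hB' a b
    simp [hB, hB']
  exact (key (K (s • p)) (liouville IP (s • p)) (h1 _) (h2 _) _ _).trans (hK s p v w)

theorem OneForm.IsInvariant.eq_of_proj_eq (h : IsPrincipalBundle IP I τ) {K : OneForm IP P}
    (hK : K.IsInvariant) (h1 : ∀ p, K p (liouville IP p) = 0) {p q : P} (hpq : τ p = τ q)
    {v v' : EP} (hv : (mfderiv IP I τ q v' : E) = mfderiv IP I τ p v) : K q v' = K p v := by
  obtain ⟨s, rfl⟩ := h.exists_smul_eq hpq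
  obtain ⟨c, rfl⟩ := h.exists_eq_add_liouville hv
  have key : ∀ (B : EP →L[ℝ] ℝ) (X : EP), B X = 0 → ∀ a : EP, B (a + c • X) = B a := by
    intro B X hB a
    simp [hB]
  exact (key (K (s • p)) (liouville IP (s • p)) (h1 _) _).trans (hK s p v)

variable [IsManifold I ∞ M] [I.Boundaryless] [IsManifold IP ∞ P]

omit [MulAction ℝˣ P] in
theorem eventually_section_comp {σ : M → P} {x : M}
    (hσ : ContMDiffAt I IP ∞ σ x) (hτσ : ∀ᶠ y in 𝓝 x, τ (σ y) = y) :
    ContMDiffAt 𝓘(ℝ, E) IP ∞ (σ ∘ (extChartAt I x).symm) (extChartAt I x x) ∧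
    ∀ᶠ e in 𝓝 (extChartAt I x x),
      MDifferentiableAt 𝓘(ℝ, E) IP (σ ∘ (extChartAt I x).symm) e ∧
      (extChartAt I x).symm =ᶠ[𝓝 e] τ ∘ (σ ∘ (extChartAt I x).symm) := by
  have hx := contMDiffAt_extChartAt_symm (I := I) x
  have h0 : (extChartAt I x).symm (extChartAt I x x) = x := extChartAt_to_inv x
  have h1 : ContMDiffAt 𝓘(ℝ, E) IP ∞ (σ ∘ (extChartAt I x).symm) (extChartAt I x x) :=
    ContMDiffAt.comp _ (by rwa [h0]) hx
  have h2 : ∀ᶠ e in 𝓝 (extChartAt I x x),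
      (extChartAt I x).symm e = τ (σ ((extChartAt I x).symm e)) := by
    have := hx.continuousAt.eventually (p := fun y ↦ τ (σ y) = y) (by rwa [h0])
    exact this.mono fun _ h ↦ h.symm
  exact ⟨h1, (eventually_mdifferentiableAt h1).and h2.eventually_nhds⟩

theorem IsPrincipalBundle.twoTensor_smooth_of_pullback (h : IsPrincipalBundle IP I τ)
    {K : TwoTensor IP P} {L : TwoTensor I M} (hL : TwoTensor.pullback IP I τ L = K)
    (hK : ∀ (f : E → P) (v : E), ContMDiffAt 𝓘(ℝ, E) IP ∞ f v → ContDiffAt ℝ ∞ (K.flat f) v) :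
    TwoTensor.Smooth I L := by
  apply TwoTensor.smooth_of_flat
  intro x
  obtain ⟨p, rfl⟩ := h.surjective x
  obtain ⟨σ, hσ, hp, hτσ⟩ := h.exists_smooth_section p
  obtain ⟨h1, h2⟩ := eventually_section_comp hσ hτσ
  refine (hK _ _ h1).congr_of_eventuallyEq ?_
  filter_upwards [h2] with e ⟨he, he'⟩
  rw [L.flat_congr he', ← hL]
  exact (L.flat_pullback (h.mdifferentiable _) he).symm

theorem IsPrincipalBundle.oneForm_smooth_of_pullback (h : IsPrincipalBundle IP I τ)
    {K : OneForm IP P} {L : OneForm I M} (hL : OneForm.pullback IP I τ L = K)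
    (hK : ∀ (f : E → P) (v : E), ContMDiffAt 𝓘(ℝ, E) IP ∞ f v → ContDiffAt ℝ ∞ (K.flat f) v) :
    OneForm.SmoothOn I L univ := by
  refine fun x _ ↦ (OneForm.contMDiffAt_of_flat ?_).contMDiffWithinAt
  obtain ⟨p, rfl⟩ := h.surjective x
  obtain ⟨σ, hσ, hp, hτσ⟩ := h.exists_smooth_section p
  obtain ⟨h1, h2⟩ := eventually_section_comp hσ hτσ
  refine (hK _ _ h1).congr_of_eventuallyEq ?_
  filter_upwards [h2] with e ⟨he, he'⟩
  rw [L.flat_congr he', ← hL]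
  exact (L.flat_pullback (h.mdifferentiable _) he).symm

omit [IsManifold I ∞ M] [I.Boundaryless] [IsManifold IP ∞ P] in
theorem IsPrincipalBundle.exists_section_at (h : IsPrincipalBundle IP I τ) (x : M) :
    ∃ σ : M → P, τ (σ x) = x ∧
      ∀ v : E, (mfderiv IP I τ (σ x) (mfderiv I IP σ x v) : E) = v := by
  obtain ⟨p, rfl⟩ := h.surjective x
  obtain ⟨σ, hσ, hp, hτσ⟩ := h.exists_smooth_section p
  exact ⟨σ, hτσ.self_of_nhds, fun v ↦ h.mfderiv_proj_section hσ rfl hτσ v⟩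

omit [IsManifold I ∞ M] [I.Boundaryless] [IsManifold IP ∞ P] in
/-- Basic 2-tensors descend to the base. -/
theorem IsPrincipalBundle.exists_twoTensor_descent (h : IsPrincipalBundle IP I τ)
    {K : TwoTensor IP P} (hK : K.IsInvariant) (h1 : ∀ p (w : EP), K p (liouville IP p) w = 0)
    (h2 : ∀ p (w : EP), K p w (liouville IP p) = 0) :
    ∃ L : TwoTensor I M, TwoTensor.pullback IP I τ L = K := by
  choose σ hσ hσ' using h.exists_section_at
  refine ⟨fun x ↦ TwoTensor.pullback I IP (σ x) K x, ?_⟩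
  funext p
  ext v w
  exact hK.eq_of_proj_eq h h1 h2 (hσ (τ p)).symm (hσ' (τ p) _) (hσ' (τ p) _)

omit [IsManifold I ∞ M] [I.Boundaryless] [IsManifold IP ∞ P] in
/-- Basic 1-forms descend to the base. -/
theorem IsPrincipalBundle.exists_oneForm_descent (h : IsPrincipalBundle IP I τ)
    {K : OneForm IP P} (hK : K.IsInvariant) (h1 : ∀ p, K p (liouville IP p) = 0) :
    ∃ L : OneForm I M, OneForm.pullback IP I τ L = K := by
  choose σ hσ hσ' using h.exists_section_at
  refine ⟨fun x ↦ OneForm.pullback I IP (σ x) K x, ?_⟩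
  funext p
  ext v
  exact hK.eq_of_proj_eq h h1 (hσ (τ p)).symm (hσ' (τ p) _)

end Basic

section Flow

variable {EP : Type*} [NormedAddCommGroup EP] [NormedSpace ℝ EP]
  {HP : Type*} [TopologicalSpace HP] {IP : ModelWithCorners ℝ EP HP}
  {P : Type*} [TopologicalSpace P] [ChartedSpace HP P] [MulAction ℝˣ P]
  {E : Type*} [NormedAddCommGroup E] [NormedSpace ℝ E]
  {H : Type*} [TopologicalSpace H] {I : ModelWithCorners ℝ E H}
  {M : Type*} [TopologicalSpace M] [ChartedSpace H M] {τ : P → M}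
  {V : Type*} [NormedAddCommGroup V] [NormedSpace ℝ V] {f : V → P} {v : V}

/-- The map `f`, moved by the flow of the Liouville vector field. -/
def flow (f : V → P) (q : V × ℝ) : P := expUnit q.2 • f q.1

theorem IsPrincipalBundle.contMDiffAt_flow (h : IsPrincipalBundle IP I τ)
    (hf : ContMDiffAt 𝓘(ℝ, V) IP ∞ f v) (t : ℝ) :
    ContMDiffAt 𝓘(ℝ, V × ℝ) IP ∞ (flow f) (v, t) := by
  have h1 : ContMDiffAt 𝓘(ℝ, V × ℝ) 𝓘(ℝ, ℝ) ∞ (fun q : V × ℝ ↦ expUnit q.2) (v, t) :=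
    contMDiff_expUnit.contMDiffAt.comp _ contDiff_snd.contMDiff.contMDiffAt
  have h2 : ContMDiffAt 𝓘(ℝ, V × ℝ) IP ∞ (fun q : V × ℝ ↦ f q.1) (v, t) :=
    ContMDiffAt.comp (v, t) (g := f) (f := Prod.fst) hf contDiff_fst.contMDiff.contMDiffAt
  exact h.contMDiff_smul.contMDiffAt.comp (v, t) (h1.prodMk h2)

theorem IsPrincipalBundle.mdifferentiableAt_flow (h : IsPrincipalBundle IP I τ)
    (hf : MDifferentiableAt 𝓘(ℝ, V) IP f v) (t : ℝ) :
    MDifferentiableAt 𝓘(ℝ, V × ℝ) IP (flow f) (v, t) := by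
  have h1 : MDifferentiableAt 𝓘(ℝ, V × ℝ) 𝓘(ℝ, ℝ) (fun q : V × ℝ ↦ expUnit q.2) (v, t) :=
    (contMDiff_expUnit.mdifferentiableAt (by simp)).comp (v, t)
      differentiableAt_snd.mdifferentiableAt
  have h2 : MDifferentiableAt 𝓘(ℝ, V × ℝ) IP (fun q : V × ℝ ↦ f q.1) (v, t) :=
    MDifferentiableAt.comp (v, t) (g := f) (f := Prod.fst) hf
      differentiableAt_fst.mdifferentiableAt
  exact (h.contMDiff_smul.mdifferentiableAt (by simp)).comp (v, t) (h1.prodMk h2)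

theorem IsPrincipalBundle.mfderiv_flow_snd (h : IsPrincipalBundle IP I τ)
    (hf : MDifferentiableAt 𝓘(ℝ, V) IP f v) :
    (mfderiv 𝓘(ℝ, V × ℝ) IP (flow f) (v, 0) ((0, 1) : V × ℝ) : EP) = liouville IP (f v) := by
  have h0 : HasFDerivAt (fun t : ℝ ↦ (v, t)) (ContinuousLinearMap.inr ℝ V ℝ) 0 :=
    hasFDerivAt_prodMk_right v 0
  have h1 := mfderiv_comp_apply (I := 𝓘(ℝ, ℝ)) (0 : ℝ) (f := fun t : ℝ ↦ (v, t))
    (h.mdifferentiableAt_flow hf 0) h0.differentiableAt.mdifferentiableAt (1 : ℝ)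
  rw [mfderiv_eq_fderiv, h0.fderiv] at h1
  exact h1.symm.trans (h.mfderiv_expUnit_smul (f v))

theorem IsPrincipalBundle.mfderiv_flow_fst (h : IsPrincipalBundle IP I τ)
    (hf : MDifferentiableAt 𝓘(ℝ, V) IP f v) (t : ℝ) (a : V) :
    (mfderiv 𝓘(ℝ, V × ℝ) IP (flow f) (v, t) ((a, 0) : V × ℝ) : EP) =
      mfderiv IP IP (fun q : P ↦ expUnit t • q) (f v) (mfderiv 𝓘(ℝ, V) IP f v a) := by
  have h0 : HasFDerivAt (fun v : V ↦ (v, t)) (ContinuousLinearMap.inl ℝ V ℝ) v :=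
    hasFDerivAt_prodMk_left v t
  have h1 := mfderiv_comp_apply (I := 𝓘(ℝ, V)) v (f := fun v : V ↦ (v, t))
    (h.mdifferentiableAt_flow hf t) h0.differentiableAt.mdifferentiableAt a
  rw [mfderiv_eq_fderiv, h0.fderiv] at h1
  have h2 := mfderiv_comp_apply v (h.mdifferentiable_const_smul (expUnit t) (f v)) hf a
  exact h1.symm.trans h2

theorem IsPrincipalBundle.mfderiv_flow_fst_zero (h : IsPrincipalBundle IP I τ)
    (hf : MDifferentiableAt 𝓘(ℝ, V) IP f v) (a : V) :
    (mfderiv 𝓘(ℝ, V × ℝ) IP (flow f) (v, 0) ((a, 0) : V × ℝ) : EP) =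
      mfderiv 𝓘(ℝ, V) IP f v a := by
  refine (h.mfderiv_flow_fst hf 0 a).trans ?_
  have : (fun q : P ↦ expUnit 0 • q) = id := by
    ext q; rw [expUnit_zero, one_smul]; rfl
  rw [this, mfderiv_id]
  rfl

omit [MulAction ℝˣ P] in
theorem TwoTensor.congr_all (K : TwoTensor IP P) {p q : P} (h : p = q) {v v' w w' : EP}
    (hv : v = v') (hw : w = w') : K p v w = K q v' w' := by
  subst h hv hw; rfl

omit [TopologicalSpace P] [NormedAddCommGroup V] [NormedSpace ℝ V] in
theorem flow_zero (v : V) : flow f (v, 0) = f v := by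
  simp [flow, expUnit_zero]

theorem IsPrincipalBundle.flat_flow_snd_fst (h : IsPrincipalBundle IP I τ) (K : TwoTensor IP P)
    (hf : MDifferentiableAt 𝓘(ℝ, V) IP f v) (a : V) :
    K.flat (flow f) (v, 0) (0, 1) (a, 0) = (liouvilleForm IP K).flat f v a :=
  K.congr_all (flow_zero v) (h.mfderiv_flow_snd hf) (h.mfderiv_flow_fst_zero hf a)

theorem IsPrincipalBundle.flat_flow_snd_snd (h : IsPrincipalBundle IP I τ) (K : TwoTensor IP P)
    (hf : MDifferentiableAt 𝓘(ℝ, V) IP f v) :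
    K.flat (flow f) (v, 0) (0, 1) (0, 1) = K (f v) (liouville IP (f v)) (liouville IP (f v)) :=
  K.congr_all (flow_zero v) (h.mfderiv_flow_snd hf) (h.mfderiv_flow_snd hf)

theorem IsPrincipalBundle.flat_flow_fst_fst (h : IsPrincipalBundle IP I τ) {K : TwoTensor IP P}
    (hK : TwoTensor.IsHomogeneous IP K) (hf : MDifferentiableAt 𝓘(ℝ, V) IP f v) (t : ℝ) (a b : V) :
    K.flat (flow f) (v, t) (a, 0) (b, 0) = Real.exp t * K.flat f v a b := by
  refine (K.congr_all rfl (h.mfderiv_flow_fst hf t a) (h.mfderiv_flow_fst hf t b)).trans ?_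
  exact DFunLike.congr_fun (DFunLike.congr_fun (hK (expUnit t) (f v))
    (mfderiv 𝓘(ℝ, V) IP f v a)) (mfderiv 𝓘(ℝ, V) IP f v b)

variable [IsManifold IP ∞ P] [FiniteDimensional ℝ V]

theorem IsPrincipalBundle.contDiffAt_liouvilleForm_flat (h : IsPrincipalBundle IP I τ)
    {K : TwoTensor IP P} (hK : TwoTensor.Smooth IP K) (hf : ContMDiffAt 𝓘(ℝ, V) IP ∞ f v) :
    ContDiffAt ℝ ∞ ((liouvilleForm IP K).flat f) v := by
  refine contDiffAt_clm_of_apply fun a ↦ ?_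
  have h1 := (hK.contDiffAt_flat (h.contMDiffAt_flow hf 0)).comp v
    (contDiffAt_id.prodMk contDiffAt_const)
  have h2 := (h1.clm_apply (contDiffAt_const (c := ((0 : V), (1 : ℝ))))).clm_apply
    (contDiffAt_const (c := (a, (0 : ℝ))))
  refine h2.congr_of_eventuallyEq ?_
  filter_upwards [eventually_mdifferentiableAt hf] with u hu
  exact (h.flat_flow_snd_fst K hu a).symm

theorem IsPrincipalBundle.contDiffAt_liouville_liouville (h : IsPrincipalBundle IP I τ)
    {K : TwoTensor IP P} (hK : TwoTensor.Smooth IP K) (hf : ContMDiffAt 𝓘(ℝ, V) IP ∞ f v) :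
    ContDiffAt ℝ ∞ (fun v ↦ K (f v) (liouville IP (f v)) (liouville IP (f v))) v := by
  have h1 := (hK.contDiffAt_flat (h.contMDiffAt_flow hf 0)).comp v
    (contDiffAt_id.prodMk contDiffAt_const)
  have h2 := (h1.clm_apply (contDiffAt_const (c := ((0 : V), (1 : ℝ))))).clm_apply
    (contDiffAt_const (c := ((0 : V), (1 : ℝ))))
  refine h2.congr_of_eventuallyEq ?_
  filter_upwards [eventually_mdifferentiableAt hf] with u hu
  exact (h.flat_flow_snd_snd K hu).symm

/-- A homogeneous symplectic form is the differential of its Liouville form. -/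
theorem IsPrincipalBundle.fderiv_liouvilleForm_flat [FiniteDimensional ℝ EP] [IP.Boundaryless]
    (h : IsPrincipalBundle IP I τ)
    {Ω : TwoTensor IP P} (hΩ : IsSymplecticForm IP Ω) (hh : TwoTensor.IsHomogeneous IP Ω)
    (hf : ContMDiffAt 𝓘(ℝ, V) IP ∞ f v) (a b : V) :
    fderiv ℝ ((liouvilleForm IP Ω).flat f) v a b - fderiv ℝ ((liouvilleForm IP Ω).flat f) v b a =
      Ω.flat f v a b := by
  have hfl := h.contMDiffAt_flow hf 0
  have hB := (hΩ.smooth.contDiffAt_flat hfl).differentiableAt (by simp)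
  have hc := hΩ.closed.extDerivTwo_flat hΩ.smooth hΩ.alternating hfl (0, 1) (a, 0) (b, 0)
  have hθ := (h.contDiffAt_liouvilleForm_flat hΩ.smooth hf).differentiableAt (by simp)
  have hin : HasFDerivAt (fun v : V ↦ (v, (0 : ℝ))) (ContinuousLinearMap.inl ℝ V ℝ) v :=
    hasFDerivAt_prodMk_left v 0
  have hir : HasFDerivAt (fun t : ℝ ↦ (v, t)) (ContinuousLinearMap.inr ℝ V ℝ) 0 :=
    hasFDerivAt_prodMk_right v 0
  have hd := hf.mdifferentiableAt (by simp)
  have e1 : fderiv ℝ (Ω.flat (flow f)) (v, 0) (0, 1) (a, 0) (b, 0) = Ω.flat f v a b := by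
    have k1 := fderiv_bilin_const_apply hB (0, 1) (a, 0) (b, 0)
    have k2 : HasFDerivAt (fun q ↦ Ω.flat (flow f) q (a, 0) (b, 0)) _ (v, (0 : ℝ)) :=
      ((hB.hasFDerivAt.clm_apply (hasFDerivAt_const _ _)).clm_apply
        (hasFDerivAt_const _ _)).differentiableAt.hasFDerivAt
    have k3 := (k2.comp (0 : ℝ) hir).fderiv
    have k4 : (fun q ↦ Ω.flat (flow f) q (a, 0) (b, 0)) ∘ (fun t : ℝ ↦ (v, t)) =
        fun t ↦ Real.exp t * Ω.flat f v a b := by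
      ext t; exact h.flat_flow_fst_fst hh hd t a b
    have k5 : HasDerivAt (fun t ↦ Real.exp t * Ω.flat f v a b) (Ω.flat f v a b) 0 := by
      simpa using (Real.hasDerivAt_exp 0).mul_const (Ω.flat f v a b)
    rw [k4, k5.hasFDerivAt.fderiv] at k3
    have k6 := DFunLike.congr_fun k3 (1 : ℝ)
    simp at k6
    rw [← k1, k6]
  have e2 : ∀ a b : V, fderiv ℝ (Ω.flat (flow f)) (v, 0) (a, 0) (0, 1) (b, 0) =
      fderiv ℝ ((liouvilleForm IP Ω).flat f) v a b := by
    intro a b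
    have k1 := fderiv_bilin_const_apply hB (a, 0) (0, 1) (b, 0)
    have k2 : HasFDerivAt (fun q ↦ Ω.flat (flow f) q (0, 1) (b, 0)) _ (v, (0 : ℝ)) :=
      ((hB.hasFDerivAt.clm_apply (hasFDerivAt_const _ _)).clm_apply
        (hasFDerivAt_const _ _)).differentiableAt.hasFDerivAt
    have k3 := (k2.comp v hin).fderiv
    have k4 : (fun q ↦ Ω.flat (flow f) q (0, 1) (b, 0)) ∘ (fun v : V ↦ (v, (0 : ℝ))) =ᶠ[𝓝 v]
        fun v ↦ (liouvilleForm IP Ω).flat f v b := by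
      filter_upwards [eventually_mdifferentiableAt hf] with u hu
      exact h.flat_flow_snd_fst Ω hu b
    have k5 := hθ.hasFDerivAt.clm_apply (hasFDerivAt_const b v)
    rw [k4.fderiv_eq, k5.fderiv] at k3
    have k6 := DFunLike.congr_fun k3 a
    simp at k6
    rw [← k1, k6]
  rw [extDerivTwo, e1, e2, e2] at hc
  linarith

end Flow

section Contact

theorem bilin_apply_eq_zero_of_sub {W : Type*} [NormedAddCommGroup W] [NormedSpace ℝ W]
    {B : W →L[ℝ] W →L[ℝ] ℝ} {X A u w : W} {d : ℝ} (hB : ∀ a b, B a b = -B b a) (hA : B X A = 0)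
    (hX : B X X = 0) (hw : w - u = d • X) (h0 : B X w = 0) (h1 : B X u = 0 → B A u = 0) :
    B A w = 0 := by
  obtain rfl : w = u + d • X := by rw [← hw]; abel
  have h3 : B A X = 0 := by rw [hB, hA, neg_zero]
  have h4 : B X u = 0 := by simpa [hX] using h0
  simp [h1 h4, h3]

theorem exists_eq_smul_of_ker_le {W : Type*} [NormedAddCommGroup W] [NormedSpace ℝ W]
    {B : W →L[ℝ] W →L[ℝ] ℝ} (hB : ∀ v, (∀ w, B v w = 0) → v = 0) {X A : W}
    (h : ∀ w, B X w = 0 → B A w = 0) : ∃ c : ℝ, A = c • X := by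
  by_cases hX : ∀ w, B X w = 0
  · exact ⟨0, by rw [zero_smul]; exact hB A fun w ↦ h w (hX w)⟩
  · push Not at hX
    obtain ⟨r, hr⟩ := hX
    refine ⟨B A r / B X r, sub_eq_zero.1 (hB _ fun w ↦ ?_)⟩
    have h1 := h (w - (B X w / B X r) • r) (by simp; field_simp; ring)
    simp at h1 ⊢
    field_simp at h1 ⊢
    linarith

variable {EP : Type*} [NormedAddCommGroup EP] [NormedSpace ℝ EP]
  {HP : Type*} [TopologicalSpace HP] {IP : ModelWithCorners ℝ EP HP}
  {P : Type*} [TopologicalSpace P] [ChartedSpace HP P] [MulAction ℝˣ P]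
  {E : Type*} [NormedAddCommGroup E] [NormedSpace ℝ E]
  {H : Type*} [TopologicalSpace H] {I : ModelWithCorners ℝ E H}
  {M : Type*} [TopologicalSpace M] [ChartedSpace H M] {τ : P → M}
  {Ω : TwoTensor IP P}

theorem IsPrincipalBundle.liouvilleForm_smul (h : IsPrincipalBundle IP I τ)
    (hh : TwoTensor.IsHomogeneous IP Ω) (s : ℝˣ) (p : P) (w : EP) :
    liouvilleForm IP Ω (s • p) (mfderiv IP IP (fun q : P ↦ s • q) p w) =
      s * liouvilleForm IP Ω p w := by
  have h1 := DFunLike.congr_fun (DFunLike.congr_fun (hh s p) (liouville IP p)) w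
  exact (Ω.congr_all rfl (h.mfderiv_smul_liouville s p).symm rfl).trans h1

theorem IsPrincipalBundle.liouvilleForm_eq_zero_of_proj_eq (h : IsPrincipalBundle IP I τ)
    (hh : TwoTensor.IsHomogeneous IP Ω) (hθ : ∀ p, liouvilleForm IP Ω p (liouville IP p) = 0)
    {p q : P} (hpq : τ p = τ q) {v v' : EP}
    (hv : (mfderiv IP I τ q v' : E) = mfderiv IP I τ p v) (h0 : liouvilleForm IP Ω p v = 0) :
    liouvilleForm IP Ω q v' = 0 := by
  obtain ⟨s, rfl⟩ := h.exists_smul_eq hpq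
  obtain ⟨c, rfl⟩ := h.exists_eq_add_liouville hv
  have key : ∀ (B : EP →L[ℝ] ℝ) (X : EP), B X = 0 → ∀ a : EP, B (a + c • X) = B a := by
    intro B X hB a
    simp [hB]
  refine (key (liouvilleForm IP Ω (s • p)) (liouville IP (s • p)) (hθ _) _).trans ?_
  refine (h.liouvilleForm_smul hh s p v).trans ?_
  exact (congrArg _ h0).trans (mul_zero _)

/-- The projection of the kernel of the Liouville form. -/
theorem IsPrincipalBundle.exists_contactDistribution (h : IsPrincipalBundle IP I τ)
    (hh : TwoTensor.IsHomogeneous IP Ω) (hθ : ∀ p, liouvilleForm IP Ω p (liouville IP p) = 0) :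
    ∃ C : Distribution I M, ∀ p : P, C (τ p) =
      (LinearMap.ker (liouvilleForm IP Ω p).toLinearMap).map (mfderiv IP I τ p).toLinearMap := by
  choose σ hσ using h.surjective
  refine ⟨fun x ↦ (LinearMap.ker (liouvilleForm IP Ω (σ x)).toLinearMap).map
    (mfderiv IP I τ (σ x)).toLinearMap, fun p ↦ ?_⟩
  ext v
  constructor
  · rintro ⟨w, hw, rfl⟩
    obtain ⟨w', hw'⟩ := h.mfderiv_surjective p (mfderiv IP I τ (σ (τ p)) w)
    exact ⟨w', h.liouvilleForm_eq_zero_of_proj_eq hh hθ (hσ _) hw' hw, hw'⟩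
  · rintro ⟨w, hw, rfl⟩
    obtain ⟨w', hw'⟩ := h.mfderiv_surjective (σ (τ p)) (mfderiv IP I τ p w)
    exact ⟨w', h.liouvilleForm_eq_zero_of_proj_eq hh hθ (hσ _).symm hw' hw, hw'⟩

theorem IsPrincipalBundle.mem_contactDistribution (h : IsPrincipalBundle IP I τ)
    (hh : TwoTensor.IsHomogeneous IP Ω) (hθ : ∀ p, liouvilleForm IP Ω p (liouville IP p) = 0)
    {C : Distribution I M} (hC : ∀ p : P, C (τ p) =
      (LinearMap.ker (liouvilleForm IP Ω p).toLinearMap).map (mfderiv IP I τ p).toLinearMap)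
    {p : P} {x : M} (hx : τ p = x) {w : EP} {v : TangentSpace I x}
    (hv : (mfderiv IP I τ p w : E) = v) : v ∈ C x ↔ liouvilleForm IP Ω p w = 0 := by
  subst hx
  rw [hC]
  constructor
  · rintro ⟨w', hw', hv'⟩
    exact h.liouvilleForm_eq_zero_of_proj_eq hh hθ rfl (hv.trans hv'.symm) hw'
  · exact fun hw ↦ ⟨w, hw, hv⟩

variable [IsManifold IP ∞ P] [IsManifold I ∞ M] [I.Boundaryless] [FiniteDimensional ℝ E]

theorem IsPrincipalBundle.isHyperplaneDistribution (h : IsPrincipalBundle IP I τ)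
    (hΩ : IsSymplecticForm IP Ω)
    (hh : TwoTensor.IsHomogeneous IP Ω) {C : Distribution I M} (hC : ∀ p : P, C (τ p) =
      (LinearMap.ker (liouvilleForm IP Ω p).toLinearMap).map (mfderiv IP I τ p).toLinearMap) :
    IsHyperplaneDistribution I C := by
  have hθ : ∀ p, liouvilleForm IP Ω p (liouville IP p) = 0 := fun p ↦ hΩ.alternating p _
  intro x
  obtain ⟨p, rfl⟩ := h.surjective x
  obtain ⟨B, σ, a, hB, hx, -, hσ, hτσ, -⟩ := h.exists_section p
  refine ⟨B, hB, hx, OneForm.pullback I IP σ (liouvilleForm IP Ω), ?_, ?_⟩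
  · intro y hy
    refine (OneForm.contMDiffAt_of_flat ?_).contMDiffWithinAt
    have h1 := hσ.contMDiffAt (hB.mem_nhds hy)
    have h2 : ∀ᶠ z in 𝓝 y, τ (σ z) = z := Filter.eventually_of_mem (hB.mem_nhds hy) hτσ
    obtain ⟨h3, -⟩ := eventually_section_comp h1 h2
    refine (h.contDiffAt_liouvilleForm_flat hΩ.smooth h3).congr_of_eventuallyEq ?_
    have hc := contMDiffAt_extChartAt_symm (I := I) y
    have h0 : (extChartAt I y).symm (extChartAt I y y) = y := extChartAt_to_inv y
    have h4 : ∀ᶠ e in 𝓝 (extChartAt I y y), (extChartAt I y).symm e ∈ B :=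
      hc.continuousAt.eventually (hB.mem_nhds (by rwa [h0]))
    filter_upwards [h4, eventually_mdifferentiableAt hc] with e he he'
    exact OneForm.flat_pullback _
      ((hσ.contMDiffAt (hB.mem_nhds he)).mdifferentiableAt (by simp)) he'
  · intro y hy
    have hσy := hσ.contMDiffAt (hB.mem_nhds hy)
    have hτ' : ∀ᶠ z in 𝓝 y, τ (σ z) = z := Filter.eventually_of_mem (hB.mem_nhds hy) hτσ
    have hm : ∀ v : TangentSpace I y, v ∈ C y ↔
        liouvilleForm IP Ω (σ y) (mfderiv I IP σ y v) = 0 := fun v ↦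
      h.mem_contactDistribution hh hθ hC (hτσ y hy)
        (h.mfderiv_proj_section hσy rfl hτ' v)
    refine ⟨fun h0 ↦ ?_, by ext v; exact hm v⟩
    refine h.liouville_ne_zero (σ y) (hΩ.nondegenerate _ _ fun w ↦ ?_)
    have h1 := (hm (mfderiv IP I τ (σ y) w : E)).2 (DFunLike.congr_fun h0 _)
    exact (h.mem_contactDistribution hh hθ hC (hτσ y hy) rfl).1 h1

theorem fderiv_clm_apply_of_eventually_zero {V : Type*} [NormedAddCommGroup V] [NormedSpace ℝ V]
    {η : V → V →L[ℝ] ℝ} {Y : V → V} {v₀ : V} (hη : DifferentiableAt ℝ η v₀)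
    (hY : DifferentiableAt ℝ Y v₀) (h : ∀ᶠ v in 𝓝 v₀, η v (Y v) = 0) (u : V) :
    η v₀ (fderiv ℝ Y v₀ u) = - fderiv ℝ η v₀ u (Y v₀) := by
  have h1 := (hη.hasFDerivAt.clm_apply hY.hasFDerivAt).fderiv
  have h2 : (fun v ↦ η v (Y v)) =ᶠ[𝓝 v₀] fun _ ↦ 0 := h
  rw [h2.fderiv_eq, fderiv_fun_const] at h1
  have h3 := DFunLike.congr_fun h1 u
  simp at h3
  linarith

/-- Near a point where the 1-form `η` does not vanish, vectors in its kernel extend to smooth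
fields in its kernel. -/
theorem exists_field_in_ker {V : Type*} [NormedAddCommGroup V] [NormedSpace ℝ V]
    {η : V → V →L[ℝ] ℝ} {v₀ : V} (hη : ContDiffAt ℝ ∞ η v₀) {r : V} (hr : η v₀ r ≠ 0) {a : V}
    (ha : η v₀ a = 0) : ∃ X : V → V, ContDiffAt ℝ ∞ X v₀ ∧ X v₀ = a ∧
      ∀ᶠ v in 𝓝 v₀, η v (X v) = 0 := by
  have hr' : ContDiffAt ℝ ∞ (fun v ↦ η v r) v₀ := hη.clm_apply contDiffAt_const
  have ha' : ContDiffAt ℝ ∞ (fun v ↦ η v a) v₀ := hη.clm_apply contDiffAt_const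
  refine ⟨fun v ↦ a - (η v a / η v r) • r,
    contDiffAt_const.sub ((ha'.div hr' hr).smul contDiffAt_const), by simp [ha], ?_⟩
  filter_upwards [hr'.continuousAt.eventually_ne hr] with v hv
  simp
  field_simp
  ring

variable [FiniteDimensional ℝ EP] [IP.Boundaryless]

/-- The base of a homogeneous symplectic principal bundle is a contact manifold. -/
theorem IsPrincipalBundle.isContactDistribution (h : IsPrincipalBundle IP I τ)
    (hΩ : IsSymplecticForm IP Ω)
    (hh : TwoTensor.IsHomogeneous IP Ω) {C : Distribution I M} (hC : ∀ p : P, C (τ p) =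
      (LinearMap.ker (liouvilleForm IP Ω p).toLinearMap).map (mfderiv IP I τ p).toLinearMap) :
    IsContactDistribution I C := by
  have hθ : ∀ p, liouvilleForm IP Ω p (liouville IP p) = 0 := fun p ↦ hΩ.alternating p _
  refine ⟨h.isHyperplaneDistribution hΩ hh hC, fun x v hv hXY ↦ ?_⟩
  obtain ⟨p, rfl⟩ := h.surjective x
  obtain ⟨σ, hσ, hp, hτσ⟩ := h.exists_smooth_section p
  obtain ⟨hf, hev⟩ := eventually_section_comp hσ hτσ
  set f := σ ∘ (extChartAt I (τ p)).symm with hfdef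
  set e₀ := extChartAt I (τ p) (τ p) with he₀
  have h0 : (extChartAt I (τ p)).symm e₀ = τ p := extChartAt_to_inv _
  have hfp : f e₀ = p := (congrArg σ h0).trans hp
  set η := (liouvilleForm IP Ω).flat f with hηdef
  have hη : ContDiffAt ℝ ∞ η e₀ := h.contDiffAt_liouvilleForm_flat hΩ.smooth hf
  -- vectors in the chart and their lifts
  have hlift : ∀ e, MDifferentiableAt 𝓘(ℝ, E) IP f e →
      (extChartAt I (τ p)).symm =ᶠ[𝓝 e] τ ∘ f → ∀ a : E,
      (mfderiv IP I τ (f e) (mfderiv 𝓘(ℝ, E) IP f e a) : E) =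
        mfderiv 𝓘(ℝ, E) I (extChartAt I (τ p)).symm e a := by
    intro e he he' a
    have h1 := mfderiv_comp_apply e (h.mdifferentiable (f e)) he a
    rw [← he'.mfderiv_eq (I := 𝓘(ℝ, E)) (I' := I)] at h1
    exact h1.symm
  have hlift₀ : ∀ a : E, (mfderiv IP I τ (f e₀) (mfderiv 𝓘(ℝ, E) IP f e₀ a) : E) = a := by
    intro a
    have h1 := hev.self_of_nhds
    exact (hlift e₀ h1.1 h1.2 a).trans (mfderiv_extChartAt_symm_self (τ p) a)
  have hmem : ∀ a : TangentSpace I (τ p), a ∈ C (τ p) ↔ η e₀ a = 0 := fun a ↦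
    h.mem_contactDistribution hh hθ hC (congrArg τ hfp) (hlift₀ a)
  have hfield : ∀ X : E → E, (∀ᶠ e in 𝓝 e₀, η e (X e) = 0) →
      ∀ᶠ y in 𝓝 (τ p), VField.ofChart I (τ p) X y ∈ C y := by
    intro X hX
    filter_upwards [(continuousAt_extChartAt (I := I) (τ p)).eventually (hX.and hev),
      eventually_extChartAt_symm (I := I) (τ p)] with y hy hy'
    refine (h.mem_contactDistribution hh hθ hC (x := y) (v := VField.ofChart I (τ p) X y) ?_
      (hlift _ hy.2.1 hy.2.2 _)).2 hy.1
    exact hy.2.2.self_of_nhds.symm.trans hy'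
  have hr : ∃ r : E, η e₀ r ≠ 0 := by
    by_contra! hr
    refine h.liouville_ne_zero p (hΩ.nondegenerate _ _ fun w ↦ ?_)
    have h1 := (hmem (mfderiv IP I τ p w : E)).2 (hr _)
    exact (h.mem_contactDistribution hh hθ hC rfl rfl).1 h1
  obtain ⟨r, hr⟩ := hr
  have hv0 : η e₀ v = 0 := (hmem v).1 hv
  obtain ⟨X, hX, hXv, hXη⟩ := exists_field_in_ker hη hr hv0
  have hΩ0 : ∀ c : E, η e₀ c = 0 → Ω.flat f e₀ v c = 0 := by
    intro c hc
    obtain ⟨Y, hY, hYc, hYη⟩ := exists_field_in_ker hη hr hc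
    have hb := (hmem _).1 (hXY _ _ (VField.ofChart_smoothAt hX) (VField.ofChart_smoothAt hY)
      (hfield X hXη) (hfield Y hYη) ((VField.ofChart_self (τ p) X).trans hXv))
    have hb' : η e₀ (fderiv ℝ Y e₀ (X e₀) - fderiv ℝ X e₀ (Y e₀) : E) = 0 :=
      (congrArg (η e₀) (mlieBracket_ofChart X Y)).symm.trans hb
    have hη1 := hη.differentiableAt (by simp)
    have k1 := fderiv_clm_apply_of_eventually_zero hη1 (hX.differentiableAt (by simp)) hXη (Y e₀)
    have k2 := fderiv_clm_apply_of_eventually_zero hη1 (hY.differentiableAt (by simp)) hYη (X e₀)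
    have k3 := h.fderiv_liouvilleForm_flat hΩ hh hf (X e₀) (Y e₀)
    rw [map_sub, k1, k2] at hb'
    rw [hXv, hYc] at k3 hb'
    exact k3.symm.trans (by linarith)
  have hlin : ∃ c : ℝ, (mfderiv 𝓘(ℝ, E) IP f e₀ v : EP) = c • (liouville IP (f e₀) : EP) := by
    suffices hker : ∀ w : EP, Ω (f e₀) (liouville IP (f e₀)) w = 0 →
        Ω (f e₀) (mfderiv 𝓘(ℝ, E) IP f e₀ v) w = 0 from
      exists_eq_smul_of_ker_le (W := EP) (B := Ω (f e₀)) (hΩ.nondegenerate (f e₀)) hker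
    intro w hw
    let A : EP := mfderiv 𝓘(ℝ, E) IP f e₀ v
    let u : EP := mfderiv 𝓘(ℝ, E) IP f e₀ (mfderiv IP I τ (f e₀) w : E)
    have h1 : (mfderiv IP I τ (f e₀) (w - u : EP) : E) = 0 :=
      ((mfderiv IP I τ (f e₀)).map_sub w u).trans (sub_eq_zero.2 (hlift₀ _).symm)
    obtain ⟨d, hd⟩ := h.exists_smul_liouville h1
    exact bilin_apply_eq_zero_of_sub (W := EP) (B := Ω (f e₀)) (X := liouville IP (f e₀)) (A := A) (u := u)
      (fun a b ↦ TwoTensor.skew_of_alternating hΩ.alternating (f e₀) a b) hv0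
      (hΩ.alternating _ _) hd hw fun hu ↦ hΩ0 _ hu
  obtain ⟨c, hc⟩ := hlin
  have h2 := hlift₀ v
  have h3 : (mfderiv IP I τ (f e₀) (mfderiv 𝓘(ℝ, E) IP f e₀ v) : E) = 0 := by
    refine (congrArg (mfderiv IP I τ (f e₀)) hc).trans ?_
    refine ((mfderiv IP I τ (f e₀)).map_smul c _).trans ?_
    exact (congrArg (c • ·) (h.mfderiv_proj_liouville (f e₀))).trans (smul_zero c)
  exact h2.symm.trans h3

end Contact

section Conical

variable {EP : Type*} [NormedAddCommGroup EP] [NormedSpace ℝ EP]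
  {HP : Type*} [TopologicalSpace HP] {IP : ModelWithCorners ℝ EP HP}
  {P : Type*} [TopologicalSpace P] [ChartedSpace HP P] [MulAction ℝˣ P]
  {E : Type*} [NormedAddCommGroup E] [NormedSpace ℝ E]
  {H : Type*} [TopologicalSpace H] {I : ModelWithCorners ℝ E H}
  {M : Type*} [TopologicalSpace M] [ChartedSpace H M] {τ : P → M}
  {Ω g : TwoTensor IP P} {s : P → ℝ} {C : Distribution I M} {gM : TwoTensor I M}

/-- `g` is homogeneous, and the Liouville vector field is the `g`-gradient of the homogeneous
function `s = g(∇, ∇)`. -/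
structure IsConical (g : TwoTensor IP P) (s : P → ℝ) : Prop where
  pos : ∀ p, 0 < s p
  smooth : ContMDiff IP 𝓘(ℝ, ℝ) ∞ s
  self : ∀ p, g p (liouville IP p) (liouville IP p) = s p
  apply_liouville : ∀ (p : P) (w : EP), g p (liouville IP p) w = mvfderiv IP s p w
  smul : ∀ (t : ℝˣ) (p : P), s (t • p) = |(t : ℝ)| * s p
  metric : ∀ (t : ℝˣ) (p : P) (v w : EP), g (t • p) (mfderiv IP IP (fun q : P ↦ t • q) p v)
    (mfderiv IP IP (fun q : P ↦ t • q) p w) = |(t : ℝ)| * g p v w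

/-- The part of `g` transverse to the Liouville vector field, scaled to be invariant. -/
def transverse (g : TwoTensor IP P) (s : P → ℝ) : TwoTensor IP P := fun p ↦
  (s p)⁻¹ • g p - (s p ^ 2)⁻¹ • OneForm.sq IP (liouvilleForm IP g) p

theorem transverse_apply (g : TwoTensor IP P) (s : P → ℝ) (p : P) (v w : EP) :
    transverse g s p v w = (s p)⁻¹ * g p v w -
      (s p ^ 2)⁻¹ * (g p (liouville IP p) v * g p (liouville IP p) w) := rfl

theorem IsConical.transverse_liouville_left (hs : IsConical g s) (p : P) (w : EP) :
    transverse g s p (liouville IP p) w = 0 := by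
  have h1 := (hs.pos p).ne'
  refine (transverse_apply g s p (liouville IP p) w).trans ?_
  rw [hs.self]
  field_simp
  ring

theorem IsConical.transverse_liouville_right (hs : IsConical g s)
    (hg : ∀ p (v w : EP), g p v w = g p w v) (p : P) (w : EP) :
    transverse g s p w (liouville IP p) = 0 := by
  have h1 := (hs.pos p).ne'
  refine (transverse_apply g s p w (liouville IP p)).trans ?_
  rw [hs.self]
  have e1 := hg p w (liouville IP p)
  have e2 : (s p)⁻¹ = (s p ^ 2)⁻¹ * s p := by field_simp
  linear_combination (s p)⁻¹ * e1 + g p (liouville IP p) w * e2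

theorem IsConical.metric_liouville (hs : IsConical g s) (h : IsPrincipalBundle IP I τ) (t : ℝˣ)
    (p : P) (w : EP) :
    g (t • p) (liouville IP (t • p)) (mfderiv IP IP (fun q : P ↦ t • q) p w) =
      |(t : ℝ)| * g p (liouville IP p) w :=
  (g.congr_all rfl (h.mfderiv_smul_liouville t p).symm rfl).trans (hs.metric t p _ w)

theorem IsConical.transverse_isInvariant (hs : IsConical g s) (h : IsPrincipalBundle IP I τ) :
    (transverse g s).IsInvariant := by
  intro t p v w
  have h1 := (hs.pos p).ne'
  have h2 : |(t : ℝ)| ≠ 0 := abs_ne_zero.2 t.ne_zero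
  have h3 := transverse_apply g s (t • p) (mfderiv IP IP (fun q : P ↦ t • q) p v)
    (mfderiv IP IP (fun q : P ↦ t • q) p w)
  refine h3.trans ?_
  rw [hs.metric t p v w, hs.metric_liouville h, hs.metric_liouville h, hs.smul, transverse_apply]
  field_simp

theorem IsConical.transverse_pos (hs : IsConical g s) (h : IsPrincipalBundle IP I τ)
    (hg : ∀ p (v w : EP), g p v w = g p w v) (hpos : ∀ p (v : EP), v ≠ 0 → 0 < g p v v)
    {p : P} {w : EP} (hw : (mfderiv IP I τ p w : E) ≠ 0) : 0 < transverse g s p w w := by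
  have h1 := hs.pos p
  let X : EP := liouville IP p
  have hX : ∀ c : ℝ, (mfderiv IP I τ p (c • X) : E) = 0 := fun c ↦
    ((mfderiv IP I τ p).map_smul c X).trans
      ((congrArg (c • ·) (h.mfderiv_proj_liouville p)).trans (smul_zero c))
  have h3 := hpos p (w - (g p X w / s p) • X) fun h0 ↦
    hw ((congrArg (mfderiv IP I τ p) (sub_eq_zero.1 h0)).trans (hX _))
  have key : ∀ (G : EP →L[ℝ] EP →L[ℝ] ℝ) (X : EP), (∀ a b, G a b = G b a) → G X X = s p →
      G (w - (G X w / s p) • X) (w - (G X w / s p) • X) = G w w - G X w ^ 2 / s p := by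
    intro G X hG hX
    simp only [map_sub, map_smul, sub_apply, smul_apply, smul_eq_mul, hX, hG w X]
    field_simp
    ring
  have h4 := h3.trans_eq (key (g p) (liouville IP p) (hg p) (hs.self p))
  have h5 : transverse g s p w w =
      (s p)⁻¹ * (g p w w - g p (liouville IP p) w ^ 2 / s p) := by
    refine (transverse_apply g s p w w).trans ?_
    field_simp
  exact (mul_pos (inv_pos.2 h1) h4).trans_eq h5.symm

section Smooth

variable [IsManifold IP ∞ P] {V : Type*} [NormedAddCommGroup V] [NormedSpace ℝ V]
  [FiniteDimensional ℝ V]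

theorem IsConical.transverse_flat (hs : IsConical g s) (h : IsPrincipalBundle IP I τ)
    (hg : TwoTensor.Smooth IP g) {f : V → P} {v : V} (hf : ContMDiffAt 𝓘(ℝ, V) IP ∞ f v) :
    ContDiffAt ℝ ∞ ((transverse g s).flat f) v := by
  refine contDiffAt_clm_of_apply fun a ↦ contDiffAt_clm_of_apply fun b ↦ ?_
  have h1 : ContDiffAt ℝ ∞ (fun v ↦ s (f v)) v :=
    (hs.smooth.contMDiffAt.comp v hf).contDiffAt
  have h2 := hg.contDiffAt_flat hf
  have h3 := h.contDiffAt_liouvilleForm_flat hg hf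
  have h0 := (hs.pos (f v)).ne'
  have h2' : ContDiffAt ℝ ∞ (fun v ↦ g.flat f v a b) v :=
    (h2.clm_apply contDiffAt_const).clm_apply contDiffAt_const
  have h3' : ∀ a, ContDiffAt ℝ ∞ (fun v ↦ (liouvilleForm IP g).flat f v a) v := fun a ↦
    h3.clm_apply contDiffAt_const
  exact ((h1.inv h0).mul h2').sub (((h1.pow 2).inv (pow_ne_zero 2 h0)).mul
    ((h3' a).mul (h3' b)))

end Smooth

theorem pullback_eq_transverse_iff (hs : IsConical g s) (L : TwoTensor I M) :
    TwoTensor.pullback IP I τ L = transverse g s ↔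
      g = fun p ↦ (s p)⁻¹ • OneForm.sq IP (fun q ↦ mvfderiv IP s q) p +
        s p • TwoTensor.pullback IP I τ L p := by
  constructor
  · intro h1
    rw [h1]
    funext p
    ext v w
    have h2 := (hs.pos p).ne'
    refine Eq.trans (b := (s p)⁻¹ * (mvfderiv IP s p v * mvfderiv IP s p w) +
      s p * transverse g s p v w) ?_ rfl
    refine Eq.trans ?_ (congrArg (fun r ↦ (s p)⁻¹ * (mvfderiv IP s p v * mvfderiv IP s p w) +
      s p * r) (transverse_apply g s p v w).symm)
    rw [hs.apply_liouville p v, hs.apply_liouville p w]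
    field_simp
    ring
  · intro h1
    funext p
    ext v w
    have h2 := (hs.pos p).ne'
    refine Eq.trans ?_ (transverse_apply g s p v w).symm
    rw [hs.apply_liouville p v, hs.apply_liouville p w]
    have h3 : g p v w = (s p)⁻¹ * (mvfderiv IP s p v * mvfderiv IP s p w) +
      s p * TwoTensor.pullback IP I τ L p v w := DFunLike.congr_fun (DFunLike.congr_fun
        (congrFun h1 p) v) w
    rw [h3]
    field_simp
    ring

/-- The calibration induced by the transverse metric. -/
theorem IsConical.inducedCalibration_eq (hs : IsConical g s) (h : IsPrincipalBundle IP I τ)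
    (hΩ : ∀ p (v : EP), Ω p v v = 0) {J : EndField IP P} (hJ : IsCompatibleStructure IP Ω g J)
    (hg : ∀ p (v w : EP), g p v w = g p w v) (hpos : ∀ p (v : EP), v ≠ 0 → 0 < g p v v)
    (hC : ∀ p : P, C (τ p) =
      (LinearMap.ker (liouvilleForm IP Ω p).toLinearMap).map (mfderiv IP I τ p).toLinearMap)
    (hgM : TwoTensor.pullback IP I τ gM = transverse g s) :
    inducedCalibration IP I τ Ω C gM = s := by
  funext p
  have hs0 := hs.pos p
  have hgM' : ∀ v w : EP, gM (τ p) (mfderiv IP I τ p v) (mfderiv IP I τ p w) =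
      transverse g s p v w := fun v w ↦
    DFunLike.congr_fun (DFunLike.congr_fun (congrFun hgM p) v) w
  let X : EP := liouville IP p
  let T : EP := J p X
  have hsk : ∀ v w : EP, Ω p v w = -Ω p w v := fun v w ↦
    TwoTensor.skew_of_alternating hΩ p v w
  have hT : ∀ w : EP, g p T w = Ω p X w := by
    intro w
    refine (hg p T w).trans ((hJ.1 p w T).trans ?_)
    refine (congrArg (Ω p w) (hJ.2 p X)).trans (((Ω p w).map_neg X).trans ?_)
    exact (hsk X w).symm
  have hTX : g p X T = 0 := (hg p X T).trans ((hT X).trans (hΩ p X))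
  have hθT : Ω p X T = s p := (hJ.1 p X X).symm.trans (hs.self p)
  have hKT : ∀ w : EP, transverse g s p T w = (s p)⁻¹ * Ω p X w := by
    intro w
    refine (transverse_apply g s p T w).trans ?_
    rw [hT w]
    have : g p (liouville IP p) T = 0 := hTX
    rw [this]; ring
  have hKTT : transverse g s p T T = 1 := by
    rw [hKT, hθT, inv_mul_cancel₀ hs0.ne']
  have hKsymm : ∀ v w : EP, transverse g s p v w = transverse g s p w v := by
    intro v w
    rw [transverse_apply, transverse_apply, hg p v w]; ring
  have hset : {r : ℝ | ∃ w : TangentSpace IP p, mfderiv IP I τ p w ≠ 0 ∧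
    (∀ c ∈ C (τ p), gM (τ p) (mfderiv IP I τ p w) c = 0) ∧
    r = |liouvilleForm IP Ω p w| /
      Real.sqrt (gM (τ p) (mfderiv IP I τ p w) (mfderiv IP I τ p w))} = {s p} := by
    ext r
    constructor
    · rintro ⟨(w : EP), hw, hwc, rfl⟩
      have hwc' : ∀ c : EP, Ω p X c = 0 → transverse g s p w c = 0 := by
        intro c hc
        refine (hgM' w c).symm.trans (hwc _ ?_)
        rw [hC]
        exact ⟨c, hc, rfl⟩
      let l : ℝ := transverse g s p w T
      have hl : l = (s p)⁻¹ * Ω p X w := (hKsymm w T).trans (hKT w)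
      let u : EP := (w : EP) - l • T
      have hθu : Ω p X u = 0 := by
        refine ((Ω p X).map_sub (w : EP) (l • T)).trans ?_
        have h1 : Ω p X (l • T) = l * s p :=
          ((Ω p X).map_smul l T).trans (congrArg (l * ·) hθT)
        have h2 : l * s p = Ω p X w := by rw [hl]; field_simp
        exact sub_eq_zero.2 (h1.trans h2).symm
      have hwu : transverse g s p w u = 0 := hwc' u hθu
      have hKu : ∀ z : EP, transverse g s p u z = transverse g s p w z - l * transverse g s p T z := by
        intro z
        have : ∀ B : EP →L[ℝ] EP →L[ℝ] ℝ, B u z = B w z - l * B T z := by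
          intro B; simp [u]
        exact this (transverse g s p)
      have huu : transverse g s p u u = 0 := by
        rw [hKu, hwu, hKT, hθu]; ring
      have hTu : (mfderiv IP I τ p u : E) = 0 := by
        by_contra h0
        exact (hs.transverse_pos h hg hpos h0).ne' huu
      have hww : transverse g s p w w = l ^ 2 := by
        have h1 : transverse g s p u w = 0 := (hKsymm u w).trans hwu
        rw [hKu, hKsymm T w] at h1
        linarith [h1, show l = transverse g s p w T from rfl, sq l]
      have hl0 : l ≠ 0 := by
        intro h0
        have := hs.transverse_pos h hg hpos (p := p) (w := w) hw
        rw [hww, h0] at this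
        simp at this
      have e1 : gM (τ p) (mfderiv IP I τ p w) (mfderiv IP I τ p w) = l ^ 2 := (hgM' w w).trans hww
      have e2 : liouvilleForm IP Ω p w = l * s p := by
        rw [hl]
        refine Eq.trans (b := Ω p X w) rfl ?_
        field_simp
      rw [mem_singleton_iff, e1, e2, Real.sqrt_sq_eq_abs, abs_mul, abs_of_pos hs0]
      have := abs_pos.2 hl0
      field_simp
    · rintro rfl
      have e1 : gM (τ p) (mfderiv IP I τ p T) (mfderiv IP I τ p T) = 1 := (hgM' T T).trans hKTT
      refine ⟨T, ?_, ?_, ?_⟩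
      · intro h0
        have h1 := hgM' T T
        rw [hKTT] at h1
        have h2 : gM (τ p) (mfderiv IP I τ p T) (mfderiv IP I τ p T) = 0 :=
          (congrArg (fun v ↦ gM (τ p) v (mfderiv IP I τ p T)) h0).trans
            (by rw [map_zero]; rfl)
        linarith
      · intro c hc
        rw [hC] at hc
        obtain ⟨c, hc, rfl⟩ := hc
        refine (hgM' T c).trans ((hKT c).trans ?_)
        exact (congrArg ((s p)⁻¹ * ·) hc).trans (mul_zero _)
      · rw [e1]
        have : liouvilleForm IP Ω p T = s p := hθT
        rw [this, Real.sqrt_one, div_one, abs_of_pos hs0]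
  rw [inducedCalibration, hset, csSup_singleton]

variable [IsManifold IP ∞ P] [IsManifold I ∞ M] [I.Boundaryless] [IP.Boundaryless]
  [FiniteDimensional ℝ E] [FiniteDimensional ℝ EP]

/-- A homogeneous almost Kähler structure with conical metric is a Kählerianization. -/
theorem IsConical.exists_isKahlerianization (hs : IsConical g s) (h : IsPrincipalBundle IP I τ)
    (hh : TwoTensor.IsHomogeneous IP Ω) (hk : IsAlmostKahler IP Ω g) :
    ∃ (C : Distribution I M) (gM : TwoTensor I M), IsKahlerianization IP I τ Ω g C gM := by
  have hΩ := hk.symplectic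
  have hg := hk.riemannian
  obtain ⟨J, hJ⟩ := hk.compatible
  obtain ⟨C, hC⟩ := h.exists_contactDistribution hh fun p ↦ hΩ.alternating p _
  obtain ⟨gM, hgM⟩ := h.exists_twoTensor_descent (hs.transverse_isInvariant h)
    hs.transverse_liouville_left (hs.transverse_liouville_right hg.symm)
  have hcal := hs.inducedCalibration_eq h hΩ.alternating hJ hg.symm hg.pos hC hgM
  have hm : g = inducedMetric IP I τ Ω C gM := by
    have h1 := (pullback_eq_transverse_iff hs gM).1 hgM
    rw [← hcal] at h1
    exact h1
  have hgM' : ∀ p (v w : EP), gM (τ p) (mfderiv IP I τ p v) (mfderiv IP I τ p w) =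
      transverse g s p v w := fun p v w ↦
    DFunLike.congr_fun (DFunLike.congr_fun (congrFun hgM p) v) w
  have hr : IsRiemannianMetric I gM := by
    refine isRiemannianMetric_of_posDef
      (h.twoTensor_smooth_of_pullback hgM fun f v hf ↦ hs.transverse_flat h hg.smooth hf) ?_ ?_
    · intro x v w
      obtain ⟨p, rfl⟩ := h.surjective x
      obtain ⟨v, rfl⟩ := h.mfderiv_surjective p v
      obtain ⟨w, rfl⟩ := h.mfderiv_surjective p w
      refine (hgM' p v w).trans (Eq.trans ?_ (hgM' p w v).symm)
      rw [transverse_apply, transverse_apply, mul_comm (g p (liouville IP p) v)]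
      exact congrArg (fun r ↦ (s p)⁻¹ * r - _) (hg.symm p v w)
    · intro x v hv
      obtain ⟨p, rfl⟩ := h.surjective x
      obtain ⟨v, rfl⟩ := h.mfderiv_surjective p v
      exact (hs.transverse_pos h hg.symm hg.pos hv).trans_eq (hgM' p v v).symm
  exact ⟨C, gM, ⟨⟨h, hΩ, hh, h.isContactDistribution hΩ hh hC, hC⟩, hr, hm ▸ hk⟩, hm⟩

end Conical

section Kahlerianization

variable {EP : Type*} [NormedAddCommGroup EP] [NormedSpace ℝ EP]
  {HP : Type*} [TopologicalSpace HP] {IP : ModelWithCorners ℝ EP HP}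
  {P : Type*} [TopologicalSpace P] [ChartedSpace HP P] [MulAction ℝˣ P]
  {E : Type*} [NormedAddCommGroup E] [NormedSpace ℝ E]
  {H : Type*} [TopologicalSpace H] {I : ModelWithCorners ℝ E H}
  {M : Type*} [TopologicalSpace M] [ChartedSpace H M] {τ : P → M}
  {Ω g : TwoTensor IP P} {s : P → ℝ} {C : Distribution I M} {gM : TwoTensor I M}

/-- The set whose supremum is the induced calibration. -/
def calibrationSet (IP : ModelWithCorners ℝ EP HP) (I : ModelWithCorners ℝ E H) (τ : P → M)
    (Ω : TwoTensor IP P) (C : Distribution I M) (g : TwoTensor I M) (p : P) : Set ℝ :=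
  {r : ℝ | ∃ w : TangentSpace IP p, mfderiv IP I τ p w ≠ 0 ∧
    (∀ c ∈ C (τ p), g (τ p) (mfderiv IP I τ p w) c = 0) ∧
    r = |liouvilleForm IP Ω p w| /
      Real.sqrt (g (τ p) (mfderiv IP I τ p w) (mfderiv IP I τ p w))}

theorem IsPrincipalBundle.mul_mem_calibrationSet (h : IsPrincipalBundle IP I τ)
    (hh : TwoTensor.IsHomogeneous IP Ω) (C : Distribution I M) (gM : TwoTensor I M) (t : ℝˣ) (p : P)
    {r : ℝ} (hr : r ∈ calibrationSet IP I τ Ω C gM p) :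
    |(t : ℝ)| * r ∈ calibrationSet IP I τ Ω C gM (t • p) := by
  obtain ⟨(w : EP), hw, hwc, rfl⟩ := hr
  have e0 := h.mfderiv_proj_smul t p w
  refine ⟨mfderiv IP IP (fun q : P ↦ t • q) p w, fun h0 ↦ hw (e0.symm.trans h0), ?_, ?_⟩
  · have key : ∀ x y (_ : x = y) (v v' : E), v = v' → (∀ c ∈ C x, gM x v c = 0) →
        ∀ c ∈ C y, gM y v' c = 0 := by
      rintro x _ rfl v _ rfl h; exact h
    exact key _ _ (h.proj_smul t p).symm _ _ e0.symm hwc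
  · have e1 := h.liouvilleForm_smul hh t p w
    have e2 : gM (τ (t • p)) (mfderiv IP I τ (t • p) (mfderiv IP IP (fun q : P ↦ t • q) p w))
        (mfderiv IP I τ (t • p) (mfderiv IP IP (fun q : P ↦ t • q) p w)) =
        gM (τ p) (mfderiv IP I τ p w) (mfderiv IP I τ p w) :=
      gM.congr_all (h.proj_smul t p) e0 e0
    refine Eq.trans ?_ (congrArg₂ (fun a b ↦ |a| / Real.sqrt b) e1.symm e2.symm)
    simp only [abs_mul]
    ring

theorem IsPrincipalBundle.inducedCalibration_smul (h : IsPrincipalBundle IP I τ)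
    (hh : TwoTensor.IsHomogeneous IP Ω) (C : Distribution I M) (gM : TwoTensor I M)
    (t : ℝˣ) (p : P) : inducedCalibration IP I τ Ω C gM (t • p) =
      |(t : ℝ)| * inducedCalibration IP I τ Ω C gM p := by
  have ht : |(t : ℝ)| ≠ 0 := abs_ne_zero.2 t.ne_zero
  have h1 : calibrationSet IP I τ Ω C gM (t • p) =
      (fun r ↦ |(t : ℝ)| • r) '' calibrationSet IP I τ Ω C gM p := by
    ext r
    constructor
    · intro hr
      have h2 := h.mul_mem_calibrationSet hh C gM t⁻¹ _ hr
      rw [inv_smul_smul] at h2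
      refine ⟨_, h2, ?_⟩
      simp only [smul_eq_mul, Units.val_inv_eq_inv_val, abs_inv]
      field_simp
    · rintro ⟨r, hr, rfl⟩
      exact h.mul_mem_calibrationSet hh C gM t p hr
  have h2 := Real.sSup_smul_of_nonneg (abs_nonneg (t : ℝ)) (calibrationSet IP I τ Ω C gM p)
  exact (congrArg sSup h1).trans h2

theorem IsPrincipalBundle.mvfderiv_liouville (h : IsPrincipalBundle IP I τ)
    (hs : ∀ (t : ℝˣ) (p : P), s (t • p) = |(t : ℝ)| * s p) {p : P}
    (hd : MDifferentiableAt IP 𝓘(ℝ, ℝ) s p) : mvfderiv IP s p (liouville IP p) = s p := by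
  have h0 : ContMDiff 𝓘(ℝ, ℝ) IP ∞ (fun t : ℝ ↦ expUnit t • p) :=
    (h.contMDiff_smul_const p).comp contMDiff_expUnit
  have hp : expUnit 0 • p = p := by rw [expUnit_zero, one_smul]
  have h1 := mfderiv_comp_apply (0 : ℝ) (hp.symm ▸ hd) (h0.mdifferentiableAt (by simp)) (1 : ℝ)
  have h2 : s ∘ (fun t : ℝ ↦ expUnit t • p) = fun t ↦ Real.exp t * s p := by
    ext t
    simp only [Function.comp, hs, expUnit_val, Real.abs_exp]
  rw [h2, mfderiv_eq_fderiv] at h1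
  have h5 : HasDerivAt (fun t ↦ Real.exp t * s p) (s p) 0 := by
    simpa using (Real.hasDerivAt_exp 0).mul_const (s p)
  have h6 : (fderiv ℝ (fun t ↦ Real.exp t * s p) 0 1 : ℝ) = s p := by
    rw [h5.hasFDerivAt.fderiv]; simp
  have h3 : ∀ q, q = p → ∀ v w : EP, v = w →
      (mfderiv IP 𝓘(ℝ, ℝ) s q v : ℝ) = mvfderiv IP s p w := by
    rintro _ rfl _ _ rfl; rfl
  exact (h3 _ hp _ _ (h.mfderiv_expUnit_smul p)).symm.trans (h1.symm.trans h6)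

theorem IsPrincipalBundle.mvfderiv_smul (h : IsPrincipalBundle IP I τ)
    (hs : ∀ (t : ℝˣ) (p : P), s (t • p) = |(t : ℝ)| * s p) {p : P}
    (hd : MDifferentiable IP 𝓘(ℝ, ℝ) s) (t : ℝˣ) (w : EP) :
    mvfderiv IP s (t • p) (mfderiv IP IP (fun q : P ↦ t • q) p w) =
      |(t : ℝ)| * mvfderiv IP s p w := by
  have h1 := mfderiv_comp_apply p (hd (t • p)) (h.mdifferentiable_const_smul t p) w
  have h2 : s ∘ (fun q : P ↦ t • q) = |(t : ℝ)| • s := by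
    ext q; exact hs t q
  rw [h2, const_smul_mfderiv (hd p)] at h1
  exact h1.symm

omit [MulAction ℝˣ P] in
theorem contMDiff_of_contDiffAt_chart [IsManifold IP ∞ P]
    (hs : ∀ p, ContDiffAt ℝ ∞ (s ∘ (extChartAt IP p).symm) (extChartAt IP p p)) :
    ContMDiff IP 𝓘(ℝ, ℝ) ∞ s := by
  intro p
  have h1 := (hs p).contMDiffAt.comp p (contMDiffAt_extChartAt (n := ∞))
  refine h1.congr_of_eventuallyEq ?_
  filter_upwards [eventually_extChartAt_symm (I := IP) p] with q hq
  simp only [Function.comp, hq]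

variable [IsManifold IP ∞ P] [IsManifold I ∞ M] [IP.Boundaryless] [FiniteDimensional ℝ EP]

/-- The metric of a Kählerianization is conical. -/
theorem IsKahlerianization.isConical (hK : IsKahlerianization IP I τ Ω g C gM) :
    IsConical g (inducedCalibration IP I τ Ω C gM) := by
  have h := hK.almostSasakian.cover.principal
  have hh := hK.almostSasakian.cover.homogeneous
  have hg : IsRiemannianMetric IP g := by
    have := hK.almostSasakian.almostKahler.riemannian
    rwa [← hK.metric_eq] at this
  set s := inducedCalibration IP I τ Ω C gM with hsdef
  have hsm : ∀ (t : ℝˣ) (p : P), s (t • p) = |(t : ℝ)| * s p :=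
    h.inducedCalibration_smul hh C gM
  have hgf : ∀ p (v w : EP), g p v w = (s p)⁻¹ * (mvfderiv IP s p v * mvfderiv IP s p w) +
      s p * gM (τ p) (mfderiv IP I τ p v) (mfderiv IP I τ p w) := fun p v w ↦
    DFunLike.congr_fun (DFunLike.congr_fun (congrFun hK.metric_eq p) v) w
  have hg0 : ∀ p (w : EP), gM (τ p) (mfderiv IP I τ p (liouville IP p)) (mfderiv IP I τ p w) = 0 :=
    fun p w ↦ (gM.congr_all rfl (h.mfderiv_proj_liouville p) rfl).trans
      (DFunLike.congr_fun ((gM (τ p)).map_zero) (mfderiv IP I τ p w))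
  have hgl : ∀ p (w : EP), g p (liouville IP p) w =
      (s p)⁻¹ * (mvfderiv IP s p (liouville IP p) * mvfderiv IP s p w) := by
    intro p w
    refine (hgf p _ w).trans ?_
    rw [hg0, mul_zero, add_zero]
  have hd0 : ∀ p, mvfderiv IP s p (liouville IP p) ≠ 0 := by
    intro p h0
    have h1 := hg.pos p _ (h.liouville_ne_zero p)
    have h2 := hgl p (liouville IP p)
    rw [h0] at h2
    simp only [mul_zero] at h2
    exact h1.ne' h2
  have hd : MDifferentiable IP 𝓘(ℝ, ℝ) s := by
    intro p
    by_contra h0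
    apply hd0 p
    have : mfderiv IP 𝓘(ℝ, ℝ) s p = 0 := mfderiv_zero_of_not_mdifferentiableAt h0
    exact DFunLike.congr_fun this _
  have hsl : ∀ p, mvfderiv IP s p (liouville IP p) = s p := fun p ↦
    h.mvfderiv_liouville hsm (hd p)
  have hs0 : ∀ p, s p ≠ 0 := fun p ↦ hsl p ▸ hd0 p
  have hself : ∀ p, g p (liouville IP p) (liouville IP p) = s p := by
    intro p
    have := hs0 p
    refine (hgl p _).trans ?_
    rw [hsl p]
    field_simp
  refine ⟨fun p ↦ (hg.pos p _ (h.liouville_ne_zero p)).trans_eq (hself p),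
    contMDiff_of_contDiffAt_chart fun p ↦ ?_, hself, fun p w ↦ ?_, hsm, fun t p v w ↦ ?_⟩
  · have h1 := h.contDiffAt_liouville_liouville hg.smooth (contMDiffAt_extChartAt_symm (I := IP) p)
    refine h1.congr_of_eventuallyEq (Filter.Eventually.of_forall fun e ↦ ?_)
    exact (hself _).symm
  · have := hs0 p
    rw [hgl, hsl]
    field_simp
  · refine (hgf (t • p) _ _).trans ?_
    rw [h.mvfderiv_smul hsm hd, h.mvfderiv_smul hsm hd, hsm, hgf p v w]
    have e0 := h.mfderiv_proj_smul t p v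
    have e1 := h.mfderiv_proj_smul t p w
    have e2 := gM.congr_all (h.proj_smul t p) e0 e1
    refine (congrArg (_ + _ * ·) e2).trans ?_
    have ht : |(t : ℝ)| ≠ 0 := abs_ne_zero.2 t.ne_zero
    field_simp

omit [IP.Boundaryless] [FiniteDimensional ℝ EP] in
theorem IsKahlerianization.isAlmostKahler (hK : IsKahlerianization IP I τ Ω g C gM) :
    IsAlmostKahler IP Ω g := by
  have := hK.almostSasakian.almostKahler
  rwa [← hK.metric_eq] at this

theorem IsKahlerianization.calibration_eq (hK : IsKahlerianization IP I τ Ω g C gM)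
    (hs : IsConical g s) : inducedCalibration IP I τ Ω C gM = s := by
  funext p
  exact (hK.isConical.self p).symm.trans (hs.self p)

theorem IsKahlerianization.pullback_eq (hK : IsKahlerianization IP I τ Ω g C gM)
    (hs : IsConical g s) : TwoTensor.pullback IP I τ gM = transverse g s := by
  rw [pullback_eq_transverse_iff hs, ← hK.calibration_eq hs]
  exact hK.metric_eq

/-- The contact distribution and the metric are determined by the Kählerianization. -/
theorem IsKahlerianization.unique {C' : Distribution I M} {gM' : TwoTensor I M}
    (hK : IsKahlerianization IP I τ Ω g C gM) (hK' : IsKahlerianization IP I τ Ω g C' gM') :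
    C' = C ∧ gM' = gM := by
  have h := hK.almostSasakian.cover.principal
  constructor
  · funext x
    obtain ⟨p, rfl⟩ := h.surjective x
    rw [hK'.almostSasakian.cover.projection, hK.almostSasakian.cover.projection]
  · have h1 := (hK'.pullback_eq hK.isConical).trans (hK.pullback_eq hK.isConical).symm
    funext x
    obtain ⟨p, rfl⟩ := h.surjective x
    ext v w
    obtain ⟨v, rfl⟩ := h.mfderiv_surjective p v
    obtain ⟨w, rfl⟩ := h.mfderiv_surjective p w
    exact DFunLike.congr_fun (DFunLike.congr_fun (congrFun h1 p) v) w

end Kahlerianization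

section ProductBundles

variable {E₁ : Type*} [NormedAddCommGroup E₁] [NormedSpace ℝ E₁]
  {H₁ : Type*} [TopologicalSpace H₁] {I₁ : ModelWithCorners ℝ E₁ H₁}
  {P₁ : Type*} [TopologicalSpace P₁] [ChartedSpace H₁ P₁] [MulAction ℝˣ P₁]
  {F₁ : Type*} [NormedAddCommGroup F₁] [NormedSpace ℝ F₁]
  {G₁ : Type*} [TopologicalSpace G₁] {K₁ : ModelWithCorners ℝ F₁ G₁}
  {M₁ : Type*} [TopologicalSpace M₁] [ChartedSpace G₁ M₁] {τ₁ : P₁ → M₁}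
  {E₂ : Type*} [NormedAddCommGroup E₂] [NormedSpace ℝ E₂]
  {H₂ : Type*} [TopologicalSpace H₂] {I₂ : ModelWithCorners ℝ E₂ H₂}
  {P₂ : Type*} [TopologicalSpace P₂] [ChartedSpace H₂ P₂] [MulAction ℝˣ P₂]
  {F₂ : Type*} [NormedAddCommGroup F₂] [NormedSpace ℝ F₂]
  {G₂ : Type*} [TopologicalSpace G₂] {K₂ : ModelWithCorners ℝ F₂ G₂}
  {M₂ : Type*} [TopologicalSpace M₂] [ChartedSpace G₂ M₂] {τ₂ : P₂ → M₂}
  {Ω₁ g₁ : TwoTensor I₁ P₁} {Ω₂ g₂ : TwoTensor I₂ P₂} {s₁ : P₁ → ℝ} {s₂ : P₂ → ℝ}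

theorem liouville_prod (h₁ : IsPrincipalBundle I₁ K₁ τ₁) (h₂ : IsPrincipalBundle I₂ K₂ τ₂)
    (p : P₁ × P₂) : (liouville (I₁.prod I₂) p : E₁ × E₂) =
      ((liouville I₁ p.1 : E₁), (liouville I₂ p.2 : E₂)) := by
  have h := mfderiv_prodMk (x := (1 : ℝˣ))
    ((h₁.contMDiff_smul_const p.1).mdifferentiableAt (by simp))
    ((h₂.contMDiff_smul_const p.2).mdifferentiableAt (by simp))
  exact DFunLike.congr_fun h (1 : ℝ)

theorem mfderiv_smul_prod (h₁ : IsPrincipalBundle I₁ K₁ τ₁) (h₂ : IsPrincipalBundle I₂ K₂ τ₂)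
    (t : ℝˣ) (p : P₁ × P₂) (w : E₁ × E₂) :
    (mfderiv (I₁.prod I₂) (I₁.prod I₂) (fun q : P₁ × P₂ ↦ t • q) p w : E₁ × E₂) =
      ((mfderiv I₁ I₁ (fun q : P₁ ↦ t • q) p.1 w.1 : E₁),
        (mfderiv I₂ I₂ (fun q : P₂ ↦ t • q) p.2 w.2 : E₂)) := by
  have h := mfderiv_prodMap (p := p) (h₁.mdifferentiable_const_smul t p.1)
    (h₂.mdifferentiable_const_smul t p.2)
  exact DFunLike.congr_fun h w

theorem TwoTensor.IsHomogeneous.prod (h₁ : IsPrincipalBundle I₁ K₁ τ₁)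
    (h₂ : IsPrincipalBundle I₂ K₂ τ₂) (hΩ₁ : TwoTensor.IsHomogeneous I₁ Ω₁)
    (hΩ₂ : TwoTensor.IsHomogeneous I₂ Ω₂) :
    TwoTensor.IsHomogeneous (I₁.prod I₂) (TwoTensor.prod I₁ I₂ Ω₁ Ω₂) := by
  intro t p
  ext (v : E₁ × E₂) (w : E₁ × E₂)
  have e1 := DFunLike.congr_fun (DFunLike.congr_fun (hΩ₁ t p.1) v.1) w.1
  have e2 := DFunLike.congr_fun (DFunLike.congr_fun (hΩ₂ t p.2) v.2) w.2
  refine ((TwoTensor.prod I₁ I₂ Ω₁ Ω₂).congr_all rfl (mfderiv_smul_prod h₁ h₂ t p v)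
    (mfderiv_smul_prod h₁ h₂ t p w)).trans ?_
  refine (TwoTensor.prod_apply Ω₁ Ω₂ (t • p) _ _).trans ?_
  refine (congrArg₂ (· + ·) e1 e2).trans ?_
  refine (mul_add (t : ℝ) (Ω₁ p.1 v.1 w.1) (Ω₂ p.2 v.2 w.2)).symm.trans ?_
  exact congrArg ((t : ℝ) * ·) (TwoTensor.prod_apply Ω₁ Ω₂ p v w).symm

omit [MulAction ℝˣ P₁] [MulAction ℝˣ P₂] in
theorem mvfderiv_add_prod {p : P₁ × P₂} (h₁ : MDifferentiableAt I₁ 𝓘(ℝ, ℝ) s₁ p.1)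
    (h₂ : MDifferentiableAt I₂ 𝓘(ℝ, ℝ) s₂ p.2) (w : E₁ × E₂) :
    mvfderiv (I₁.prod I₂) (fun q : P₁ × P₂ ↦ s₁ q.1 + s₂ q.2) p w =
      mvfderiv I₁ s₁ p.1 w.1 + mvfderiv I₂ s₂ p.2 w.2 := by
  have d1 : HasMFDerivAt (I₁.prod I₂) 𝓘(ℝ, ℝ) (fun q : P₁ × P₂ ↦ s₁ q.1) p _ :=
    HasMFDerivAt.comp p h₁.hasMFDerivAt (hasMFDerivAt_fst p)
  have d2 : HasMFDerivAt (I₁.prod I₂) 𝓘(ℝ, ℝ) (fun q : P₁ × P₂ ↦ s₂ q.2) p _ :=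
    HasMFDerivAt.comp p h₂.hasMFDerivAt (hasMFDerivAt_snd p)
  exact DFunLike.congr_fun (d1.add d2).mfderiv w

theorem prod_apply_liouville (h₁ : IsPrincipalBundle I₁ K₁ τ₁)
    (h₂ : IsPrincipalBundle I₂ K₂ τ₂) (p : P₁ × P₂) (w : E₁ × E₂) :
    TwoTensor.prod I₁ I₂ g₁ g₂ p (liouville (I₁.prod I₂) p) w =
      g₁ p.1 (liouville I₁ p.1) w.1 + g₂ p.2 (liouville I₂ p.2) w.2 :=
  ((TwoTensor.prod I₁ I₂ g₁ g₂).congr_all rfl (liouville_prod h₁ h₂ p) rfl).trans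
    (TwoTensor.prod_apply g₁ g₂ p _ w)

theorem IsConical.prod (h₁ : IsPrincipalBundle I₁ K₁ τ₁) (h₂ : IsPrincipalBundle I₂ K₂ τ₂)
    (hs₁ : IsConical g₁ s₁) (hs₂ : IsConical g₂ s₂) :
    IsConical (TwoTensor.prod I₁ I₂ g₁ g₂) (fun p ↦ s₁ p.1 + s₂ p.2) where
  pos p := add_pos (hs₁.pos _) (hs₂.pos _)
  smooth := (hs₁.smooth.comp contMDiff_fst).add (hs₂.smooth.comp contMDiff_snd)
  self p := by
    refine (prod_apply_liouville h₁ h₂ p _).trans ?_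
    have h := liouville_prod h₁ h₂ p
    have e1 := (g₁.congr_all rfl rfl (congrArg Prod.fst h)).trans (hs₁.self p.1)
    have e2 := (g₂.congr_all rfl rfl (congrArg Prod.snd h)).trans (hs₂.self p.2)
    exact congrArg₂ (· + ·) e1 e2
  apply_liouville p w := by
    refine (prod_apply_liouville h₁ h₂ p w).trans (Eq.trans ?_
      (mvfderiv_add_prod (hs₁.smooth.mdifferentiableAt (by simp))
      (hs₂.smooth.mdifferentiableAt (by simp)) w).symm)
    exact congrArg₂ (· + ·) (hs₁.apply_liouville _ _) (hs₂.apply_liouville _ _)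
  smul t p := by
    simp only [Prod.smul_fst, Prod.smul_snd, hs₁.smul, hs₂.smul]; ring
  metric t p v w := by
    refine ((TwoTensor.prod I₁ I₂ g₁ g₂).congr_all rfl (mfderiv_smul_prod h₁ h₂ t p v)
      (mfderiv_smul_prod h₁ h₂ t p w)).trans ?_
    refine (TwoTensor.prod_apply g₁ g₂ (t • p) _ _).trans ?_
    refine (congrArg₂ (· + ·) (hs₁.metric t p.1 v.1 w.1) (hs₂.metric t p.2 v.2 w.2)).trans ?_
    refine (mul_add _ _ _).symm.trans ?_
    exact congrArg (|(t : ℝ)| * ·) (TwoTensor.prod_apply g₁ g₂ p v w).symm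

omit [MulAction ℝˣ P₁] [MulAction ℝˣ P₂] in
theorem productBeta_apply (s₁ : P₁ → ℝ) (s₂ : P₂ → ℝ) (p : P₁ × P₂) (w : E₁ × E₂) :
    productBeta I₁ I₂ s₁ s₂ p w = (s₁ p.1 + s₂ p.2)⁻¹ *
      (Real.sqrt (s₂ p.2 / s₁ p.1) * mvfderiv I₁ s₁ p.1 w.1 -
        Real.sqrt (s₁ p.1 / s₂ p.2) * mvfderiv I₂ s₂ p.2 w.2) := by
  have h1 := mfderiv_fst (I := I₁) (I' := I₂) (x := p)
  have h2 := mfderiv_snd (I := I₁) (I' := I₂) (x := p)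
  change (s₁ p.1 + s₂ p.2)⁻¹ * (Real.sqrt (s₂ p.2 / s₁ p.1) *
    mvfderiv I₁ s₁ p.1 (mfderiv (I₁.prod I₂) I₁ Prod.fst p w) -
      Real.sqrt (s₁ p.1 / s₂ p.2) *
        mvfderiv I₂ s₂ p.2 (mfderiv (I₁.prod I₂) I₂ Prod.snd p w)) = _
  rw [h1, h2]
  rfl

theorem productBeta_isInvariant (h₁ : IsPrincipalBundle I₁ K₁ τ₁)
    (h₂ : IsPrincipalBundle I₂ K₂ τ₂) (hs₁ : IsConical g₁ s₁) (hs₂ : IsConical g₂ s₂) :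
    (productBeta I₁ I₂ s₁ s₂).IsInvariant := by
  intro t p w
  have ht : |(t : ℝ)| ≠ 0 := abs_ne_zero.2 t.ne_zero
  refine (congrArg (productBeta I₁ I₂ s₁ s₂ (t • p)) (mfderiv_smul_prod h₁ h₂ t p w)).trans ?_
  refine (productBeta_apply s₁ s₂ (t • p) _).trans (Eq.trans ?_ (productBeta_apply s₁ s₂ p w).symm)
  have e1 := h₁.mvfderiv_smul hs₁.smul (hs₁.smooth.mdifferentiable (by simp)) t (p := p.1) w.1
  have e2 := h₂.mvfderiv_smul hs₂.smul (hs₂.smooth.mdifferentiable (by simp)) t (p := p.2) w.2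
  have e3 : s₁ (t • p).1 = |(t : ℝ)| * s₁ p.1 := hs₁.smul t p.1
  have e4 : s₂ (t • p).2 = |(t : ℝ)| * s₂ p.2 := hs₂.smul t p.2
  rw [e3, e4, mul_div_mul_left _ _ ht, mul_div_mul_left _ _ ht]
  refine (congrArg₂ (fun a b ↦ (|(t : ℝ)| * s₁ p.1 + |(t : ℝ)| * s₂ p.2)⁻¹ *
    (Real.sqrt (s₂ p.2 / s₁ p.1) * a - Real.sqrt (s₁ p.1 / s₂ p.2) * b)) e1 e2).trans ?_
  have h3 := add_pos (hs₁.pos p.1) (hs₂.pos p.2)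
  rw [← mul_add, mul_inv]
  field_simp

theorem IsConical.exists_sq (hs₁ : IsConical g₁ s₁) (p : P₁) : ∃ r : ℝ, 0 < r ∧ s₁ p = r ^ 2 :=
  ⟨Real.sqrt (s₁ p), Real.sqrt_pos.2 (hs₁.pos p), (Real.sq_sqrt (hs₁.pos p).le).symm⟩

theorem sqrt_sq_div_sq {a b : ℝ} (ha : 0 < a) (hb : 0 < b) : Real.sqrt (a ^ 2 / b ^ 2) = a / b := by
  rw [← div_pow, Real.sqrt_sq (by positivity)]

theorem productBeta_liouville (h₁ : IsPrincipalBundle I₁ K₁ τ₁)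
    (h₂ : IsPrincipalBundle I₂ K₂ τ₂) (hs₁ : IsConical g₁ s₁) (hs₂ : IsConical g₂ s₂)
    (p : P₁ × P₂) : productBeta I₁ I₂ s₁ s₂ p (liouville (I₁.prod I₂) p) = 0 := by
  refine (congrArg (productBeta I₁ I₂ s₁ s₂ p) (liouville_prod h₁ h₂ p)).trans ?_
  refine (productBeta_apply s₁ s₂ p _).trans ?_
  have e1 : mvfderiv I₁ s₁ p.1 (liouville I₁ p.1) = s₁ p.1 :=
    (hs₁.apply_liouville _ _).symm.trans (hs₁.self _)
  have e2 : mvfderiv I₂ s₂ p.2 (liouville I₂ p.2) = s₂ p.2 :=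
    (hs₂.apply_liouville _ _).symm.trans (hs₂.self _)
  refine (congrArg₂ (fun a b ↦ (s₁ p.1 + s₂ p.2)⁻¹ *
    (Real.sqrt (s₂ p.2 / s₁ p.1) * a - Real.sqrt (s₁ p.1 / s₂ p.2) * b)) e1 e2).trans ?_
  obtain ⟨a, ha, ha'⟩ := hs₁.exists_sq p.1
  obtain ⟨b, hb, hb'⟩ := hs₂.exists_sq p.2
  rw [ha', hb', sqrt_sq_div_sq ha hb, sqrt_sq_div_sq hb ha]
  field_simp
  ring

omit [MulAction ℝˣ P₁] in
theorem OneForm.flat_mvfderiv {V : Type*} [NormedAddCommGroup V] [NormedSpace ℝ V] {f : V → P₁}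
    {v : V} (hs : MDifferentiableAt I₁ 𝓘(ℝ, ℝ) s₁ (f v))
    (hf : MDifferentiableAt 𝓘(ℝ, V) I₁ f v) (a : V) :
    mvfderiv I₁ s₁ (f v) (mfderiv 𝓘(ℝ, V) I₁ f v a) = fderiv ℝ (fun v ↦ s₁ (f v)) v a := by
  have h := mfderiv_comp_apply v hs hf a
  rw [mfderiv_eq_fderiv] at h
  exact h.symm

theorem contDiffAt_productBeta_flat [IsManifold I₁ ∞ P₁] [IsManifold I₂ ∞ P₂]
    {V : Type*} [NormedAddCommGroup V] [NormedSpace ℝ V] [FiniteDimensional ℝ V]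
    (hs₁ : IsConical g₁ s₁) (hs₂ : IsConical g₂ s₂) {f : V → P₁ × P₂} {v : V}
    (hf : ContMDiffAt 𝓘(ℝ, V) (I₁.prod I₂) ∞ f v) :
    ContDiffAt ℝ ∞ ((productBeta I₁ I₂ s₁ s₂).flat f) v := by
  refine contDiffAt_clm_of_apply fun a ↦ ?_
  have c1 : ContDiffAt ℝ ∞ (fun v ↦ s₁ (f v).1) v :=
    (hs₁.smooth.contMDiffAt.comp v hf.fst).contDiffAt
  have c2 : ContDiffAt ℝ ∞ (fun v ↦ s₂ (f v).2) v :=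
    (hs₂.smooth.contMDiffAt.comp v hf.snd).contDiffAt
  have p1 := hs₁.pos (f v).1
  have p2 := hs₂.pos (f v).2
  have k1 : ContDiffAt ℝ ∞ (fun v ↦ fderiv ℝ (fun v ↦ s₁ (f v).1) v a) v :=
    (c1.fderiv_right (m := ∞) (by simp)).clm_apply contDiffAt_const
  have k2 : ContDiffAt ℝ ∞ (fun v ↦ fderiv ℝ (fun v ↦ s₂ (f v).2) v a) v :=
    (c2.fderiv_right (m := ∞) (by simp)).clm_apply contDiffAt_const
  have key := ((c1.add c2).inv (add_pos p1 p2).ne').mul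
    ((((c2.div c1 p1.ne').sqrt (div_pos p2 p1).ne').mul k1).sub
      (((c1.div c2 p2.ne').sqrt (div_pos p1 p2).ne').mul k2))
  refine key.congr_of_eventuallyEq ?_
  filter_upwards [eventually_mdifferentiableAt hf] with u hu
  refine (productBeta_apply s₁ s₂ (f u) (mfderiv 𝓘(ℝ, V) (I₁.prod I₂) f u a)).trans ?_
  have hu1 : MDifferentiableAt 𝓘(ℝ, V) I₁ (fun v ↦ (f v).1) u := hu.fst
  have hu2 : MDifferentiableAt 𝓘(ℝ, V) I₂ (fun v ↦ (f v).2) u := hu.snd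
  have e1 := OneForm.flat_mvfderiv (hs₁.smooth.mdifferentiableAt (by simp)) hu1 a
  have e2 := OneForm.flat_mvfderiv (hs₂.smooth.mdifferentiableAt (by simp)) hu2 a
  have e3 := DFunLike.congr_fun (mfderiv_prodMk hu1 hu2) a
  have e31 : ((mfderiv 𝓘(ℝ, V) (I₁.prod I₂) f u a : E₁ × E₂).1 : E₁) =
    mfderiv 𝓘(ℝ, V) I₁ (fun v ↦ (f v).1) u a := congrArg Prod.fst e3
  have e32 : ((mfderiv 𝓘(ℝ, V) (I₁.prod I₂) f u a : E₁ × E₂).2 : E₂) =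
    mfderiv 𝓘(ℝ, V) I₂ (fun v ↦ (f v).2) u a := congrArg Prod.snd e3
  exact congrArg₂ (fun x y ↦ (s₁ (f u).1 + s₂ (f u).2)⁻¹ *
    (Real.sqrt (s₂ (f u).2 / s₁ (f u).1) * x - Real.sqrt (s₁ (f u).1 / s₂ (f u).2) * y))
    ((congrArg (mvfderiv I₁ s₁ (f u).1) e31).trans e1)
    ((congrArg (mvfderiv I₂ s₂ (f u).2) e32).trans e2)

theorem transverse_prod_sub_sq (h₁ : IsPrincipalBundle I₁ K₁ τ₁)
    (h₂ : IsPrincipalBundle I₂ K₂ τ₂) (hs₁ : IsConical g₁ s₁) (hs₂ : IsConical g₂ s₂)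
    (p : P₁ × P₂) (v w : E₁ × E₂) :
    transverse (TwoTensor.prod I₁ I₂ g₁ g₂) (fun p ↦ s₁ p.1 + s₂ p.2) p v w -
      productBeta I₁ I₂ s₁ s₂ p v * productBeta I₁ I₂ s₁ s₂ p w =
    s₁ p.1 / (s₁ p.1 + s₂ p.2) * transverse g₁ s₁ p.1 v.1 w.1 +
      s₂ p.2 / (s₁ p.1 + s₂ p.2) * transverse g₂ s₂ p.2 v.2 w.2 := by
  have e0 := transverse_apply (TwoTensor.prod I₁ I₂ g₁ g₂) (fun p ↦ s₁ p.1 + s₂ p.2) p v w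
  have e1 := TwoTensor.prod_apply g₁ g₂ p v w
  have e2 := fun w ↦ (prod_apply_liouville (g₁ := g₁) (g₂ := g₂) h₁ h₂ p w)
  rw [e1, e2, e2] at e0
  have e3 := transverse_apply g₁ s₁ p.1 v.1 w.1
  have e4 := transverse_apply g₂ s₂ p.2 v.2 w.2
  rw [e0, e3, e4, productBeta_apply, productBeta_apply]
  simp only [hs₁.apply_liouville, hs₂.apply_liouville]
  obtain ⟨a, ha, ha'⟩ := hs₁.exists_sq p.1
  obtain ⟨b, hb, hb'⟩ := hs₂.exists_sq p.2
  rw [ha', hb', sqrt_sq_div_sq ha hb, sqrt_sq_div_sq hb ha]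
  generalize g₁ p.1 v.1 w.1 = x1
  generalize g₂ p.2 v.2 w.2 = x2
  generalize mvfderiv I₁ s₁ p.1 v.1 = x3
  generalize mvfderiv I₁ s₁ p.1 w.1 = x4
  generalize mvfderiv I₂ s₂ p.2 v.2 = x5
  generalize mvfderiv I₂ s₂ p.2 w.2 = x6
  have : a ^ 2 + b ^ 2 ≠ 0 := by positivity
  field_simp
  ring

omit [MulAction ℝˣ P₁] [MulAction ℝˣ P₂] in
theorem pullback_comp_fst {gM₁ : TwoTensor K₁ M₁} (h : MDifferentiable I₁ K₁ τ₁) (p : P₁ × P₂)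
    (v w : E₁ × E₂) : TwoTensor.pullback (I₁.prod I₂) K₁ (fun q : P₁ × P₂ ↦ τ₁ q.1) gM₁ p v w =
      TwoTensor.pullback I₁ K₁ τ₁ gM₁ p.1 v.1 w.1 := by
  have d : HasMFDerivAt (I₁.prod I₂) K₁ (fun q : P₁ × P₂ ↦ τ₁ q.1) p _ :=
    HasMFDerivAt.comp p (h p.1).hasMFDerivAt (hasMFDerivAt_fst p)
  have e : ∀ v : E₁ × E₂, (mfderiv (I₁.prod I₂) K₁ (fun q : P₁ × P₂ ↦ τ₁ q.1) p v : F₁) =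
      mfderiv I₁ K₁ τ₁ p.1 v.1 := fun v ↦ DFunLike.congr_fun d.mfderiv v
  exact gM₁.congr_all rfl (e v) (e w)

omit [MulAction ℝˣ P₁] [MulAction ℝˣ P₂] in
theorem pullback_comp_snd {gM₂ : TwoTensor K₂ M₂} (h : MDifferentiable I₂ K₂ τ₂) (p : P₁ × P₂)
    (v w : E₁ × E₂) : TwoTensor.pullback (I₁.prod I₂) K₂ (fun q : P₁ × P₂ ↦ τ₂ q.2) gM₂ p v w =
      TwoTensor.pullback I₂ K₂ τ₂ gM₂ p.2 v.2 w.2 := by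
  have d : HasMFDerivAt (I₁.prod I₂) K₂ (fun q : P₁ × P₂ ↦ τ₂ q.2) p _ :=
    HasMFDerivAt.comp p (h p.2).hasMFDerivAt (hasMFDerivAt_snd p)
  have e : ∀ v : E₁ × E₂, (mfderiv (I₁.prod I₂) K₂ (fun q : P₁ × P₂ ↦ τ₂ q.2) p v : F₂) =
      mfderiv I₂ K₂ τ₂ p.2 v.2 := fun v ↦ DFunLike.congr_fun d.mfderiv v
  exact gM₂.congr_all rfl (e v) (e w)

end ProductBundles

section Slices

variable {E : Type*} [NormedAddCommGroup E] [NormedSpace ℝ E]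
  {H : Type*} [TopologicalSpace H] (I : ModelWithCorners ℝ E H)
  (X : Type*) [TopologicalSpace X] [ChartedSpace H X] [MulAction ℝˣ X]
  (N : Type*) [NormedAddCommGroup N] [NormedSpace ℝ N]

/-- A smooth slice of an action of `ℝˣ`: an equivariant identification of an invariant open set
`W` with `T × ℝˣ`, for an open set `T` of a normed space. -/
structure Slice where
  W : Set X
  T : Set N
  f : X → N
  σ : N → X
  a : X → ℝˣ
  isOpen_W : IsOpen W
  isOpen_T : IsOpen T
  mapsTo_f : ∀ x ∈ W, f x ∈ T
  mapsTo_σ : ∀ y ∈ T, σ y ∈ W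
  smul_mem : ∀ x ∈ W, ∀ s : ℝˣ, s • x ∈ W
  f_smul : ∀ x ∈ W, ∀ s : ℝˣ, f (s • x) = f x
  a_smul : ∀ x ∈ W, ∀ s : ℝˣ, a (s • x) = s * a x
  f_σ : ∀ y ∈ T, f (σ y) = y
  a_σ : ∀ y ∈ T, a (σ y) = 1
  smul_σ : ∀ x ∈ W, a x • σ (f x) = x
  contMDiffOn_f : ContMDiffOn I 𝓘(ℝ, N) ∞ f W
  contMDiffOn_a : ContMDiffOn I 𝓘(ℝ, ℝ) ∞ a W
  contMDiffOn_σ : ContMDiffOn 𝓘(ℝ, N) I ∞ σ T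

variable {I X N}

/-- The projection to the orbit space. -/
def orbitProj (X : Type*) [MulAction ℝˣ X] (x : X) : MulAction.orbitRel.Quotient ℝˣ X :=
  Quotient.mk (MulAction.orbitRel ℝˣ X) x

omit [TopologicalSpace X] [ChartedSpace H X] in
theorem orbitProj_eq_iff {x y : X} : orbitProj X x = orbitProj X y ↔ ∃ s : ℝˣ, y = s • x := by
  rw [eq_comm, orbitProj, orbitProj, Quotient.eq]
  exact exists_congr fun s ↦ eq_comm

omit [TopologicalSpace X] [ChartedSpace H X] in
theorem orbitProj_smul (s : ℝˣ) (x : X) : orbitProj X (s • x) = orbitProj X x :=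
  (orbitProj_eq_iff.2 ⟨s, rfl⟩).symm

omit [TopologicalSpace X] [ChartedSpace H X] in
theorem orbitProj_out (q : MulAction.orbitRel.Quotient ℝˣ X) :
    orbitProj X (Quotient.out q) = q := Quotient.out_eq q

omit [ChartedSpace H X] in
theorem continuous_orbitProj : Continuous (orbitProj X) := continuous_quot_mk

theorem Slice.mem_of_orbitProj_mem (c : Slice I X N) {x : X}
    (hx : orbitProj X x ∈ orbitProj X '' c.W) : x ∈ c.W := by
  obtain ⟨y, hy, hxy⟩ := hx
  obtain ⟨s, rfl⟩ := orbitProj_eq_iff.1 hxy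
  exact c.smul_mem y hy s

theorem Slice.out_mem (c : Slice I X N) {q : MulAction.orbitRel.Quotient ℝˣ X}
    (hq : q ∈ orbitProj X '' c.W) : Quotient.out q ∈ c.W :=
  c.mem_of_orbitProj_mem (by rwa [orbitProj_out])

theorem Slice.f_eq_of_orbitProj_eq (c : Slice I X N) {x y : X} (hx : x ∈ c.W)
    (h : orbitProj X x = orbitProj X y) : c.f y = c.f x := by
  obtain ⟨s, rfl⟩ := orbitProj_eq_iff.1 h
  exact c.f_smul x hx s

theorem Slice.f_out (c : Slice I X N) {x : X} (hx : x ∈ c.W) :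
    c.f (Quotient.out (orbitProj X x)) = c.f x :=
  c.f_eq_of_orbitProj_eq hx (orbitProj_out _).symm

theorem Slice.orbitProj_σ_f (c : Slice I X N) {x : X} (hx : x ∈ c.W) :
    orbitProj X (c.σ (c.f x)) = orbitProj X x := by
  conv_rhs => rw [← c.smul_σ x hx]
  rw [orbitProj_smul]

variable [ContinuousConstSMul ℝˣ X]

omit [ChartedSpace H X] in
theorem isOpenMap_orbitProj : IsOpenMap (orbitProj X) := isOpenMap_quotient_mk'_mul

/-- The chart of the orbit space defined by a slice. -/
def Slice.chart (c : Slice I X N) : OpenPartialHomeomorph (MulAction.orbitRel.Quotient ℝˣ X) N where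
  toFun q := c.f (Quotient.out q)
  invFun y := orbitProj X (c.σ y)
  source := orbitProj X '' c.W
  target := c.T
  map_source' q hq := c.mapsTo_f _ (c.out_mem hq)
  map_target' y hy := ⟨_, c.mapsTo_σ y hy, rfl⟩
  left_inv' q hq := (c.orbitProj_σ_f (c.out_mem hq)).trans (orbitProj_out q)
  right_inv' y hy := (c.f_out (c.mapsTo_σ y hy)).trans (c.f_σ y hy)
  open_source := isOpenMap_orbitProj _ c.isOpen_W
  open_target := c.isOpen_T
  continuousOn_toFun := by
    rw [continuousOn_open_iff (isOpenMap_orbitProj _ c.isOpen_W)]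
    intro V hV
    have h1 : orbitProj X '' c.W ∩ (fun q ↦ c.f (Quotient.out q)) ⁻¹' V =
        orbitProj X '' (c.W ∩ c.f ⁻¹' V) := by
      ext q
      constructor
      · rintro ⟨⟨x, hx, rfl⟩, hq⟩
        refine ⟨x, ⟨hx, ?_⟩, rfl⟩
        rw [mem_preimage, c.f_out hx] at hq
        exact hq
      · rintro ⟨x, ⟨hx, hxV⟩, rfl⟩
        refine ⟨⟨x, hx, rfl⟩, ?_⟩
        rw [mem_preimage, c.f_out hx]
        exact hxV
    rw [h1]
    exact isOpenMap_orbitProj _ (c.contMDiffOn_f.continuousOn.isOpen_inter_preimage c.isOpen_W hV)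
  continuousOn_invFun := continuous_orbitProj.comp_continuousOn c.contMDiffOn_σ.continuousOn

theorem Slice.chart_orbitProj (c : Slice I X N) {x : X} (hx : x ∈ c.W) :
    c.chart (orbitProj X x) = c.f x := c.f_out hx

/-- The charted space structure of the orbit space defined by slices. -/
@[reducible]
def sliceChartedSpace (c : X → Slice I X N) (hc : ∀ x, x ∈ (c x).W) :
    ChartedSpace N (MulAction.orbitRel.Quotient ℝˣ X) where
  atlas := range fun x ↦ (c x).chart
  chartAt q := (c (Quotient.out q)).chart
  mem_chart_source q := ⟨_, hc _, orbitProj_out q⟩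
  chart_mem_atlas _ := ⟨_, rfl⟩

theorem isManifold_sliceChartedSpace (c : X → Slice I X N) (hc : ∀ x, x ∈ (c x).W) :
    letI := sliceChartedSpace c hc
    IsManifold 𝓘(ℝ, N) ∞ (MulAction.orbitRel.Quotient ℝˣ X) := by
  let := sliceChartedSpace c hc
  refine isManifold_of_contDiffOn _ _ _ ?_
  rintro _ _ ⟨x, rfl⟩ ⟨x', rfl⟩
  simp only [modelWithCornersSelf_coe, modelWithCornersSelf_coe_symm, Function.comp_id,
    Function.id_comp, range_id, inter_univ, preimage_id]
  have hsub : ∀ y ∈ ((c x).chart.symm ≫ₕ (c x').chart).source,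
      y ∈ (c x).T ∧ (c x).σ y ∈ (c x').W := by
    intro y hy
    rw [OpenPartialHomeomorph.trans_source] at hy
    exact ⟨hy.1, (c x').mem_of_orbitProj_mem hy.2⟩
  have h1 : ContMDiffOn 𝓘(ℝ, N) 𝓘(ℝ, N) ∞ (fun y ↦ (c x').f ((c x).σ y))
      ((c x).chart.symm ≫ₕ (c x').chart).source :=
    (c x').contMDiffOn_f.comp ((c x).contMDiffOn_σ.mono fun y hy ↦ (hsub y hy).1)
      fun y hy ↦ (hsub y hy).2
  exact h1.contDiffOn.congr fun y hy ↦ (c x').chart_orbitProj (hsub y hy).2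

theorem contMDiff_orbitProj (c : X → Slice I X N) (hc : ∀ x, x ∈ (c x).W) :
    letI := sliceChartedSpace c hc
    ContMDiff I 𝓘(ℝ, N) ∞ (orbitProj X) := by
  let := sliceChartedSpace c hc
  intro x
  rw [contMDiffAt_iff_target]
  refine ⟨continuous_orbitProj.continuousAt, ?_⟩
  let c₀ := c (Quotient.out (orbitProj X x))
  have hx : x ∈ c₀.W := c₀.mem_of_orbitProj_mem ⟨_, hc _, orbitProj_out _⟩
  refine (c₀.contMDiffOn_f.contMDiffAt (c₀.isOpen_W.mem_nhds hx)).congr_of_eventuallyEq ?_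
  filter_upwards [c₀.isOpen_W.mem_nhds hx] with y hy
  exact c₀.chart_orbitProj hy

omit [ContinuousConstSMul ℝˣ X] in
theorem Slice.preimage_image (c : Slice I X N) :
    orbitProj X ⁻¹' (orbitProj X '' c.W) = c.W :=
  Subset.antisymm (fun _ hx ↦ c.mem_of_orbitProj_mem hx) (subset_preimage_image _ _)

/-- The local trivialization defined by a slice. -/
def Slice.trivialization (c : Slice I X N)
    (hsm : ContMDiff (𝓘(ℝ, ℝ).prod I) I ∞ (fun q : ℝˣ × X ↦ q.1 • q.2)) :
    Trivialization ℝˣ (orbitProj X) where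
  toFun x := (orbitProj X x, c.a x)
  invFun z := z.2 • c.σ (c.chart z.1)
  source := c.W
  target := (orbitProj X '' c.W) ×ˢ univ
  map_source' x hx := ⟨⟨x, hx, rfl⟩, mem_univ _⟩
  map_target' z hz := c.smul_mem _ (c.mapsTo_σ _ (c.chart.map_source hz.1)) _
  left_inv' x hx := by rw [c.chart_orbitProj hx, c.smul_σ x hx]
  right_inv' z hz := by
    have h1 := c.chart.map_source hz.1
    have h2 := c.mapsTo_σ _ h1
    refine Prod.ext ?_ ?_
    · exact (orbitProj_smul _ _).trans (c.chart.left_inv hz.1)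
    · simp only [c.a_smul _ h2, c.a_σ _ h1, mul_one]
  open_source := c.isOpen_W
  open_target := (isOpenMap_orbitProj _ c.isOpen_W).prod isOpen_univ
  continuousOn_toFun := continuous_orbitProj.continuousOn.prodMk c.contMDiffOn_a.continuousOn
  continuousOn_invFun := by
    refine hsm.continuous.comp_continuousOn (continuousOn_snd.prodMk ?_)
    refine c.contMDiffOn_σ.continuousOn.comp
      (c.chart.continuousOn_toFun.comp continuousOn_fst fun z hz ↦ hz.1)
      fun z hz ↦ c.chart.map_source hz.1
  baseSet := orbitProj X '' c.W
  open_baseSet := isOpenMap_orbitProj _ c.isOpen_W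
  source_eq := c.preimage_image.symm
  target_eq := rfl
  proj_toFun _ _ := rfl

theorem isPrincipalBundle_orbitProj
    (hsm : ContMDiff (𝓘(ℝ, ℝ).prod I) I ∞ (fun q : ℝˣ × X ↦ q.1 • q.2))
    (c : X → Slice I X N) (hc : ∀ x, x ∈ (c x).W) :
    letI := sliceChartedSpace c hc
    IsPrincipalBundle I 𝓘(ℝ, N) (orbitProj X) := by
  let := sliceChartedSpace c hc
  have := isManifold_sliceChartedSpace c hc
  intro q
  let c₀ := c (Quotient.out q)
  refine ⟨c₀.trivialization hsm, ⟨_, hc _, orbitProj_out q⟩, ?_, ?_, ?_⟩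
  · exact (contMDiff_orbitProj c hc).contMDiffOn.prodMk c₀.contMDiffOn_a
  · have h1 : ContMDiffOn 𝓘(ℝ, N) 𝓘(ℝ, N) ∞ c₀.chart c₀.chart.source :=
      contMDiffOn_of_mem_maximalAtlas (IsManifold.chart_mem_maximalAtlas (I := 𝓘(ℝ, N)) q)
    have h2 : ContMDiffOn (𝓘(ℝ, N).prod 𝓘(ℝ, ℝ)) 𝓘(ℝ, N) ∞
        (fun z : MulAction.orbitRel.Quotient ℝˣ X × ℝˣ ↦ c₀.chart z.1)
        ((orbitProj X '' c₀.W) ×ˢ univ) :=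
      h1.comp contMDiffOn_fst fun z hz ↦ hz.1
    have h3 := c₀.contMDiffOn_σ.comp h2 fun z hz ↦ c₀.chart.map_source hz.1
    exact hsm.comp_contMDiffOn (contMDiffOn_snd.prodMk h3)
  · intro x hx s
    refine ⟨c₀.smul_mem x hx s, Prod.ext (orbitProj_smul s x) (c₀.a_smul x hx s)⟩

end Slices

section ProductSlices

variable {E₁ : Type*} [NormedAddCommGroup E₁] [NormedSpace ℝ E₁]
  {P₁ : Type*} [TopologicalSpace P₁] [ChartedSpace E₁ P₁] [MulAction ℝˣ P₁]
  {F₁ : Type*} [NormedAddCommGroup F₁] [NormedSpace ℝ F₁]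
  {G₁ : Type*} [TopologicalSpace G₁] {K₁ : ModelWithCorners ℝ F₁ G₁}
  {M₁ : Type*} [TopologicalSpace M₁] [ChartedSpace G₁ M₁] {τ₁ : P₁ → M₁}
  {E₂ : Type*} [NormedAddCommGroup E₂] [NormedSpace ℝ E₂]
  {H₂ : Type*} [TopologicalSpace H₂] {I₂ : ModelWithCorners ℝ E₂ H₂}
  {P₂ : Type*} [TopologicalSpace P₂] [ChartedSpace H₂ P₂] [MulAction ℝˣ P₂]
  {F₂ : Type*} [NormedAddCommGroup F₂] [NormedSpace ℝ F₂]
  {M₂ : Type*} [TopologicalSpace M₂] [ChartedSpace F₂ M₂] {τ₂ : P₂ → M₂}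
  {N : Type*} [NormedAddCommGroup N] [NormedSpace ℝ N]

theorem IsPrincipalBundle.contMDiff_smul_prod (h₁ : IsPrincipalBundle 𝓘(ℝ, E₁) K₁ τ₁)
    (h₂ : IsPrincipalBundle I₂ 𝓘(ℝ, F₂) τ₂) :
    ContMDiff (𝓘(ℝ, ℝ).prod (𝓘(ℝ, E₁).prod I₂)) (𝓘(ℝ, E₁).prod I₂) ∞
      (fun q : ℝˣ × P₁ × P₂ ↦ q.1 • q.2) :=
  (h₁.contMDiff_smul.comp (contMDiff_fst.prodMk (contMDiff_fst.comp contMDiff_snd))).prodMk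
    (h₂.contMDiff_smul.comp (contMDiff_fst.prodMk (contMDiff_snd.comp contMDiff_snd)))

/-- A slice of the diagonal action on a product, given by a chart of the first factor and a local
trivialization of the second one. -/
theorem IsPrincipalBundle.exists_slice [IsManifold 𝓘(ℝ, E₁) ∞ P₁] [IsManifold 𝓘(ℝ, F₂) ∞ M₂]
    (h₁ : IsPrincipalBundle 𝓘(ℝ, E₁) K₁ τ₁)
    (h₂ : IsPrincipalBundle I₂ 𝓘(ℝ, F₂) τ₂) (L : (E₁ × F₂) ≃L[ℝ] N) (p : P₁ × P₂) :
    ∃ c : Slice (𝓘(ℝ, E₁).prod I₂) (P₁ × P₂) N, p ∈ c.W := by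
  obtain ⟨B, σ, a, hB, hx, hoB, hσ, hτσ, hp, hτ, ha, haσ, -, hs⟩ := h₂.exists_section p.2
  let ψ := chartAt E₁ p.1
  let φ := chartAt F₂ (τ₂ p.2)
  have hψ : ContMDiffOn 𝓘(ℝ, E₁) 𝓘(ℝ, E₁) ∞ ψ ψ.source := contMDiffOn_chart
  have hψ' : ContMDiffOn 𝓘(ℝ, E₁) 𝓘(ℝ, E₁) ∞ ψ.symm ψ.target := contMDiffOn_chart_symm
  have hφ : ContMDiffOn 𝓘(ℝ, F₂) 𝓘(ℝ, F₂) ∞ φ φ.source := contMDiffOn_chart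
  have hφ' : ContMDiffOn 𝓘(ℝ, F₂) 𝓘(ℝ, F₂) ∞ φ.symm φ.target := contMDiffOn_chart_symm
  have ha1 : ∀ y ∈ B, a (σ y) = 1 := by
    intro y hy
    have h0 : τ₂ (σ y) ∈ B := by rwa [hτσ y hy]
    have h1 := haσ _ h0
    rw [hτσ y hy] at h1
    have h2 := (hs _ h0 (a (σ y))).2
    rw [← h1] at h2
    exact mul_eq_right.1 h2.symm
  have hap : a p.2 = 1 := by rw [← hp]; exact ha1 _ hx
  let W₀ : Set (P₁ × P₂) := {x | τ₂ x.2 ∈ B}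
  have hW₀ : IsOpen W₀ := hoB.preimage continuous_snd
  have ha₀ : ContMDiffOn (𝓘(ℝ, E₁).prod I₂) 𝓘(ℝ, ℝ) ∞ (fun x : P₁ × P₂ ↦ a x.2) W₀ :=
    ha.comp contMDiffOn_snd fun x hx ↦ hx
  have hm : ContMDiffOn (𝓘(ℝ, E₁).prod I₂) 𝓘(ℝ, E₁) ∞ (fun x : P₁ × P₂ ↦ (a x.2)⁻¹ • x.1) W₀ :=
    h₁.contMDiff_smul.comp_contMDiffOn (ha₀.inv.prodMk contMDiffOn_fst)
  have hτ₀ : ContMDiffOn (𝓘(ℝ, E₁).prod I₂) 𝓘(ℝ, F₂) ∞ (fun x : P₁ × P₂ ↦ τ₂ x.2) W₀ :=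
    hτ.comp contMDiffOn_snd fun x hx ↦ hx
  let W : Set (P₁ × P₂) := W₀ ∩ (fun x : P₁ × P₂ ↦ ((a x.2)⁻¹ • x.1, τ₂ x.2)) ⁻¹'
    (ψ.source ×ˢ φ.source)
  have hW : IsOpen W := (hm.continuousOn.prodMk hτ₀.continuousOn).isOpen_inter_preimage hW₀
    (ψ.open_source.prod φ.open_source)
  let T₀ : Set (E₁ × F₂) := ψ.target ×ˢ (φ.target ∩ φ.symm ⁻¹' B)
  have hT₀ : IsOpen T₀ := ψ.open_target.prod
    (φ.continuousOn_symm.isOpen_inter_preimage φ.open_target hB)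
  let f₀ : P₁ × P₂ → E₁ × F₂ := fun x ↦ (ψ ((a x.2)⁻¹ • x.1), φ (τ₂ x.2))
  let σ₀ : E₁ × F₂ → P₁ × P₂ := fun y ↦ (ψ.symm y.1, σ (φ.symm y.2))
  have hinv : ∀ x ∈ W₀, ∀ s : ℝˣ, (a (s • x.2))⁻¹ • s • x.1 = (a x.2)⁻¹ • x.1 := by
    intro x hx s
    rw [(hs x.2 hx s).2, smul_smul, mul_inv, mul_comm s⁻¹, inv_mul_cancel_right]
  have hf₀ : ∀ x ∈ W, f₀ x ∈ T₀ := by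
    intro x hx
    refine ⟨ψ.map_source hx.2.1, φ.map_source hx.2.2, ?_⟩
    rw [mem_preimage, φ.left_inv hx.2.2]
    exact hx.1
  have hστ : ∀ y ∈ T₀, τ₂ (σ₀ y).2 = φ.symm y.2 := fun y hy ↦ hτσ _ hy.2.2
  have hσa : ∀ y ∈ T₀, a (σ₀ y).2 = 1 := fun y hy ↦ ha1 _ hy.2.2
  have hσ₀ : ∀ y ∈ T₀, σ₀ y ∈ W := by
    intro y hy
    refine ⟨?_, ?_, ?_⟩
    · change τ₂ (σ₀ y).2 ∈ B
      rw [hστ y hy]; exact hy.2.2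
    · change (a (σ₀ y).2)⁻¹ • (σ₀ y).1 ∈ ψ.source
      rw [hσa y hy, inv_one, one_smul]
      exact ψ.map_target hy.1
    · change τ₂ (σ₀ y).2 ∈ φ.source
      rw [hστ y hy]; exact φ.map_target hy.2.1
  have hfσ : ∀ y ∈ T₀, f₀ (σ₀ y) = y := by
    intro y hy
    refine Prod.ext ?_ ?_
    · change ψ ((a (σ₀ y).2)⁻¹ • (σ₀ y).1) = y.1
      rw [hσa y hy, inv_one, one_smul]
      exact ψ.right_inv hy.1
    · change φ (τ₂ (σ₀ y).2) = y.2
      rw [hστ y hy]; exact φ.right_inv hy.2.1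
  have hfs : ContMDiffOn (𝓘(ℝ, E₁).prod I₂) 𝓘(ℝ, E₁ × F₂) ∞ f₀ W :=
    (hψ.comp (hm.mono inter_subset_left) fun x hx ↦ hx.2.1).prodMk_space
      (hφ.comp (hτ₀.mono inter_subset_left) fun x hx ↦ hx.2.2)
  have hσs : ContMDiffOn 𝓘(ℝ, E₁ × F₂) (𝓘(ℝ, E₁).prod I₂) ∞ σ₀ T₀ :=
    (hψ'.comp contDiff_fst.contMDiff.contMDiffOn fun y hy ↦ hy.1).prodMk
      (hσ.comp (hφ'.comp contDiff_snd.contMDiff.contMDiffOn fun y hy ↦ hy.2.1)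
        fun y hy ↦ hy.2.2)
  refine ⟨{
    W := W
    T := L.symm ⁻¹' T₀
    f := fun x ↦ L (f₀ x)
    σ := fun y ↦ σ₀ (L.symm y)
    a := fun x ↦ a x.2
    isOpen_W := hW
    isOpen_T := hT₀.preimage L.symm.continuous
    mapsTo_f := fun x hx ↦ by
      rw [mem_preimage, L.symm_apply_apply]; exact hf₀ x hx
    mapsTo_σ := fun y hy ↦ hσ₀ _ hy
    smul_mem := fun x hx s ↦ ?_
    f_smul := fun x hx s ↦ ?_
    a_smul := fun x hx s ↦ (hs x.2 hx.1 s).2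
    f_σ := fun y hy ↦ by rw [hfσ _ hy, L.apply_symm_apply]
    a_σ := fun y hy ↦ hσa _ hy
    smul_σ := fun x hx ↦ ?_
    contMDiffOn_f := L.contDiff.contMDiff.comp_contMDiffOn hfs
    contMDiffOn_a := ha₀.mono inter_subset_left
    contMDiffOn_σ := hσs.comp L.symm.contDiff.contMDiff.contMDiffOn fun y hy ↦ hy }, ?_⟩
  · refine ⟨?_, ?_, ?_⟩
    · change τ₂ (s • x.2) ∈ B
      rw [(hs x.2 hx.1 s).1]; exact hx.1
    · change (a (s • x.2))⁻¹ • s • x.1 ∈ ψ.source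
      rw [hinv x hx.1]; exact hx.2.1
    · change τ₂ (s • x.2) ∈ φ.source
      rw [(hs x.2 hx.1 s).1]; exact hx.2.2
  · refine congrArg L (Prod.ext ?_ ?_)
    · exact congrArg ψ (hinv x hx.1 s)
    · exact congrArg φ (hs x.2 hx.1 s).1
  · rw [L.symm_apply_apply]
    refine Prod.ext ?_ ?_
    · change a x.2 • ψ.symm (ψ ((a x.2)⁻¹ • x.1)) = x.1
      rw [ψ.left_inv hx.2.1, smul_inv_smul]
    · change a x.2 • σ (φ.symm (φ (τ₂ x.2))) = x.2
      rw [φ.left_inv hx.2.2]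
      exact (haσ x.2 hx.1).symm
  · refine ⟨hx, ?_, mem_chart_source F₂ _⟩
    change (a p.2)⁻¹ • p.1 ∈ ψ.source
    rw [hap, inv_one, one_smul]
    exact mem_chart_source E₁ _

end ProductSlices

section Topology

variable {E₁ : Type*} [NormedAddCommGroup E₁] [NormedSpace ℝ E₁]
  {H₁ : Type*} [TopologicalSpace H₁] {I₁ : ModelWithCorners ℝ E₁ H₁}
  {P₁ : Type*} [TopologicalSpace P₁] [ChartedSpace H₁ P₁] [MulAction ℝˣ P₁]
  {F₁ : Type*} [NormedAddCommGroup F₁] [NormedSpace ℝ F₁]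
  {G₁ : Type*} [TopologicalSpace G₁] {K₁ : ModelWithCorners ℝ F₁ G₁}
  {M₁ : Type*} [TopologicalSpace M₁] [ChartedSpace G₁ M₁] {τ₁ : P₁ → M₁}
  {E₂ : Type*} [NormedAddCommGroup E₂] [NormedSpace ℝ E₂]
  {H₂ : Type*} [TopologicalSpace H₂] {I₂ : ModelWithCorners ℝ E₂ H₂}
  {P₂ : Type*} [TopologicalSpace P₂] [ChartedSpace H₂ P₂] [MulAction ℝˣ P₂]
  {F₂ : Type*} [NormedAddCommGroup F₂] [NormedSpace ℝ F₂]
  {G₂ : Type*} [TopologicalSpace G₂] {K₂ : ModelWithCorners ℝ F₂ G₂}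
  {M₂ : Type*} [TopologicalSpace M₂] [ChartedSpace G₂ M₂] {τ₂ : P₂ → M₂}

theorem IsPrincipalBundle.continuousConstSMul (h : IsPrincipalBundle I₁ K₁ τ₁) :
    ContinuousConstSMul ℝˣ P₁ := ⟨fun s ↦ (h.contMDiff_const_smul s).continuous⟩

/-- The total space of a principal bundle over a second countable base is second countable. -/
theorem IsPrincipalBundle.secondCountableTopology [SecondCountableTopology M₁]
    (h : IsPrincipalBundle I₁ K₁ τ₁) : SecondCountableTopology P₁ := by
  have : SecondCountableTopology ℝˣ :=
    Units.isOpenEmbedding_val.isEmbedding.secondCountableTopology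
  choose e he _ using h
  obtain ⟨S, hS, hcov⟩ := TopologicalSpace.countable_cover_nhds
    fun x ↦ (e x).open_baseSet.mem_nhds (he x)
  have : Countable S := hS
  have : ∀ x : S, SecondCountableTopology (e x).source := fun x ↦
    (e x).toOpenPartialHomeomorph.secondCountableTopology_source
  refine TopologicalSpace.secondCountableTopology_of_countable_cover (U := fun x : S ↦ (e x).source)
    (fun x ↦ (e x).open_source) (eq_univ_of_forall fun p ↦ ?_)
  obtain ⟨x, hx, hp⟩ := mem_iUnion₂.1 (hcov.symm ▸ mem_univ (τ₁ p) : τ₁ p ∈ _)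
  exact mem_iUnion.2 ⟨⟨x, hx⟩, (e x).mem_source.2 hp⟩

theorem IsPrincipalBundle.secondCountableTopology_productBase [SecondCountableTopology M₁]
    [SecondCountableTopology M₂] (h₁ : IsPrincipalBundle I₁ K₁ τ₁)
    (h₂ : IsPrincipalBundle I₂ K₂ τ₂) : SecondCountableTopology (ProductBase P₁ P₂) := by
  have := h₁.secondCountableTopology
  have := h₂.secondCountableTopology
  have := h₁.continuousConstSMul
  have := h₂.continuousConstSMul
  exact ContinuousConstSMul.secondCountableTopology

theorem IsPrincipalBundle.t2Space_productBase [T2Space M₁] [T2Space M₂]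
    (h₁ : IsPrincipalBundle I₁ K₁ τ₁) (h₂ : IsPrincipalBundle I₂ K₂ τ₂) :
    T2Space (ProductBase P₁ P₂) := by
  have := h₁.continuousConstSMul
  have := h₂.continuousConstSMul
  have hq : IsOpenQuotientMap (orbitProj (P₁ × P₂)) :=
    ⟨fun q ↦ ⟨_, orbitProj_out q⟩, continuous_orbitProj, isOpenMap_orbitProj⟩
  refine (t2Space_iff_of_isOpenQuotientMap hq).2 ?_
  rw [← isOpen_compl_iff, isOpen_iff_mem_nhds]
  rintro ⟨⟨p₁, p₂⟩, ⟨q₁, q₂⟩⟩ hpq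
  by_cases e1 : τ₁ p₁ = τ₁ q₁
  swap
  · have hc : Continuous fun z : (P₁ × P₂) × (P₁ × P₂) ↦ (τ₁ z.1.1, τ₁ z.2.1) :=
      (h₁.contMDiff.continuous.comp (continuous_fst.comp continuous_fst)).prodMk
        (h₁.contMDiff.continuous.comp (continuous_fst.comp continuous_snd))
    have ho : IsOpen {z : (P₁ × P₂) × (P₁ × P₂) | τ₁ z.1.1 ≠ τ₁ z.2.1} :=
      isClosed_diagonal.isOpen_compl.preimage hc
    filter_upwards [ho.mem_nhds e1] with z hz hz'
    obtain ⟨s, hs⟩ := orbitProj_eq_iff.1 hz'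
    exact hz (by rw [hs]; exact (h₁.proj_smul s z.1.1).symm)
  by_cases e2 : τ₂ p₂ = τ₂ q₂
  swap
  · have hc : Continuous fun z : (P₁ × P₂) × (P₁ × P₂) ↦ (τ₂ z.1.2, τ₂ z.2.2) :=
      (h₂.contMDiff.continuous.comp (continuous_snd.comp continuous_fst)).prodMk
        (h₂.contMDiff.continuous.comp (continuous_snd.comp continuous_snd))
    have ho : IsOpen {z : (P₁ × P₂) × (P₁ × P₂) | τ₂ z.1.2 ≠ τ₂ z.2.2} :=
      isClosed_diagonal.isOpen_compl.preimage hc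
    filter_upwards [ho.mem_nhds e2] with z hz hz'
    obtain ⟨s, hs⟩ := orbitProj_eq_iff.1 hz'
    exact hz (by rw [hs]; exact (h₂.proj_smul s z.1.2).symm)
  obtain ⟨B₁, σ₁, a₁, -, hx₁, ho₁, -, -, -, -, ha₁, hσ₁, -, hs₁⟩ := h₁.exists_section p₁
  obtain ⟨B₂, σ₂, a₂, -, hx₂, ho₂, -, -, -, -, ha₂, hσ₂, -, hs₂⟩ := h₂.exists_section p₂
  have hy₁ : τ₁ q₁ ∈ B₁ := e1 ▸ hx₁
  have hy₂ : τ₂ q₂ ∈ B₂ := e2 ▸ hx₂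
  have c₁ : ∀ p, τ₁ p ∈ B₁ → ContinuousAt a₁ p := fun p hp ↦
    (ha₁.contMDiffAt (ho₁.mem_nhds hp)).continuousAt
  have c₂ : ∀ p, τ₂ p ∈ B₂ → ContinuousAt a₂ p := fun p hp ↦
    (ha₂.contMDiffAt (ho₂.mem_nhds hp)).continuousAt
  let z₀ : (P₁ × P₂) × (P₁ × P₂) := ((p₁, p₂), (q₁, q₂))
  have d1 : ContinuousAt (fun z : (P₁ × P₂) × (P₁ × P₂) ↦ a₁ z.2.1 * (a₁ z.1.1)⁻¹) z₀ :=
    (ContinuousAt.comp (f := fun z : (P₁ × P₂) × (P₁ × P₂) ↦ z.2.1) (c₁ q₁ hy₁)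
      (by fun_prop)).mul (ContinuousAt.comp (f := fun z : (P₁ × P₂) × (P₁ × P₂) ↦ z.1.1)
        (c₁ p₁ hx₁) (by fun_prop)).inv
  have d2 : ContinuousAt (fun z : (P₁ × P₂) × (P₁ × P₂) ↦ a₂ z.2.2 * (a₂ z.1.2)⁻¹) z₀ :=
    (ContinuousAt.comp (f := fun z : (P₁ × P₂) × (P₁ × P₂) ↦ z.2.2) (c₂ q₂ hy₂)
      (by fun_prop)).mul (ContinuousAt.comp (f := fun z : (P₁ × P₂) × (P₁ × P₂) ↦ z.1.2)
        (c₂ p₂ hx₂) (by fun_prop)).inv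
  have hne : a₁ q₁ * (a₁ p₁)⁻¹ ≠ a₂ q₂ * (a₂ p₂)⁻¹ := by
    intro h
    refine hpq (orbitProj_eq_iff.2 ⟨a₁ q₁ * (a₁ p₁)⁻¹, Prod.ext ?_ ?_⟩)
    · change q₁ = (a₁ q₁ * (a₁ p₁)⁻¹) • p₁
      rw [mul_smul, inv_smul_eq_iff.2 (hσ₁ p₁ hx₁), e1]
      exact hσ₁ q₁ hy₁
    · change q₂ = (a₁ q₁ * (a₁ p₁)⁻¹) • p₂
      rw [h, mul_smul, inv_smul_eq_iff.2 (hσ₂ p₂ hx₂), e2]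
      exact hσ₂ q₂ hy₂
  have n1 : ∀ᶠ z : (P₁ × P₂) × (P₁ × P₂) in 𝓝 z₀, τ₁ z.1.1 ∈ B₁ :=
    ((continuous_fst.comp continuous_fst).continuousAt (x := z₀)).eventually (ho₁.mem_nhds hx₁)
  have n2 : ∀ᶠ z : (P₁ × P₂) × (P₁ × P₂) in 𝓝 z₀, τ₂ z.1.2 ∈ B₂ :=
    ((continuous_snd.comp continuous_fst).continuousAt (x := z₀)).eventually (ho₂.mem_nhds hx₂)
  filter_upwards [n1, n2, (d1.ne_iff_eventually_ne d2).1 hne] with z hz1 hz2 hz hz'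
  obtain ⟨s, hs⟩ := orbitProj_eq_iff.1 hz'
  have f1 : z.2.1 = s • z.1.1 := congrArg Prod.fst hs
  have f2 : z.2.2 = s • z.1.2 := congrArg Prod.snd hs
  refine hz ?_
  rw [f1, f2, (hs₁ _ hz1 s).2, (hs₂ _ hz2 s).2, mul_inv_cancel_right, mul_inv_cancel_right]

end Topology

end SasakianProduct

end

theorem mainTheorem6
    {n₁ n₂ : ℕ}
    {M₁ : Type*} [TopologicalSpace M₁] [T2Space M₁] [SecondCountableTopology M₁]
    [ChartedSpace (EuclideanSpace ℝ (Fin n₁)) M₁] [IsManifold (𝓡 n₁) ∞ M₁]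
    {M₂ : Type*} [TopologicalSpace M₂] [T2Space M₂] [SecondCountableTopology M₂]
    [ChartedSpace (EuclideanSpace ℝ (Fin n₂)) M₂] [IsManifold (𝓡 n₂) ∞ M₂]
    {P₁ : Type*} [TopologicalSpace P₁] [MulAction ℝˣ P₁]
    [ChartedSpace (EuclideanSpace ℝ (Fin (n₁ + 1))) P₁] [IsManifold (𝓡 (n₁ + 1)) ∞ P₁]
    {P₂ : Type*} [TopologicalSpace P₂] [MulAction ℝˣ P₂]
    [ChartedSpace (EuclideanSpace ℝ (Fin (n₂ + 1))) P₂] [IsManifold (𝓡 (n₂ + 1)) ∞ P₂]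
    (τ₁ : P₁ → M₁) (Ω₁ g₁ : TwoTensor (𝓡 (n₁ + 1)) P₁)
    (C₁ : Distribution (𝓡 n₁) M₁) (gM₁ : TwoTensor (𝓡 n₁) M₁)
    (τ₂ : P₂ → M₂) (Ω₂ g₂ : TwoTensor (𝓡 (n₂ + 1)) P₂)
    (C₂ : Distribution (𝓡 n₂) M₂) (gM₂ : TwoTensor (𝓡 n₂) M₂)
    (hK₁ : IsKahlerianization (𝓡 (n₁ + 1)) (𝓡 n₁) τ₁ Ω₁ g₁ C₁ gM₁)
    (hK₂ : IsKahlerianization (𝓡 (n₂ + 1)) (𝓡 n₂) τ₂ Ω₂ g₂ C₂ gM₂) :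
    T2Space (ProductBase P₁ P₂) ∧ SecondCountableTopology (ProductBase P₁ P₂) ∧
    (∃ (_ : ChartedSpace (EuclideanSpace ℝ (Fin (n₁ + n₂ + 1))) (ProductBase P₁ P₂))
      (_ : IsManifold (𝓡 (n₁ + n₂ + 1)) ∞ (ProductBase P₁ P₂)),
      IsPrincipalBundle ((𝓡 (n₁ + 1)).prod (𝓡 (n₂ + 1))) (𝓡 (n₁ + n₂ + 1))
        (productProj P₁ P₂)) ∧
    ∀ (_ : ChartedSpace (EuclideanSpace ℝ (Fin (n₁ + n₂ + 1))) (ProductBase P₁ P₂))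
      (_ : IsManifold (𝓡 (n₁ + n₂ + 1)) ∞ (ProductBase P₁ P₂)),
      IsPrincipalBundle ((𝓡 (n₁ + 1)).prod (𝓡 (n₂ + 1))) (𝓡 (n₁ + n₂ + 1))
        (productProj P₁ P₂) →
      ∃ (C : Distribution (𝓡 (n₁ + n₂ + 1)) (ProductBase P₁ P₂))
        (gM : TwoTensor (𝓡 (n₁ + n₂ + 1)) (ProductBase P₁ P₂)),
        -- the product is the Kählerianization of an almost Sasakian structure
        IsKahlerianization ((𝓡 (n₁ + 1)).prod (𝓡 (n₂ + 1))) (𝓡 (n₁ + n₂ + 1))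
          (productProj P₁ P₂) (TwoTensor.prod _ _ Ω₁ Ω₂) (TwoTensor.prod _ _ g₁ g₂) C gM ∧
        -- which is unique
        (∀ (C' : Distribution (𝓡 (n₁ + n₂ + 1)) (ProductBase P₁ P₂))
          (gM' : TwoTensor (𝓡 (n₁ + n₂ + 1)) (ProductBase P₁ P₂)),
          IsKahlerianization ((𝓡 (n₁ + 1)).prod (𝓡 (n₂ + 1))) (𝓡 (n₁ + n₂ + 1))
            (productProj P₁ P₂) (TwoTensor.prod _ _ Ω₁ Ω₂) (TwoTensor.prod _ _ g₁ g₂) C' gM' →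
          C' = C ∧ gM' = gM) ∧
        -- and Sasakian if both factors are Sasakian
        (IsSasakian (𝓡 (n₁ + 1)) (𝓡 n₁) τ₁ Ω₁ C₁ gM₁ →
          IsSasakian (𝓡 (n₂ + 1)) (𝓡 n₂) τ₂ Ω₂ C₂ gM₂ →
          IsSasakian ((𝓡 (n₁ + 1)).prod (𝓡 (n₂ + 1))) (𝓡 (n₁ + n₂ + 1))
            (productProj P₁ P₂) (TwoTensor.prod _ _ Ω₁ Ω₂) C gM) ∧
        -- the explicit form of the calibration and of the metric
        ∀ (s₁ : P₁ → ℝ) (s₂ : P₂ → ℝ),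
          s₁ = inducedCalibration (𝓡 (n₁ + 1)) (𝓡 n₁) τ₁ Ω₁ C₁ gM₁ →
          s₂ = inducedCalibration (𝓡 (n₂ + 1)) (𝓡 n₂) τ₂ Ω₂ C₂ gM₂ →
          (∀ p₁, 0 < s₁ p₁) ∧ (∀ p₂, 0 < s₂ p₂) ∧
          (∀ p : P₁ × P₂,
            inducedCalibration ((𝓡 (n₁ + 1)).prod (𝓡 (n₂ + 1))) (𝓡 (n₁ + n₂ + 1))
              (productProj P₁ P₂) (TwoTensor.prod _ _ Ω₁ Ω₂) C gM p = s₁ p.1 + s₂ p.2) ∧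
          (∀ (t : ℝˣ),
            OneForm.pullback ((𝓡 (n₁ + 1)).prod (𝓡 (n₂ + 1)))
              ((𝓡 (n₁ + 1)).prod (𝓡 (n₂ + 1))) (fun p : P₁ × P₂ ↦ t • p)
              (productBeta (𝓡 (n₁ + 1)) (𝓡 (n₂ + 1)) s₁ s₂) =
            productBeta (𝓡 (n₁ + 1)) (𝓡 (n₂ + 1)) s₁ s₂) ∧
          ∃ β₀ : OneForm (𝓡 (n₁ + n₂ + 1)) (ProductBase P₁ P₂),
            OneForm.SmoothOn (𝓡 (n₁ + n₂ + 1)) β₀ Set.univ ∧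
            OneForm.pullback ((𝓡 (n₁ + 1)).prod (𝓡 (n₂ + 1))) (𝓡 (n₁ + n₂ + 1))
              (productProj P₁ P₂) β₀ = productBeta (𝓡 (n₁ + 1)) (𝓡 (n₂ + 1)) s₁ s₂ ∧
            ∀ p : P₁ × P₂,
              TwoTensor.pullback ((𝓡 (n₁ + 1)).prod (𝓡 (n₂ + 1))) (𝓡 (n₁ + n₂ + 1))
                (productProj P₁ P₂) (gM - OneForm.sq (𝓡 (n₁ + n₂ + 1)) β₀) p =
              (s₁ p.1 / (s₁ p.1 + s₂ p.2)) •
                TwoTensor.pullback ((𝓡 (n₁ + 1)).prod (𝓡 (n₂ + 1))) (𝓡 n₁)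
                  (fun q : P₁ × P₂ ↦ τ₁ q.1) gM₁ p +
              (s₂ p.2 / (s₁ p.1 + s₂ p.2)) •
                TwoTensor.pullback ((𝓡 (n₁ + 1)).prod (𝓡 (n₂ + 1))) (𝓡 n₂)
                  (fun q : P₁ × P₂ ↦ τ₂ q.2) gM₂ p := by
  have h₁ := hK₁.almostSasakian.cover.principal
  have h₂ := hK₂.almostSasakian.cover.principal
  refine ⟨h₁.t2Space_productBase h₂, h₁.secondCountableTopology_productBase h₂, ?_, ?_⟩
  · have := h₁.continuousConstSMul
    have := h₂.continuousConstSMul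
    have hrank : Module.finrank ℝ (EuclideanSpace ℝ (Fin (n₁ + 1)) × EuclideanSpace ℝ (Fin n₂)) =
        Module.finrank ℝ (EuclideanSpace ℝ (Fin (n₁ + n₂ + 1))) := by
      simp only [Module.finrank_prod, finrank_euclideanSpace_fin]
      omega
    choose c hc using h₁.exists_slice h₂ (ContinuousLinearEquiv.ofFinrankEq hrank)
    exact ⟨sliceChartedSpace c hc, isManifold_sliceChartedSpace c hc,
      isPrincipalBundle_orbitProj (h₁.contMDiff_smul_prod h₂) c hc⟩
  · intro _ _ hp
    have hs₁ := hK₁.isConical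
    have hs₂ := hK₂.isConical
    have hs := hs₁.prod h₁ h₂ hs₂
    have hk := hK₁.isAlmostKahler.prod hK₂.isAlmostKahler
    have hh := hK₁.almostSasakian.cover.homogeneous.prod h₁ h₂
      hK₂.almostSasakian.cover.homogeneous
    obtain ⟨C, gM, hK⟩ := hs.exists_isKahlerianization hp hh hk
    refine ⟨C, gM, hK, fun C' gM' hK' ↦ hK.unique hK', fun hS₁ hS₂ ↦ ?_, ?_⟩
    · refine ⟨hK.almostSasakian, ?_⟩
      have h := hS₁.kahler.prod hS₂.kahler
      rwa [← hK₁.metric_eq, ← hK₂.metric_eq, hK.metric_eq] at h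
    · rintro s₁ s₂ rfl rfl
      have hβ := productBeta_isInvariant h₁ h₂ hs₁ hs₂
      obtain ⟨β₀, hβ₀⟩ := hp.exists_oneForm_descent hβ
        (productBeta_liouville h₁ h₂ hs₁ hs₂)
      refine ⟨hs₁.pos, hs₂.pos, congrFun (hK.calibration_eq hs), fun t ↦ ?_, β₀,
        hp.oneForm_smooth_of_pullback hβ₀ fun f v hf ↦ contDiffAt_productBeta_flat hs₁ hs₂ hf,
        hβ₀, fun p ↦ ?_⟩
      · funext p
        ext v
        exact hβ t p v
      · ext v w
        have e0 := DFunLike.congr_fun (DFunLike.congr_fun (congrFun (hK.pullback_eq hs) p) v) w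
        have e1 := DFunLike.congr_fun (congrFun hβ₀ p)
        have e2 := (pullback_comp_fst (I₂ := 𝓡 (n₂ + 1)) h₁.mdifferentiable p v w).trans (DFunLike.congr_fun
          (DFunLike.congr_fun (congrFun (hK₁.pullback_eq hs₁) p.1) _) _)
        have e3 := (pullback_comp_snd (I₁ := 𝓡 (n₁ + 1)) h₂.mdifferentiable p v w).trans (DFunLike.congr_fun
          (DFunLike.congr_fun (congrFun (hK₂.pullback_eq hs₂) p.2) _) _)
        refine (congrArg₂ (· - ·) e0 (congrArg₂ (· * ·) (e1 v) (e1 w))).trans ?_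
        refine (transverse_prod_sub_sq h₁ h₂ hs₁ hs₂ p v w).trans ?_
        exact congrArg₂ (fun a b ↦ _ * a + _ * b) e2.symm e3.symm
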